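/- Let $M$ be a connected smooth $3$-manifold with an almost contact metric structure $(\varphi,\xi,\eta,g)$: a smooth $(1,1)$-tensor field $\varphi$, a smooth vector field $\xi$, a smooth $1$-form $\eta$ and a Riemannian metric $g$ with $\varphi^2=-I+\eta\otimes\xi$, $\eta(\xi)=1$ and $g(\varphi X,\varphi Y)=g(X,Y)-\eta(X)\eta(Y)$. Put $\Phi(X,Y)=g(X,\varphi Y)$, $h=\tfrac12\mathcal L_\xi\varphi$ and $B=\varphi h$. Assume that the structure is almost Kenmotsu, i.e. $d\eta=0$ and $d\Phi=2\eta\wedge\Phi$, that $h$ is not identically zero, and let $k,\mu:M\to\mathbb R$ be smooth functions with $dk\wedge\eta=0$. Then the following are equivalent. (a) $M$ is an almost Kenmotsu generalized $(k,\mu)$-space: for all vector fields $X,Y$, $$R_{XY}\xi=k\big(\eta(Y)X-\eta(X)Y\big)+\mu\big(\eta(Y)hX-\eta(X)hY\big),$$ where $R_{XY}=[\nabla_X,\nabla_Y]-\nabla_{[X,Y]}$ is the curvature of the Levi-Civita connection $\nabla$ of $g$. (b) Every point of $M$ has an open neighbourhood $U$ with smooth coordinates $(x^1,x^2,t)$ such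 that on $U$: $k=-1-e^{-4t}$, $\mu$ depends only on $t$, $$\varphi=\sum_{i,j=1}^2\varphi^i_j\,dx^j\otimes\frac{\partial}{\partial x^i},\quad \xi=\frac{\partial}{\partial t},\quad \eta=dt,\quad g=dt\otimes dt+\sum_{i,j=1}^2 g_{ij}\,dx^i\otimes dx^j,$$ $$h=\sum_{i,j=1}^2h^i_j\,dx^j\otimes\frac{\partial}{\partial x^i},\quad B=\sum_{i,j=1}^2B^i_j\,dx^j\otimes\frac{\partial}{\partial x^i},$$ where $\varphi^i_j,g_{ij},h^i_j,B^i_j$ are functions of $t$ only; the components $\Phi_{ij}=\Phi(\partial_i,\partial_j)$, $i<j$, of $\Phi$ all vanish except $\Phi_{12}=e^{2t}$; $\sum_{s=1}^2B^i_sB^s_j=e^{-4t}\delta^i_j$; and for all $i,j\in\{1,2\}$, with $\lambda=e^{-2t}$, $$\frac{d\varphi^i_j}{dt}=2h^i_j,\qquad \frac{dh^i_j}{dt}=2\lambda^2\varphi^i_j-2h^i_j-\mu B^i_j,\qquad \frac{dB^i_j}{dt}=\mu h^i_j-2B^i_j .$$ -/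

import Mathlib

open scoped Manifold ContDiff

noncomputable section

namespace AlmostKenmotsu

open Bundle VectorField

/-- A (not necessarily smooth) vector field on the `n`-dimensional manifold `M`. -/
abbrev VecField (n : ℕ) (M : Type*) [TopologicalSpace M]
    [ChartedSpace (EuclideanSpace ℝ (Fin n)) M] : Type _ :=
  ∀ p : M, TangentSpace (𝓡 n) p

/-- A field of endomorphisms of the tangent spaces, that is, a tensor field of type `(1,1)`. -/
abbrev EndField (n : ℕ) (M : Type*) [TopologicalSpace M]
    [ChartedSpace (EuclideanSpace ℝ (Fin n)) M] : Type _ :=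
  ∀ p : M, TangentSpace (𝓡 n) p →L[ℝ] TangentSpace (𝓡 n) p

/-- A field of linear forms on the tangent spaces, that is, a `1`-form. -/
abbrev FormField (n : ℕ) (M : Type*) [TopologicalSpace M]
    [ChartedSpace (EuclideanSpace ℝ (Fin n)) M] : Type _ :=
  ∀ p : M, TangentSpace (𝓡 n) p →L[ℝ] ℝ

section Basic

variable {n : ℕ} {M : Type*} [TopologicalSpace M]
  [ChartedSpace (EuclideanSpace ℝ (Fin n)) M] [IsManifold (𝓡 n) ∞ M]

/-- The vector field `X` is differentiable at `p`. -/
abbrev DiffAt (X : VecField n M) (p : M) : Prop :=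
  MDifferentiableAt (𝓡 n) (𝓡 n).tangent (fun q ↦ (X q : TangentBundle (𝓡 n) M)) p

/-- The vector field `X` is smooth at `p`. -/
abbrev SmoothAt (X : VecField n M) (p : M) : Prop :=
  ContMDiffAt (𝓡 n) (𝓡 n).tangent ∞ (fun q ↦ (X q : TangentBundle (𝓡 n) M)) p

/-- The vector field `X` is smooth on `M`. -/
abbrev SmoothVec (X : VecField n M) : Prop :=
  ContMDiff (𝓡 n) (𝓡 n).tangent ∞ (fun q ↦ (X q : TangentBundle (𝓡 n) M))

/-- The tensor field `A` of type `(1,1)` is smooth on `M`. -/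
abbrev SmoothEnd (A : EndField n M) : Prop :=
  ContMDiff (𝓡 n)
    ((𝓡 n).prod 𝓘(ℝ, EuclideanSpace ℝ (Fin n) →L[ℝ] EuclideanSpace ℝ (Fin n))) ∞
    (fun q ↦ TotalSpace.mk' (EuclideanSpace ℝ (Fin n) →L[ℝ] EuclideanSpace ℝ (Fin n))
      (E := fun q : M ↦ TangentSpace (𝓡 n) q →L[ℝ] TangentSpace (𝓡 n) q) q (A q))

/-- The `1`-form `a` is smooth on `M`. -/
abbrev SmoothForm (a : FormField n M) : Prop :=
  ContMDiff (𝓡 n) ((𝓡 n).prod 𝓘(ℝ, EuclideanSpace ℝ (Fin n) →L[ℝ] ℝ)) ∞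
    (fun q ↦ TotalSpace.mk' (EuclideanSpace ℝ (Fin n) →L[ℝ] ℝ)
      (E := fun q : M ↦ TangentSpace (𝓡 n) q →L[ℝ] ℝ) q (a q))

end Basic

/-- Smooth Riemannian metrics on `M`; `g.inner p v w` is the value `g_p(v, w)`. -/
abbrev Metric (n : ℕ) (M : Type*) [TopologicalSpace M]
    [ChartedSpace (EuclideanSpace ℝ (Fin n)) M] [IsManifold (𝓡 n) ∞ M] : Type _ :=
  ContMDiffRiemannianMetric (𝓡 n) ∞ (EuclideanSpace ℝ (Fin n))
    (fun p : M ↦ TangentSpace (𝓡 n) p)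

/-- Affine connections on `M`; for `D : Connection n M` the vector `D Y p (X p)` is
`(∇_X Y)(p)`. -/
abbrev Connection (n : ℕ) (M : Type*) [TopologicalSpace M]
    [ChartedSpace (EuclideanSpace ℝ (Fin n)) M] [IsManifold (𝓡 n) ∞ M] : Type _ :=
  CovariantDerivative (𝓡 n) (EuclideanSpace ℝ (Fin n)) (fun p : M ↦ TangentSpace (𝓡 n) p)

/-! ### The Levi-Civita connection -/

section LeviCivita

variable {n : ℕ} {M : Type*} [TopologicalSpace M]
  [ChartedSpace (EuclideanSpace ℝ (Fin n)) M] [IsManifold (𝓡 n) ∞ M]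

/-- `D` is torsion free and compatible with `g`. -/
structure IsLeviCivita (g : Metric n M) (D : Connection n M) : Prop where
  torsion_free : ∀ (p : M) (X Y : VecField n M), DiffAt X p → DiffAt Y p →
    D Y p (X p) - D X p (Y p) = mlieBracket (𝓡 n) X Y p
  metric : ∀ (p : M) (v : TangentSpace (𝓡 n) p) (Y Z : VecField n M), DiffAt Y p → DiffAt Z p →
    mvfderiv (𝓡 n) (fun q ↦ g.inner q (Y q) (Z q)) p v =
      g.inner p (D Y p v) (Z p) + g.inner p (Y p) (D Z p v)

variable (g : Metric n M)

lemma Metric.diffAt {X Y : VecField n M} {p : M} (hX : DiffAt X p) (hY : DiffAt Y p) :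
    MDifferentiableAt (𝓡 n) 𝓘(ℝ, ℝ) (fun q ↦ g.inner q (X q) (Y q)) p := by
  let : RiemannianBundle (fun p : M ↦ TangentSpace (𝓡 n) p) := ⟨g.toRiemannianMetric⟩
  exact MDifferentiableAt.inner_bundle (F := EuclideanSpace ℝ (Fin n)) hX hY

/-- The right-hand side of the Koszul formula for `g(∇_X Y, Z)`. -/
def koszul (Y X Z : VecField n M) (p : M) : ℝ :=
  (1 / 2) * (mvfderiv (𝓡 n) (fun q ↦ g.inner q (Y q) (Z q)) p (X p)
    + mvfderiv (𝓡 n) (fun q ↦ g.inner q (X q) (Z q)) p (Y p)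
    - mvfderiv (𝓡 n) (fun q ↦ g.inner q (X q) (Y q)) p (Z p)
    + g.inner p (mlieBracket (𝓡 n) X Y p) (Z p)
    - g.inner p (mlieBracket (𝓡 n) X Z p) (Y p)
    - g.inner p (mlieBracket (𝓡 n) Y Z p) (X p))

lemma inner_smul_deriv {f : M → ℝ} {X Z : VecField n M} {p : M}
    (hf : MDifferentiableAt (𝓡 n) 𝓘(ℝ, ℝ) f p) (hX : DiffAt X p) (hZ : DiffAt Z p)
    (v : TangentSpace (𝓡 n) p) :
    mvfderiv (𝓡 n) (fun q ↦ g.inner q ((f • X) q) (Z q)) p v =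
      f p * mvfderiv (𝓡 n) (fun q ↦ g.inner q (X q) (Z q)) p v
        + mvfderiv (𝓡 n) f p v * g.inner p (X p) (Z p) := by
  have : (fun q ↦ g.inner q ((f • X) q) (Z q)) = fun q ↦ f q * g.inner q (X q) (Z q) := by
    ext q; simp
  rw [this, mvfderiv_fun_mul hf (g.diffAt hX hZ)]
  simp [mul_comm]

lemma inner_add_deriv {X X' Z : VecField n M} {p : M}
    (hX : DiffAt X p) (hX' : DiffAt X' p) (hZ : DiffAt Z p)
    (v : TangentSpace (𝓡 n) p) :
    mvfderiv (𝓡 n) (fun q ↦ g.inner q ((X + X') q) (Z q)) p v =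
      mvfderiv (𝓡 n) (fun q ↦ g.inner q (X q) (Z q)) p v
        + mvfderiv (𝓡 n) (fun q ↦ g.inner q (X' q) (Z q)) p v := by
  have : (fun q ↦ g.inner q ((X + X') q) (Z q)) =
      fun q ↦ g.inner q (X q) (Z q) + g.inner q (X' q) (Z q) := by
    ext q; simp
  rw [this, mvfderiv_fun_add (g.diffAt hX hZ) (g.diffAt hX' hZ)]
  simp

lemma inner_smul_deriv_right {f : M → ℝ} {X Z : VecField n M} {p : M}
    (hf : MDifferentiableAt (𝓡 n) 𝓘(ℝ, ℝ) f p) (hX : DiffAt X p) (hZ : DiffAt Z p)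
    (v : TangentSpace (𝓡 n) p) :
    mvfderiv (𝓡 n) (fun q ↦ g.inner q (Z q) ((f • X) q)) p v =
      f p * mvfderiv (𝓡 n) (fun q ↦ g.inner q (Z q) (X q)) p v
        + mvfderiv (𝓡 n) f p v * g.inner p (Z p) (X p) := by
  have h := inner_smul_deriv g hf hX hZ v
  simp_rw [g.symm _ _ (Z _)] at h
  exact h

lemma inner_add_deriv_right {X X' Z : VecField n M} {p : M}
    (hX : DiffAt X p) (hX' : DiffAt X' p) (hZ : DiffAt Z p)
    (v : TangentSpace (𝓡 n) p) :
    mvfderiv (𝓡 n) (fun q ↦ g.inner q (Z q) ((X + X') q)) p v =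
      mvfderiv (𝓡 n) (fun q ↦ g.inner q (Z q) (X q)) p v
        + mvfderiv (𝓡 n) (fun q ↦ g.inner q (Z q) (X' q)) p v := by
  have h := inner_add_deriv g hX hX' hZ v
  simp_rw [g.symm _ _ (Z _)] at h
  exact h

lemma koszul_tensorial_fst {Y Z : VecField n M} {p : M} (hY : DiffAt Y p) (hZ : DiffAt Z p) :
    TensorialAt (𝓡 n) (EuclideanSpace ℝ (Fin n)) (fun X ↦ koszul g Y X Z p) p where
  smul {f X} hf hX := by
    unfold koszul
    rw [inner_smul_deriv g hf hX hZ, inner_smul_deriv g hf hX hY,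
      mlieBracket_smul_left hf hX, mlieBracket_smul_left hf hX]
    simp
    ring
  add {X X'} hX hX' := by
    unfold koszul
    rw [inner_add_deriv g hX hX' hZ, inner_add_deriv g hX hX' hY,
      mlieBracket_add_left hX hX', mlieBracket_add_left hX hX']
    simp
    ring

lemma koszul_tensorial_snd {X Y : VecField n M} {p : M} (hX : DiffAt X p) (hY : DiffAt Y p) :
    TensorialAt (𝓡 n) (EuclideanSpace ℝ (Fin n)) (fun Z ↦ koszul g Y X Z p) p where
  smul {f Z} hf hZ := by
    unfold koszul
    rw [inner_smul_deriv_right g hf hZ hX, inner_smul_deriv_right g hf hZ hY,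
      mlieBracket_smul_right hf hZ, mlieBracket_smul_right hf hZ]
    simp [g.symm p (Z p)]
    ring
  add {Z Z'} hZ hZ' := by
    unfold koszul
    rw [inner_add_deriv_right g hZ hZ' hX, inner_add_deriv_right g hZ hZ' hY,
      mlieBracket_add_right hZ hZ', mlieBracket_add_right hZ hZ']
    simp
    ring

/-- A vector field, smooth near `p`, with the given value at `p`. -/
abbrev extendVec {p : M} (v : TangentSpace (𝓡 n) p) : VecField n M :=
  FiberBundle.extend (EuclideanSpace ℝ (Fin n)) v

lemma diffAt_ext {p : M} (v : TangentSpace (𝓡 n) p) : DiffAt (extendVec v) p :=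
  FiberBundle.mdifferentiableAt_extend ..

lemma flat_bijective (p : M) : Function.Bijective (g.inner p) := by
  have : FiniteDimensional ℝ (TangentSpace (𝓡 n) p) :=
    inferInstanceAs (FiniteDimensional ℝ (EuclideanSpace ℝ (Fin n)))
  have : T2Space (TangentSpace (𝓡 n) p) :=
    inferInstanceAs (T2Space (EuclideanSpace ℝ (Fin n)))
  have hinj : Function.Injective (g.inner p) := by
    rw [injective_iff_map_eq_zero]
    intro v hv
    by_contra hne
    have := g.pos p v hne
    simp [hv] at this
  have hfr : Module.finrank ℝ (TangentSpace (𝓡 n) p) =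
      Module.finrank ℝ (TangentSpace (𝓡 n) p →L[ℝ] ℝ) := by
    rw [← (LinearMap.toContinuousLinearMap (𝕜 := ℝ) (E := TangentSpace (𝓡 n) p)
      (F' := ℝ)).finrank_eq]
    exact (Subspace.dual_finrank_eq).symm
  exact ⟨hinj, ((LinearMap.injective_iff_surjective_of_finrank_eq_finrank hfr).1 hinj :
    Function.Surjective (g.inner p).toLinearMap)⟩

lemma koszul_smul {f : M → ℝ} {X Y Z : VecField n M} {p : M}
    (hf : MDifferentiableAt (𝓡 n) 𝓘(ℝ, ℝ) f p) (hX : DiffAt X p) (hY : DiffAt Y p)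
    (hZ : DiffAt Z p) :
    koszul g (f • Y) X Z p =
      f p * koszul g Y X Z p + mvfderiv (𝓡 n) f p (X p) * g.inner p (Y p) (Z p) := by
  unfold koszul
  rw [inner_smul_deriv g hf hY hZ, inner_smul_deriv_right g hf hY hX,
    mlieBracket_smul_right hf hY, mlieBracket_smul_left hf hY]
  simp [g.symm p (Y p) (X p)]
  ring

lemma koszul_add {X Y Y' Z : VecField n M} {p : M}
    (hX : DiffAt X p) (hY : DiffAt Y p) (hY' : DiffAt Y' p) (hZ : DiffAt Z p) :
    koszul g (Y + Y') X Z p = koszul g Y X Z p + koszul g Y' X Z p := by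
  unfold koszul
  rw [inner_add_deriv g hY hY' hZ, inner_add_deriv_right g hY hY' hX,
    mlieBracket_add_right hY hY', mlieBracket_add_left hY hY']
  simp
  ring

lemma exists_covDeriv (Y : VecField n M) (p : M) :
    ∃ A : TangentSpace (𝓡 n) p →L[ℝ] TangentSpace (𝓡 n) p,
      DiffAt Y p → ∀ X Z : VecField n M, DiffAt X p → DiffAt Z p →
        g.inner p (A (X p)) (Z p) = koszul g Y X Z p := by
  by_cases hY : DiffAt Y p
  swap
  · exact ⟨0, fun h ↦ absurd h hY⟩
  have : FiniteDimensional ℝ (TangentSpace (𝓡 n) p) :=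
    inferInstanceAs (FiniteDimensional ℝ (EuclideanSpace ℝ (Fin n)))
  have : T2Space (TangentSpace (𝓡 n) p) :=
    inferInstanceAs (T2Space (EuclideanSpace ℝ (Fin n)))
  let K := TensorialAt.mkHom₂ (I := 𝓡 n) (F := EuclideanSpace ℝ (Fin n))
    (F' := EuclideanSpace ℝ (Fin n)) (fun X Z : VecField n M ↦ koszul g Y X Z p) p
    (fun Z hZ ↦ koszul_tensorial_fst g hY hZ) (fun X hX ↦ koszul_tensorial_snd g hX hY)
  let e := LinearEquiv.ofBijective (g.inner p).toLinearMap (flat_bijective g p)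
  refine ⟨LinearMap.toContinuousLinearMap (e.symm.toLinearMap ∘ₗ K.toLinearMap), ?_⟩
  intro _ X Z hX hZ
  have h1 : e (e.symm (K (X p))) = K (X p) := e.apply_symm_apply _
  have h2 : K (X p) (Z p) = koszul g Y X Z p := TensorialAt.mkHom₂_apply _ _ hX hZ
  rw [← h2, ← h1]
  rfl

lemma flat_ext {p : M} {u v : TangentSpace (𝓡 n) p}
    (h : ∀ Z : VecField n M, DiffAt Z p → g.inner p u (Z p) = g.inner p v (Z p)) : u = v := by
  apply (flat_bijective g p).1
  ext w
  have := h _ (diffAt_ext w)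
  simpa using this

/-- Every Riemannian metric has a Levi-Civita connection. -/
theorem exists_isLeviCivita : ∃ D : Connection n M, IsLeviCivita g D := by
  choose D hD using exists_covDeriv g
  have hext : ∀ (Y : VecField n M) (p : M) (v : TangentSpace (𝓡 n) p) (Z : VecField n M),
      DiffAt Y p → DiffAt Z p → g.inner p (D Y p v) (Z p) = koszul g Y (extendVec v) Z p := by
    intro Y p v Z hY hZ
    have := hD Y p hY _ Z (diffAt_ext v) hZ
    simpa using this
  refine ⟨⟨D, ⟨?_, ?_⟩⟩, ⟨?_, ?_⟩⟩
  · intro Y Y' p hY hY' _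
    ext1 v
    apply flat_ext g
    intro Z hZ
    have hYY : DiffAt (Y + Y') p := mdifferentiableAt_add_section hY hY'
    rw [hext _ _ _ _ hYY hZ, koszul_add g (diffAt_ext v) hY hY' hZ]
    simp [hext _ _ _ _ hY hZ, hext _ _ _ _ hY' hZ]
  · intro Y f p hY hf _
    ext1 v
    apply flat_ext g
    intro Z hZ
    have hYY : DiffAt (f • Y) p := hf.smul_section hY
    rw [hext _ _ _ _ hYY hZ, koszul_smul g hf (diffAt_ext v) hY hZ]
    simp [hext _ _ _ _ hY hZ]
  · intro p X Y hX hY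
    apply flat_ext g
    intro Z hZ
    simp only [map_sub, _root_.sub_apply]
    rw [hD Y p hY X Z hX hZ, hD X p hX Y Z hY hZ]
    unfold koszul
    rw [mlieBracket_swap_apply (V := Y) (W := X)]
    simp_rw [g.symm _ (Y _) (X _)]
    simp
    ring
  · intro p v Y Z hY hZ
    rw [g.symm p (Y p), hext _ _ _ _ hY hZ, hext _ _ _ _ hZ hY]
    unfold koszul
    rw [mlieBracket_swap_apply (V := Z) (W := Y)]
    simp_rw [g.symm _ (Z _) (Y _)]
    simp
    ring

/-- The Levi-Civita connection of `g`. Its values on differentiable vector fields are uniquely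
determined by the two defining properties. -/
def leviCivita : Connection n M := (exists_isLeviCivita g).choose

lemma leviCivita_spec : IsLeviCivita g (leviCivita g) := (exists_isLeviCivita g).choose_spec

/-- The value at `p` of `R_{XY} Z = ∇_X ∇_Y Z - ∇_Y ∇_X Z - ∇_{[X,Y]} Z`, where `∇` is the
Levi-Civita connection of `g`. -/
def curvature (X Y Z : VecField n M) (p : M) : TangentSpace (𝓡 n) p :=
  leviCivita g (fun q ↦ leviCivita g Z q (Y q)) p (X p)
    - leviCivita g (fun q ↦ leviCivita g Z q (X q)) p (Y p)
    - leviCivita g Z p (mlieBracket (𝓡 n) X Y p)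

end LeviCivita

/-! ### Lie derivatives of tensor fields of type `(1,1)` -/

section LieDerivative

variable {n : ℕ} {M : Type*} [TopologicalSpace M]
  [ChartedSpace (EuclideanSpace ℝ (Fin n)) M] [IsManifold (𝓡 n) ∞ M]

lemma SmoothEnd.diffAt {A : EndField n M} (hA : SmoothEnd A) {X : VecField n M} {p : M}
    (hX : DiffAt X p) : DiffAt (fun q ↦ A q (X q)) p :=
  MDifferentiableAt.clm_bundle_apply (F₁ := EuclideanSpace ℝ (Fin n))
    (F₂ := EuclideanSpace ℝ (Fin n)) (hA.mdifferentiableAt (by simp)) hX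

lemma lieDerivEnd_tensorial {A : EndField n M} (hA : SmoothEnd A) (X : VecField n M) (p : M) :
    TensorialAt (𝓡 n) (EuclideanSpace ℝ (Fin n))
      (fun Y : VecField n M ↦
        mlieBracket (𝓡 n) X (fun q ↦ A q (Y q)) p - A p (mlieBracket (𝓡 n) X Y p)) p where
  smul {f Y} hf hY := by
    have h1 : (fun q ↦ A q ((f • Y) q)) = f • (fun q ↦ A q (Y q) : VecField n M) := by
      ext1 q; simp
    rw [h1, mlieBracket_smul_right hf (hA.diffAt hY), mlieBracket_smul_right hf hY]
    simp
    module
  add {Y Y'} hY hY' := by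
    have h1 : (fun q ↦ A q ((Y + Y') q)) =
        (fun q ↦ A q (Y q) : VecField n M) + (fun q ↦ A q (Y' q) : VecField n M) := by
      ext1 q; simp
    rw [h1, mlieBracket_add_right (hA.diffAt hY) (hA.diffAt hY'), mlieBracket_add_right hY hY']
    simp
    module

/-- The Lie derivative `L_X A` of a smooth tensor field `A` of type `(1,1)`: the tensor field with
`(L_X A) Y = [X, A Y] - A [X, Y]` for all vector fields `Y`. -/
def lieDerivEnd (X : VecField n M) (A : EndField n M) (hA : SmoothEnd A) : EndField n M :=
  fun p ↦ TensorialAt.mkHom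
    (fun Y : VecField n M ↦
      mlieBracket (𝓡 n) X (fun q ↦ A q (Y q)) p - A p (mlieBracket (𝓡 n) X Y p)) p
    (lieDerivEnd_tensorial hA X p)

end LieDerivative

/-! ### Almost contact metric structures -/

/-- An almost contact metric structure `(φ, ξ, η, g)` on `M`. -/
structure AlmostContactMetric (n : ℕ) (M : Type*) [TopologicalSpace M]
    [ChartedSpace (EuclideanSpace ℝ (Fin n)) M] [IsManifold (𝓡 n) ∞ M] where
  φ : EndField n M
  ξ : VecField n M
  η : FormField n M
  g : Metric n M
  smooth_φ : SmoothEnd φ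
  smooth_ξ : SmoothVec ξ
  smooth_η : SmoothForm η
  φ_φ : ∀ (p : M) (v : TangentSpace (𝓡 n) p), φ p (φ p v) = -v + η p v • ξ p
  η_ξ : ∀ p : M, η p (ξ p) = 1
  inner_φ_φ : ∀ (p : M) (v w : TangentSpace (𝓡 n) p),
    g.inner p (φ p v) (φ p w) = g.inner p v w - η p v * η p w

namespace AlmostContactMetric

variable {n : ℕ} {M : Type*} [TopologicalSpace M]
  [ChartedSpace (EuclideanSpace ℝ (Fin n)) M] [IsManifold (𝓡 n) ∞ M]
  (S : AlmostContactMetric n M)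

/-- The fundamental `2`-form `Φ(X, Y) = g(X, φ Y)`. -/
def Φ (p : M) (v w : TangentSpace (𝓡 n) p) : ℝ := S.g.inner p v (S.φ p w)

/-- The value at `p` of `dη(X, Y) = X(η(Y)) - Y(η(X)) - η([X, Y])`. -/
def dη (X Y : VecField n M) (p : M) : ℝ :=
  mvfderiv (𝓡 n) (fun q ↦ S.η q (Y q)) p (X p)
    - mvfderiv (𝓡 n) (fun q ↦ S.η q (X q)) p (Y p)
    - S.η p (mlieBracket (𝓡 n) X Y p)

/-- The value at `p` of `dΦ(X, Y, Z)`. -/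
def dΦ (X Y Z : VecField n M) (p : M) : ℝ :=
  mvfderiv (𝓡 n) (fun q ↦ S.Φ q (Y q) (Z q)) p (X p)
    + mvfderiv (𝓡 n) (fun q ↦ S.Φ q (Z q) (X q)) p (Y p)
    + mvfderiv (𝓡 n) (fun q ↦ S.Φ q (X q) (Y q)) p (Z p)
    - S.Φ p (mlieBracket (𝓡 n) X Y p) (Z p)
    - S.Φ p (mlieBracket (𝓡 n) Y Z p) (X p)
    - S.Φ p (mlieBracket (𝓡 n) Z X p) (Y p)

/-- `(η ∧ Φ)(u, v, w)`. -/
def ηwedgeΦ (p : M) (u v w : TangentSpace (𝓡 n) p) : ℝ :=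
  S.η p u * S.Φ p v w + S.η p v * S.Φ p w u + S.η p w * S.Φ p u v

/-- The structure is almost Kenmotsu: `dη = 0` and `dΦ = 2 η ∧ Φ`. Both conditions are tested at
each point `p` on arbitrary vector fields that are smooth at `p`. -/
structure IsAlmostKenmotsu : Prop where
  dη_eq_zero : ∀ (p : M) (X Y : VecField n M), SmoothAt X p → SmoothAt Y p → S.dη X Y p = 0
  dΦ_eq : ∀ (p : M) (X Y Z : VecField n M), SmoothAt X p → SmoothAt Y p → SmoothAt Z p →
    S.dΦ X Y Z p = 2 * S.ηwedgeΦ p (X p) (Y p) (Z p)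

/-- The tensor field `h = (1/2) L_ξ φ`. -/
def h : EndField n M := fun p ↦ (1 / 2 : ℝ) • lieDerivEnd S.ξ S.φ S.smooth_φ p

/-- The tensor field `B = φ ∘ h`. -/
def B : EndField n M := fun p ↦ S.φ p ∘L S.h p

/-- The generalized `(k, μ)`-nullity condition
`R_{XY} ξ = k (η(Y) X - η(X) Y) + μ (η(Y) h X - η(X) h Y)`. -/
def IsGeneralizedKMu (k μ : M → ℝ) : Prop :=
  ∀ (p : M) (X Y : VecField n M), SmoothAt X p → SmoothAt Y p →
    curvature S.g X Y S.ξ p =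
      k p • (S.η p (Y p) • X p - S.η p (X p) • Y p)
        + μ p • (S.η p (Y p) • S.h p (X p) - S.η p (X p) • S.h p (Y p))

end AlmostContactMetric

/-! ### Coordinates -/

section Coordinates

variable {n : ℕ} {M : Type*} [TopologicalSpace M]
  [ChartedSpace (EuclideanSpace ℝ (Fin n)) M]

/-- The coordinate vector field `∂/∂xⁱ` of the chart `e` (meaningful on `e.source`). -/
def coordField (e : OpenPartialHomeomorph M (EuclideanSpace ℝ (Fin n))) (i : Fin n) :
    VecField n M :=
  mpullback (𝓡 n) (𝓡 n) e
    (fun y ↦ (NormedSpace.fromTangentSpace y).symm (EuclideanSpace.single i 1))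

/-- The coordinate `1`-form `dxⁱ` of the chart `e` (meaningful on `e.source`). -/
def coordForm (e : OpenPartialHomeomorph M (EuclideanSpace ℝ (Fin n))) (i : Fin n) :
    FormField n M :=
  fun q ↦ mvfderiv (𝓡 n) (fun q' ↦ e q' i) q

end Coordinates

section NormalForm

variable {M : Type*} [TopologicalSpace M]
  [ChartedSpace (EuclideanSpace ℝ (Fin 3)) M] [IsManifold (𝓡 3) ∞ M]

/-- On the domain of `e`, the tensor field `A` of type `(1,1)` is
`∑_{i,j ≤ 2} Aⁱⱼ(t) dxʲ ⊗ ∂/∂xⁱ`, where `t = x³` is the third coordinate of `e`; here `a t` is the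
matrix of the components `Aⁱⱼ(t)`. -/
def HasComponents (e : OpenPartialHomeomorph M (EuclideanSpace ℝ (Fin 3))) (A : EndField 3 M)
    (a : ℝ → Matrix (Fin 2) (Fin 2) ℝ) : Prop :=
  ∀ q ∈ e.source, ∀ v : TangentSpace (𝓡 3) q,
    A q v = ∑ i : Fin 2, ∑ j : Fin 2,
      (a (e q 2) i j * coordForm e j.castSucc q v) • coordField e i.castSucc q

/-- The local form of the structure `S` and of the functions `k, μ` in the chart `e` with
coordinates `x¹ = e q 0`, `x² = e q 1`, `t = e q 2`. The functions `a`, `b`, `c` and `G` of `t` are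
the matrices of the components of `φ`, `h`, `B` and `g`, and `m` is `μ` as a function of `t`. -/
structure IsNormalForm (S : AlmostContactMetric 3 M) (k μ : M → ℝ)
    (e : OpenPartialHomeomorph M (EuclideanSpace ℝ (Fin 3)))
    (m : ℝ → ℝ) (a b c G : ℝ → Matrix (Fin 2) (Fin 2) ℝ) : Prop where
  k_eq : ∀ q ∈ e.source, k q = -1 - Real.exp (-4 * e q 2)
  μ_eq : ∀ q ∈ e.source, μ q = m (e q 2)
  φ_eq : HasComponents e S.φ a
  ξ_eq : ∀ q ∈ e.source, S.ξ q = coordField e 2 q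
  η_eq : ∀ q ∈ e.source, S.η q = coordForm e 2 q
  g_eq : ∀ q ∈ e.source, ∀ v w : TangentSpace (𝓡 3) q,
    S.g.inner q v w = coordForm e 2 q v * coordForm e 2 q w
      + ∑ i : Fin 2, ∑ j : Fin 2,
        G (e q 2) i j * (coordForm e i.castSucc q v * coordForm e j.castSucc q w)
  Φ_01 : ∀ q ∈ e.source, S.Φ q (coordField e 0 q) (coordField e 1 q) = Real.exp (2 * e q 2)
  Φ_02 : ∀ q ∈ e.source, S.Φ q (coordField e 0 q) (coordField e 2 q) = 0
  Φ_12 : ∀ q ∈ e.source, S.Φ q (coordField e 1 q) (coordField e 2 q) = 0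
  h_eq : HasComponents e S.h b
  B_eq : HasComponents e S.B c
  B_sq : ∀ q ∈ e.source, c (e q 2) * c (e q 2) = Real.exp (-4 * e q 2) • 1
  deriv_φ : ∀ q ∈ e.source, ∀ i j : Fin 2,
    HasDerivAt (fun t ↦ a t i j) (2 * b (e q 2) i j) (e q 2)
  deriv_h : ∀ q ∈ e.source, ∀ i j : Fin 2,
    HasDerivAt (fun t ↦ b t i j)
      (2 * Real.exp (-2 * e q 2) ^ 2 * a (e q 2) i j - 2 * b (e q 2) i j
        - m (e q 2) * c (e q 2) i j) (e q 2)
  deriv_B : ∀ q ∈ e.source, ∀ i j : Fin 2,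
    HasDerivAt (fun t ↦ c t i j) (m (e q 2) * b (e q 2) i j - 2 * c (e q 2) i j) (e q 2)

end NormalForm

end AlmostKenmotsu

end

/-! The tensor `B` controls everything. Write `P = I - η ⊗ ξ`. Closedness of `η` says that `∇ξ` is
symmetric, and `dΦ = 2η ∧ Φ` contracted with `ξ` then becomes `∇ξ = P - B` (`nabla_ξ`). Hence `B` is
symmetric, and `R(X, ξ)ξ = (L_ξ B)X - (P - B)² X` (`curvature_ξ`).

From (a) to (b): the nullity condition turns into `L_ξ B = (k + 1)P + μh - 2B + B²`. Both `B` and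
`L_ξ B` anticommute with `φ`, so the part of the right-hand side that commutes with `φ` must vanish.
This leaves `B² = -(k + 1)P` and `L_ξ B = μh - 2B` (`B_B`, `lie_B`). Differentiating the square
along `ξ` and using `dk ∧ η = 0` gives `dk = -4(k + 1)η`; on a connected manifold `k + 1` then
vanishes everywhere or nowhere, and `h ≠ 0` leaves the second case. So there is a global `t` with
`dt = η` and `k = -1 - exp(-4t)` (`exists_global_time`). With `λ = exp(-2t)`, the eigenvalues of `B`
are `λ, -λ, 0`, and there is a local orthonormal eigenframe `e₁, e₂ = -φe₁, ξ`. Its brackets are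
`[ξ, e₁] = -(1 - λ)e₁ + (μ/2)e₂`, `[ξ, e₂] = -(μ/2)e₁ - (1 + λ)e₂` and `[e₁, e₂] = 0`. The Jacobi
identity forces `dμ` to be a multiple of `dt`, so `μ = m(t)` locally. If `θ₁, θ₂` are dual to `e₁,
e₂`, a form `u(t)θ₁ + v(t)θ₂` is closed as soon as `(u, v)` solves a planar linear system. Two
solutions with determinant `λ` integrate to `x¹, x²` (`exists_frameChart`). The components of `φ, h,
B, g` are then explicit quadratic expressions in the solutions, up to powers of `exp(2t)`, and the
differential equations of (b) are the product rule (`isNormalForm_of_isFrameChart`).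

From (b) to (a): since `g` depends on `t` only, `∇_{∂ᵢ}∂ⱼ` is a multiple of `ξ` for `i, j ≤ 2`, and
symmetry of `B` gives `R(∂₁, ∂₂)ξ = 0`. The equation for `dB/dt`, together with `B² = exp(-4t)P`,
gives `R(∂ⱼ, ξ)ξ`. Tensoriality of `R(·, ·)ξ` does the rest (`curvatureHom_eq`). -/

noncomputable section

namespace AlmostKenmotsu

open Bundle VectorField Filter Topology

set_option linter.unusedSectionVars false

/-! ### Calculus of vector fields, brackets and the Levi-Civita connection -/

section

section Calculus

variable {n : ℕ} {M : Type*} [TopologicalSpace M]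
  [ChartedSpace (EuclideanSpace ℝ (Fin n)) M] [IsManifold (𝓡 n) ∞ M]

lemma SmoothAt.eventually_diffAt {X : VecField n M} {p : M} (hX : SmoothAt X p) :
    ∀ᶠ q in 𝓝 p, DiffAt X q := by
  -- Finite-order smoothness at a point spreads to a neighbourhood. At order `∞` the neighbourhood
  -- may shrink with the order, so only order one is used.
  have h := (contMDiffAt_iff_contMDiffAt_nhds (by simp)).1 (hX.of_le (m := 1) (by simp))
  filter_upwards [h] with q hq
  exact hq.mdifferentiableAt one_ne_zero

lemma SmoothAt.diffAt {X : VecField n M} {p : M} (hX : SmoothAt X p) : DiffAt X p :=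
  hX.mdifferentiableAt (by simp)

lemma SmoothVec.smoothAt {X : VecField n M} (hX : SmoothVec X) (p : M) : SmoothAt X p := hX p

lemma SmoothVec.diffAt {X : VecField n M} (hX : SmoothVec X) (p : M) : DiffAt X p :=
  (hX p).mdifferentiableAt (by simp)

lemma DiffAt.add {X Y : VecField n M} {p : M} (hX : DiffAt X p) (hY : DiffAt Y p) :
    DiffAt (fun q ↦ X q + Y q) p := mdifferentiableAt_add_section hX hY

lemma DiffAt.sub {X Y : VecField n M} {p : M} (hX : DiffAt X p) (hY : DiffAt Y p) :
    DiffAt (fun q ↦ X q - Y q) p := mdifferentiableAt_sub_section hX hY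

lemma DiffAt.smul {f : M → ℝ} {X : VecField n M} {p : M}
    (hf : MDifferentiableAt (𝓡 n) 𝓘(ℝ, ℝ) f p) (hX : DiffAt X p) :
    DiffAt (fun q ↦ f q • X q) p := hf.smul_section hX

lemma DiffAt.const_smul {X : VecField n M} {p : M} (c : ℝ) (hX : DiffAt X p) :
    DiffAt (fun q ↦ c • X q) p := MDifferentiableAt.smul_const_section (a := c) hX

lemma SmoothAt.add {X Y : VecField n M} {p : M} (hX : SmoothAt X p) (hY : SmoothAt Y p) :
    SmoothAt (fun q ↦ X q + Y q) p := ContMDiffAt.add_section hX hY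

lemma SmoothAt.sub {X Y : VecField n M} {p : M} (hX : SmoothAt X p) (hY : SmoothAt Y p) :
    SmoothAt (fun q ↦ X q - Y q) p := ContMDiffAt.sub_section hX hY

lemma SmoothAt.smul {f : M → ℝ} {X : VecField n M} {p : M}
    (hf : ContMDiffAt (𝓡 n) 𝓘(ℝ, ℝ) ∞ f p) (hX : SmoothAt X p) :
    SmoothAt (fun q ↦ f q • X q) p := ContMDiffAt.smul_section hf hX

lemma SmoothAt.const_smul {X : VecField n M} {p : M} (c : ℝ) (hX : SmoothAt X p) :
    SmoothAt (fun q ↦ c • X q) p := ContMDiffAt.const_smul_section (a := c) hX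

lemma SmoothAt.neg {X : VecField n M} {p : M} (hX : SmoothAt X p) :
    SmoothAt (fun q ↦ - X q) p := ContMDiffAt.neg_section hX

lemma DiffAt.congr {X Y : VecField n M} {p : M} (hX : DiffAt X p)
    (h : ∀ᶠ q in 𝓝 p, Y q = X q) : DiffAt Y p :=
  MDifferentiableAt.congr_of_eventuallyEq hX (h.mono fun q hq ↦ by simp [hq])

lemma SmoothAt.congr {X Y : VecField n M} {p : M} (hX : SmoothAt X p)
    (h : ∀ᶠ q in 𝓝 p, Y q = X q) : SmoothAt Y p :=
  ContMDiffAt.congr_of_eventuallyEq hX (h.mono fun q hq ↦ by simp [hq])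

lemma SmoothEnd.smoothAt {A : EndField n M} (hA : SmoothEnd A) {X : VecField n M} {p : M}
    (hX : SmoothAt X p) : SmoothAt (fun q ↦ A q (X q)) p :=
  ContMDiffAt.clm_bundle_apply (F₁ := EuclideanSpace ℝ (Fin n))
    (F₂ := EuclideanSpace ℝ (Fin n)) (hA p) hX

lemma SmoothAt.mlieBracket {X Y : VecField n M} {p : M} (hX : SmoothAt X p) (hY : SmoothAt Y p) :
    SmoothAt (mlieBracket (𝓡 n) X Y) p := by
  have : IsManifold (𝓡 n) (minSmoothness ℝ 2) M :=
    IsManifold.of_le (n := ∞) (by simp; exact WithTop.coe_le_coe.2 (le_top : (2 : ℕ∞) ≤ ⊤))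
  have : IsManifold (𝓡 n) ((⊤ : ℕ∞) + 1) M := inferInstanceAs (IsManifold (𝓡 n) ∞ M)
  have := ContMDiffAt.mlieBracket_vectorField (m := ⊤) (n := ⊤) (I := 𝓡 n) hX hY (by simp)
  exact this

lemma Metric.smoothAt (g : Metric n M) {X Y : VecField n M} {p : M}
    (hX : SmoothAt X p) (hY : SmoothAt Y p) :
    ContMDiffAt (𝓡 n) 𝓘(ℝ, ℝ) ∞ (fun q ↦ g.inner q (X q) (Y q)) p := by
  let : RiemannianBundle (fun p : M ↦ TangentSpace (𝓡 n) p) := ⟨g.toRiemannianMetric⟩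
  exact ContMDiffAt.inner_bundle (F := EuclideanSpace ℝ (Fin n)) hX hY

lemma smoothAt_ext {p : M} (v : TangentSpace (𝓡 n) p) : SmoothAt (extendVec v) p :=
  FiberBundle.contMDiffAt_extend ..

lemma mvfderiv_congr {f f' : M → ℝ} {p : M} (h : ∀ᶠ q in 𝓝 p, f q = f' q) :
    mvfderiv (𝓡 n) f p = mvfderiv (𝓡 n) f' p := by
  have h0 : f p = f' p := h.self_of_nhds
  unfold mvfderiv
  have := Filter.EventuallyEq.mfderiv_eq (I := 𝓡 n) (I' := 𝓘(ℝ, ℝ)) h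
  ext v
  simp [this]
  rfl

lemma mvfderiv_eventually_const {f : M → ℝ} {p : M} {c : ℝ} (h : ∀ᶠ q in 𝓝 p, f q = c)
    (v : TangentSpace (𝓡 n) p) : mvfderiv (𝓡 n) f p v = 0 := by
  rw [mvfderiv_congr h, mvfderiv_const]
  rfl

section LC
variable (g : Metric n M)

lemma leviCivita_congr {X Y : VecField n M} {p : M} (hX : DiffAt X p)
    (h : ∀ᶠ q in 𝓝 p, X q = Y q) : leviCivita g X p = leviCivita g Y p :=
  (leviCivita g).isCovariantDerivativeOn.congr_of_eventuallyEq hX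
    (hX.congr (h.mono fun _ h ↦ h.symm)) Filter.univ_mem h

lemma leviCivita_add {X Y : VecField n M} {p : M} (hX : DiffAt X p) (hY : DiffAt Y p)
    (v : TangentSpace (𝓡 n) p) :
    leviCivita g (fun q ↦ X q + Y q) p v = leviCivita g X p v + leviCivita g Y p v := by
  have := (leviCivita g).isCovariantDerivativeOn.add (x := p) hX hY
  exact DFunLike.congr_fun this v

lemma leviCivita_smul {f : M → ℝ} {X : VecField n M} {p : M}
    (hf : MDifferentiableAt (𝓡 n) 𝓘(ℝ, ℝ) f p) (hX : DiffAt X p) (v : TangentSpace (𝓡 n) p) :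
    leviCivita g (fun q ↦ f q • X q) p v =
      f p • leviCivita g X p v + mvfderiv (𝓡 n) f p v • X p := by
  have := (leviCivita g).isCovariantDerivativeOn.leibniz (x := p) hX hf
  exact DFunLike.congr_fun this v

lemma leviCivita_torsion {X Y : VecField n M} {p : M} (hX : DiffAt X p) (hY : DiffAt Y p) :
    leviCivita g Y p (X p) - leviCivita g X p (Y p) = mlieBracket (𝓡 n) X Y p :=
  (leviCivita_spec g).torsion_free p X Y hX hY

lemma leviCivita_metric {Y Z : VecField n M} {p : M} (hY : DiffAt Y p) (hZ : DiffAt Z p)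
    (v : TangentSpace (𝓡 n) p) :
    mvfderiv (𝓡 n) (fun q ↦ g.inner q (Y q) (Z q)) p v =
      g.inner p (leviCivita g Y p v) (Z p) + g.inner p (Y p) (leviCivita g Z p v) :=
  (leviCivita_spec g).metric p v Y Z hY hZ

lemma leviCivita_sub {X Y : VecField n M} {p : M} (hX : DiffAt X p) (hY : DiffAt Y p)
    (v : TangentSpace (𝓡 n) p) :
    leviCivita g (fun q ↦ X q - Y q) p v = leviCivita g X p v - leviCivita g Y p v := by
  have h := leviCivita_add g (hX.sub hY) hY v
  rw [eq_sub_iff_add_eq, ← h]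
  simp

lemma inner_ext {p : M} {u v : TangentSpace (𝓡 n) p}
    (h : ∀ w : TangentSpace (𝓡 n) p, g.inner p u w = g.inner p v w) : u = v :=
  (flat_bijective g p).1 (ContinuousLinearMap.ext h)

end LC

lemma mlieBracket_fun_smul_right {f : M → ℝ} {X Y : VecField n M} {p : M}
    (hf : MDifferentiableAt (𝓡 n) 𝓘(ℝ, ℝ) f p) (hY : DiffAt Y p) :
    mlieBracket (𝓡 n) X (fun q ↦ f q • Y q) p =
      f p • mlieBracket (𝓡 n) X Y p + mvfderiv (𝓡 n) f p (X p) • Y p := by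
  have := mlieBracket_smul_right (V := X) hf hY
  rw [add_comm]
  exact this

lemma mlieBracket_fun_add_right {X Y Z : VecField n M} {p : M} (hY : DiffAt Y p)
    (hZ : DiffAt Z p) :
    mlieBracket (𝓡 n) X (fun q ↦ Y q + Z q) p =
      mlieBracket (𝓡 n) X Y p + mlieBracket (𝓡 n) X Z p :=
  mlieBracket_add_right hY hZ

lemma mlieBracket_congr_right {X Y Z : VecField n M} {p : M} (h : ∀ᶠ q in 𝓝 p, Y q = Z q) :
    mlieBracket (𝓡 n) X Y p = mlieBracket (𝓡 n) X Z p :=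
  Filter.EventuallyEq.mlieBracket_vectorField_eq (Eventually.of_forall fun _ ↦ rfl) h

lemma mlieBracket_eq_zero_of_eventually {X Y : VecField n M} {p : M}
    (h : ∀ᶠ q in 𝓝 p, Y q = 0) : mlieBracket (𝓡 n) X Y p = 0 := by
  rw [mlieBracket_congr_right (Z := 0) (h.mono fun q hq ↦ by simpa using hq)]
  simp

/-- A field of endomorphisms that preserves smoothness of vector fields at points preserves their
differentiability. -/
lemma diffAt_apply_of_smoothAt {A : EndField n M} {p : M}
    (hA : ∀ X : VecField n M, SmoothAt X p → SmoothAt (fun q ↦ A q (X q)) p)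
    {X : VecField n M} (hX : DiffAt X p) : DiffAt (fun q ↦ A q (X q)) p := by
  let e := trivializationAt (EuclideanSpace ℝ (Fin n)) (TangentSpace (𝓡 n) : M → Type _) p
  let b := (EuclideanSpace.basisFun (Fin n) ℝ).toBasis
  have hp : p ∈ e.baseSet := FiberBundle.mem_baseSet_trivializationAt' p
  have h1 : ∀ᶠ q in 𝓝 p, X q = ∑ i, e.localFrameCoeff (𝓡 n) b i q (X q) • e.localFrame b i q :=
    e.eventually_eq_localFrame_sum_coeff_smul b hp
  -- The hypothesis on `A` is applied to the frame fields only, which are smooth at `p`; the field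
  -- `X` enters through its differentiable coefficients.
  have h2 : DiffAt (fun q ↦ ∑ i,
      e.localFrameCoeff (𝓡 n) b i q (X q) • A q (e.localFrame b i q)) p := by
    refine MDifferentiableAt.sum_section fun i _ ↦ DiffAt.smul ?_ ?_
    · exact mdifferentiableAt_localFrameCoeff b hp hX i
    · refine SmoothAt.diffAt (hA _ ?_)
      exact contMDiffAt_localFrame_of_mem (e := e) ∞ b i hp
  refine h2.congr (h1.mono fun q hq ↦ ?_)
  conv_lhs => rw [hq]
  simp

end Calculus

namespace AlmostContactMetric

variable {n : ℕ} {M : Type*} [TopologicalSpace M]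
  [ChartedSpace (EuclideanSpace ℝ (Fin n)) M] [IsManifold (𝓡 n) ∞ M]
  (S : AlmostContactMetric n M)

lemma h_apply {Y : VecField n M} {p : M} (hY : DiffAt Y p) :
    S.h p (Y p) = (1 / 2 : ℝ) • (mlieBracket (𝓡 n) S.ξ (fun q ↦ S.φ q (Y q)) p
      - S.φ p (mlieBracket (𝓡 n) S.ξ Y p)) := by
  have := TensorialAt.mkHom_apply (lieDerivEnd_tensorial S.smooth_φ S.ξ p) hY
  simp only [h, lieDerivEnd, _root_.smul_apply, this]

lemma smoothAt_φ {X : VecField n M} {p : M} (hX : SmoothAt X p) :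
    SmoothAt (fun q ↦ S.φ q (X q)) p := S.smooth_φ.smoothAt hX

lemma diffAt_φ {X : VecField n M} {p : M} (hX : DiffAt X p) :
    DiffAt (fun q ↦ S.φ q (X q)) p := S.smooth_φ.diffAt hX

lemma smoothAt_h {X : VecField n M} {p : M} (hX : SmoothAt X p) :
    SmoothAt (fun q ↦ S.h q (X q)) p := by
  refine SmoothAt.congr (X := fun q ↦ (1 / 2 : ℝ) • (mlieBracket (𝓡 n) S.ξ (fun q ↦ S.φ q (X q)) q
      - S.φ q (mlieBracket (𝓡 n) S.ξ X q))) ?_ ?_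
  · refine SmoothAt.const_smul _ (SmoothAt.sub ?_ ?_)
    · exact SmoothAt.mlieBracket (S.smooth_ξ p) (S.smoothAt_φ hX)
    · exact S.smoothAt_φ (SmoothAt.mlieBracket (S.smooth_ξ p) hX)
  · exact hX.eventually_diffAt.mono fun q hq ↦ S.h_apply hq

/-- The bracket formula for `h` differentiates `X`, so it cannot show this directly; tensoriality,
through a smooth frame, is what removes the loss of a derivative. -/
lemma diffAt_h {X : VecField n M} {p : M} (hX : DiffAt X p) :
    DiffAt (fun q ↦ S.h q (X q)) p :=
  diffAt_apply_of_smoothAt (fun _ hX ↦ S.smoothAt_h hX) hX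

lemma smoothAt_B {X : VecField n M} {p : M} (hX : SmoothAt X p) :
    SmoothAt (fun q ↦ S.B q (X q)) p := S.smoothAt_φ (S.smoothAt_h hX)

lemma diffAt_B {X : VecField n M} {p : M} (hX : DiffAt X p) :
    DiffAt (fun q ↦ S.B q (X q)) p := S.diffAt_φ (S.diffAt_h hX)

end AlmostContactMetric

end

/-! ### Algebra of the structure and the formula for `∇ξ` -/

section

namespace AlmostContactMetric

variable {n : ℕ} {M : Type*} [TopologicalSpace M]
  [ChartedSpace (EuclideanSpace ℝ (Fin n)) M] [IsManifold (𝓡 n) ∞ M]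
  (S : AlmostContactMetric n M)

/-- Since `φ²ξ = 0`, computing `φ³ξ` gives `φξ = cξ` with `c = η(φξ)`. Applying `φ` once more gives
`c² = 0`, so `φξ = 0`. Computing `φ³v` in two ways then leaves `η(φv)ξ = 0`. -/
lemma η_φ (p : M) (v : TangentSpace (𝓡 n) p) : S.η p (S.φ p v) = 0 := by
  have h1 := S.φ_φ p (S.φ p v)
  rw [S.φ_φ p v] at h1
  have h2 := S.φ_φ p (S.ξ p)
  rw [S.η_ξ, one_smul, neg_add_cancel] at h2
  have h3 := S.φ_φ p (S.φ p (S.ξ p))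
  rw [h2, map_zero] at h3
  have h4 := congrArg (S.η p) h3
  simp only [map_zero, map_add, map_neg, map_smul, S.η_ξ, smul_eq_mul, mul_one,
    neg_add_cancel] at h4
  have h5 : S.φ p (S.ξ p) = S.η p (S.φ p (S.ξ p)) • S.ξ p := by
    rw [eq_comm, ← sub_eq_zero, sub_eq_neg_add]
    exact h3.symm
  have h6 : S.η p (S.φ p (S.ξ p)) = 0 := by
    have h7 : S.η p (S.φ p (S.ξ p)) • S.φ p (S.ξ p) = 0 := by
      rw [← map_smul, ← h5, h2]
    rw [h5, smul_smul, smul_eq_zero] at h7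
    rcases h7 with h7 | h7
    · simpa [S.η_ξ] using h7
    · have := S.η_ξ p
      simp [h7] at this
  rw [h6, zero_smul] at h5
  simp only [map_add, map_neg, map_smul, h5, smul_zero, add_zero] at h1
  have h8 : S.η p (S.φ p v) • S.ξ p = 0 := by
    simpa using h1
  have := congrArg (S.η p) h8
  simpa [S.η_ξ] using this

lemma φ_ξ (p : M) : S.φ p (S.ξ p) = 0 := by
  have h2 := S.φ_φ p (S.ξ p)
  rw [S.η_ξ, one_smul, neg_add_cancel] at h2
  have h3 := S.φ_φ p (S.φ p (S.ξ p))
  rw [h2, map_zero, S.η_φ, zero_smul, add_zero] at h3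
  simpa using h3.symm

lemma inner_ξ (p : M) (v : TangentSpace (𝓡 n) p) : S.g.inner p (S.ξ p) v = S.η p v := by
  have := S.inner_φ_φ p (S.ξ p) v
  rw [S.φ_ξ, S.η_ξ] at this
  simp at this
  linarith

lemma inner_ξ_right (p : M) (v : TangentSpace (𝓡 n) p) : S.g.inner p v (S.ξ p) = S.η p v := by
  rw [S.g.symm, S.inner_ξ]

lemma inner_φ_left (p : M) (v w : TangentSpace (𝓡 n) p) :
    S.g.inner p (S.φ p v) w = - S.g.inner p v (S.φ p w) := by
  have h := S.inner_φ_φ p v (S.φ p w)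
  rw [S.φ_φ, S.η_φ] at h
  simp only [map_add, map_neg, map_smul, S.inner_ξ_right, S.η_φ, smul_eq_mul] at h
  linarith

lemma smoothAt_η {X : VecField n M} {p : M} (hX : SmoothAt X p) :
    ContMDiffAt (𝓡 n) 𝓘(ℝ, ℝ) ∞ (fun q ↦ S.η q (X q)) p := by
  simp_rw [← S.inner_ξ]
  exact S.g.smoothAt (S.smooth_ξ p) hX

lemma diffAt_η {X : VecField n M} {p : M} (hX : DiffAt X p) :
    MDifferentiableAt (𝓡 n) 𝓘(ℝ, ℝ) (fun q ↦ S.η q (X q)) p := by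
  simp_rw [← S.inner_ξ]
  exact S.g.diffAt (S.smooth_ξ.diffAt p) hX

/-- The horizontal projection `v - η(v) ξ`. -/
def proj (p : M) (v : TangentSpace (𝓡 n) p) : TangentSpace (𝓡 n) p := v - S.η p v • S.ξ p

lemma φ_φ' (p : M) (v : TangentSpace (𝓡 n) p) : S.φ p (S.φ p v) = - S.proj p v := by
  rw [S.φ_φ, proj]; abel

variable {S}

namespace IsAlmostKenmotsu

variable (hS : S.IsAlmostKenmotsu)
include hS

lemma η_mlieBracket {X : VecField n M} {Y : VecField n M} {p : M} (hX : SmoothAt X p)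
    (hY : SmoothAt Y p) :
    S.η p (mlieBracket (𝓡 n) X Y p) = mvfderiv (𝓡 n) (fun q ↦ S.η q (Y q)) p (X p)
      - mvfderiv (𝓡 n) (fun q ↦ S.η q (X q)) p (Y p) := by
  have := hS.dη_eq_zero p X Y hX hY
  unfold dη at this
  linarith

lemma η_lie {Y : VecField n M} {p : M} (hY : SmoothAt Y p) :
    S.η p (mlieBracket (𝓡 n) S.ξ Y p) = mvfderiv (𝓡 n) (fun q ↦ S.η q (Y q)) p (S.ξ p) := by
  rw [hS.η_mlieBracket (S.smooth_ξ p) hY]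
  simp [S.η_ξ, mvfderiv_const]

/-- The reason is `L_ξ` applied to `φ² = -I + η ⊗ ξ`: the right-hand side has zero Lie derivative
because `dη = 0` and `η(ξ) = 1` give `L_ξ η = 0`. -/
lemma h_φ (p : M) (v : TangentSpace (𝓡 n) p) : S.h p (S.φ p v) = - S.φ p (S.h p v) := by
  set Y : VecField n M := extendVec v
  have hY : SmoothAt Y p := smoothAt_ext v
  have hYp : Y p = v := by simp [Y]
  have h1 := S.h_apply (S.diffAt_φ hY.diffAt)
  have h2 := S.h_apply hY.diffAt
  have h3 := hS.η_lie hY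
  have h4 : mlieBracket (𝓡 n) S.ξ (fun q ↦ S.φ q (S.φ q (Y q))) p =
      mvfderiv (𝓡 n) (fun q ↦ S.η q (Y q)) p (S.ξ p) • S.ξ p - mlieBracket (𝓡 n) S.ξ Y p := by
    have : (fun q ↦ S.φ q (S.φ q (Y q))) =
        fun q ↦ (-1 : ℝ) • Y q + S.η q (Y q) • S.ξ q := by
      ext1 q
      rw [S.φ_φ]; simp
    rw [this, mlieBracket_fun_add_right (hY.diffAt.const_smul _)
      (DiffAt.smul (S.diffAt_η hY.diffAt) (S.smooth_ξ.diffAt p)),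
      mlieBracket_fun_smul_right (mdifferentiableAt_const) hY.diffAt,
      mlieBracket_fun_smul_right (S.diffAt_η hY.diffAt) (S.smooth_ξ.diffAt p)]
    simp [mvfderiv_const]
    abel
  rw [h4] at h1
  rw [hYp] at h1 h2
  rw [h1, h2]
  simp only [map_smul, map_sub, S.φ_φ, h3]
  module

lemma h_ξ (p : M) : S.h p (S.ξ p) = 0 := by
  rw [S.h_apply (S.smooth_ξ.diffAt p)]
  have : (fun q ↦ S.φ q (S.ξ q)) = (0 : VecField n M) := by
    ext1 q; simp [S.φ_ξ]
  rw [this]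
  simp

/-- For a metric, torsion-free connection, `dη(X, Y) = g(∇_X ξ, Y) - g(∇_Y ξ, X)`. -/
lemma nabla_ξ_symm (p : M) (v w : TangentSpace (𝓡 n) p) :
    S.g.inner p (leviCivita S.g S.ξ p v) w = S.g.inner p (leviCivita S.g S.ξ p w) v := by
  set X : VecField n M := extendVec v
  set Y : VecField n M := extendVec w
  have hX : SmoothAt X p := smoothAt_ext v
  have hY : SmoothAt Y p := smoothAt_ext w
  have hXp : X p = v := by simp [X]
  have hYp : Y p = w := by simp [Y]
  have h := hS.η_mlieBracket hX hY
  simp_rw [← S.inner_ξ] at h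
  rw [leviCivita_metric S.g (S.smooth_ξ.diffAt p) hY.diffAt,
    leviCivita_metric S.g (S.smooth_ξ.diffAt p) hX.diffAt,
    ← leviCivita_torsion S.g hX.diffAt hY.diffAt, map_sub, hXp, hYp] at h
  linarith

/-- As `Φ(ξ, ·) = 0`, the condition on `dΦ` evaluated at `(ξ, Y, Z)` reads `L_ξ Φ = 2Φ`. Expanding
`Φ = g(·, φ·)` with `L_ξ φ = 2h` and the symmetry of `∇ξ` gives `2g(∇_{φZ} ξ, Y) + 2g(Y, hZ) = 2g(Y,
φZ)`. -/
lemma nabla_φ (p : M) (v : TangentSpace (𝓡 n) p) :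
    leviCivita S.g S.ξ p (S.φ p v) = S.φ p v - S.h p v := by
  apply inner_ext S.g
  intro w
  set Z : VecField n M := extendVec v
  set Y : VecField n M := extendVec w
  have hZ : SmoothAt Z p := smoothAt_ext v
  have hY : SmoothAt Y p := smoothAt_ext w
  have hZp : Z p = v := by simp [Z]
  have hYp : Y p = w := by simp [Y]
  have hξ := S.smooth_ξ.diffAt p
  have h := hS.dΦ_eq p S.ξ Y Z (S.smooth_ξ p) hY hZ
  have e1 : ∀ q (u : TangentSpace (𝓡 n) q), S.Φ q u (S.ξ q) = 0 := by
    intro q u; simp [Φ, S.φ_ξ]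
  have e2 : ∀ q (u : TangentSpace (𝓡 n) q), S.Φ q (S.ξ q) u = 0 := by
    intro q u; rw [Φ, S.inner_ξ, S.η_φ]
  simp only [dΦ, ηwedgeΦ, e1, e2, mvfderiv_const, S.η_ξ] at h
  simp only [Φ] at h
  rw [leviCivita_metric S.g hY.diffAt (S.diffAt_φ hZ.diffAt), ← leviCivita_torsion S.g hξ hY.diffAt,
    ← S.g.symm _ (S.φ p (Y p)), S.inner_φ_left, mlieBracket_swap_apply (V := Z)] at h
  have t := leviCivita_torsion S.g hξ (S.diffAt_φ hZ.diffAt)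
  have t2 := S.h_apply hZ.diffAt
  rw [← t] at t2
  have t3 := congrArg (fun u ↦ S.g.inner p w u) t2
  have t4 := hS.nabla_ξ_symm p w (S.φ p v)
  simp only [hYp, hZp, map_sub, map_smul, map_neg, smul_eq_mul,
    _root_.zero_apply, _root_.sub_apply] at h t3 t4 ⊢
  rw [S.g.symm p _ w, S.g.symm p _ w, S.g.symm p _ w]
  rw [S.g.symm p _ w] at t4
  linarith

lemma h_eq (p : M) (v : TangentSpace (𝓡 n) p) :
    S.h p v = S.φ p v - leviCivita S.g S.ξ p (S.φ p v) := by
  rw [hS.nabla_φ]; abel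

/-- By symmetry `g(∇_ξ ξ, w) = g(∇_w ξ, ξ)`, which is half the derivative of `|ξ|² = 1`. -/
lemma nabla_ξ_ξ (p : M) : leviCivita S.g S.ξ p (S.ξ p) = 0 := by
  apply inner_ext S.g
  intro w
  rw [hS.nabla_ξ_symm]
  have hξ := S.smooth_ξ.diffAt p
  have h := leviCivita_metric S.g hξ hξ w
  simp only [S.inner_ξ, S.η_ξ, mvfderiv_const, S.inner_ξ_right] at h ⊢
  simp only [_root_.zero_apply, map_zero] at h ⊢
  linarith

/-- `nabla_φ` is evaluated at `φv`: `φ²` is minus the horizontal projection, `hφ = -B`, and `∇_ξ ξ =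
0` makes the projection harmless. -/
lemma nabla_ξ (p : M) (v : TangentSpace (𝓡 n) p) :
    leviCivita S.g S.ξ p v = S.proj p v - S.B p v := by
  have h := hS.nabla_φ p (S.φ p v)
  rw [S.φ_φ', hS.h_φ] at h
  have h2 : leviCivita S.g S.ξ p (S.proj p v) = leviCivita S.g S.ξ p v := by
    simp [proj, hS.nabla_ξ_ξ]
  rw [map_neg, h2] at h
  rw [← neg_inj, h]
  simp [B]
  abel

lemma η_nabla_ξ (p : M) (v : TangentSpace (𝓡 n) p) : S.η p (leviCivita S.g S.ξ p v) = 0 := by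
  rw [← S.inner_ξ, S.g.symm, hS.nabla_ξ_symm, hS.nabla_ξ_ξ]
  simp

lemma η_h (p : M) (v : TangentSpace (𝓡 n) p) : S.η p (S.h p v) = 0 := by
  rw [hS.h_eq, map_sub, S.η_φ, hS.η_nabla_ξ, sub_zero]

lemma η_B (p : M) (v : TangentSpace (𝓡 n) p) : S.η p (S.B p v) = 0 := S.η_φ p _

lemma B_ξ (p : M) : S.B p (S.ξ p) = 0 := by simp [B, hS.h_ξ]

lemma φ_B (p : M) (v : TangentSpace (𝓡 n) p) : S.φ p (S.B p v) = - S.h p v := by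
  simp [B, S.φ_φ, hS.η_h]

lemma B_φ (p : M) (v : TangentSpace (𝓡 n) p) : S.B p (S.φ p v) = S.h p v := by
  simp [B, hS.h_φ, S.φ_φ, hS.η_h]

/-- Both `∇ξ` and the horizontal projection are symmetric, and `B` is their difference. -/
lemma B_symm (p : M) (v w : TangentSpace (𝓡 n) p) :
    S.g.inner p (S.B p v) w = S.g.inner p v (S.B p w) := by
  have h1 := hS.nabla_ξ_symm p v w
  rw [hS.nabla_ξ, hS.nabla_ξ] at h1
  simp only [proj, map_sub, map_smul, _root_.sub_apply, _root_.smul_apply,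
    S.inner_ξ, smul_eq_mul] at h1
  rw [S.g.symm p v (S.B p w)]
  rw [S.g.symm p w v] at h1
  linarith

end IsAlmostKenmotsu

end AlmostContactMetric

end

/-! ### The curvature `R(·, ·)ξ` and the consequences of the nullity condition -/

section

namespace AlmostContactMetric

variable {n : ℕ} {M : Type*} [TopologicalSpace M]
  [ChartedSpace (EuclideanSpace ℝ (Fin n)) M] [IsManifold (𝓡 n) ∞ M]
  {S : AlmostContactMetric n M}

lemma curvature_swap (g : Metric n M) (X Y Z : VecField n M) (p : M) :
    curvature g Y X Z p = - curvature g X Y Z p := by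
  unfold curvature
  rw [mlieBracket_swap_apply (V := Y), map_neg]
  abel

lemma mlieBracket_ξ_φ (S : AlmostContactMetric n M) {X : VecField n M} {p : M}
    (hX : DiffAt X p) :
    mlieBracket (𝓡 n) S.ξ (fun q ↦ S.φ q (X q)) p =
      (2 : ℝ) • S.h p (X p) + S.φ p (mlieBracket (𝓡 n) S.ξ X p) := by
  rw [S.h_apply hX]
  module

lemma smoothAt_proj {X : VecField n M} {p : M} (hX : SmoothAt X p) :
    SmoothAt (fun q ↦ S.proj q (X q)) p :=
  hX.sub (SmoothAt.smul (S.smoothAt_η hX) (S.smooth_ξ p))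

lemma diffAt_proj {X : VecField n M} {p : M} (hX : DiffAt X p) :
    DiffAt (fun q ↦ S.proj q (X q)) p :=
  hX.sub (DiffAt.smul (S.diffAt_η hX) (S.smooth_ξ.diffAt p))

lemma proj_of_η_eq_zero {p : M} {v : TangentSpace (𝓡 n) p} (hv : S.η p v = 0) :
    S.proj p v = v := by simp [proj, hv]

lemma η_proj (p : M) (v : TangentSpace (𝓡 n) p) : S.η p (S.proj p v) = 0 := by
  simp [proj, S.η_ξ]

lemma φ_proj (p : M) (v : TangentSpace (𝓡 n) p) : S.φ p (S.proj p v) = S.φ p v := by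
  simp [proj, S.φ_ξ]

namespace IsAlmostKenmotsu

variable (hS : S.IsAlmostKenmotsu)
include hS

lemma diffAt_nabla_ξ {X : VecField n M} {p : M} (hX : DiffAt X p) :
    DiffAt (fun q ↦ leviCivita S.g S.ξ q (X q)) p := by
  simp_rw [hS.nabla_ξ]
  exact (diffAt_proj hX).sub (S.diffAt_B hX)

/-- The Leibniz rule for the second covariant derivative needs `∇_X ξ` to be differentiable when `X`
is merely so; `∇ξ = P - B` provides this. -/
lemma curvature_tensorial_fst {Y : VecField n M} {p : M} (_ : DiffAt Y p) :
    TensorialAt (𝓡 n) (EuclideanSpace ℝ (Fin n)) (fun X ↦ curvature S.g X Y S.ξ p) p where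
  smul {f X} hf hX := by
    unfold curvature
    have h1 : (fun q ↦ leviCivita S.g S.ξ q ((f • X) q)) =
        fun q ↦ f q • leviCivita S.g S.ξ q (X q) := by
      ext1 q; simp
    rw [h1, leviCivita_smul S.g hf (hS.diffAt_nabla_ξ hX), mlieBracket_smul_left hf hX]
    simp
    module
  add {X X'} hX hX' := by
    unfold curvature
    have h1 : (fun q ↦ leviCivita S.g S.ξ q ((X + X') q)) =
        fun q ↦ leviCivita S.g S.ξ q (X q) + leviCivita S.g S.ξ q (X' q) := by
      ext1 q; simp
    rw [h1, leviCivita_add S.g (hS.diffAt_nabla_ξ hX) (hS.diffAt_nabla_ξ hX'),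
      mlieBracket_add_left hX hX']
    simp
    module

lemma curvature_tensorial_snd {X : VecField n M} {p : M} (hX : DiffAt X p) :
    TensorialAt (𝓡 n) (EuclideanSpace ℝ (Fin n)) (fun Y ↦ curvature S.g X Y S.ξ p) p where
  smul {f Y} hf hY := by
    have := (hS.curvature_tensorial_fst hX).smul hf hY
    simp only [curvature_swap S.g X] at this
    rw [← neg_inj, this, smul_neg]
  add {_ _} hY hY' := by
    have := (hS.curvature_tensorial_fst hX).add hY hY'
    simp only [curvature_swap S.g X] at this
    rw [← neg_inj, this, neg_add]

/-- The curvature operator `(v, w) ↦ R_{vw} ξ` on tangent vectors. -/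
def curvatureHom (p : M) :
    TangentSpace (𝓡 n) p →L[ℝ] TangentSpace (𝓡 n) p →L[ℝ] TangentSpace (𝓡 n) p :=
  TensorialAt.mkHom₂ (I := 𝓡 n) (F := EuclideanSpace ℝ (Fin n))
    (F' := EuclideanSpace ℝ (Fin n)) (fun X Y : VecField n M ↦ curvature S.g X Y S.ξ p) p
    (fun _ hY ↦ hS.curvature_tensorial_fst hY) (fun _ hX ↦ hS.curvature_tensorial_snd hX)

lemma curvatureHom_apply {X Y : VecField n M} {p : M} (hX : DiffAt X p) (hY : DiffAt Y p) :
    hS.curvatureHom p (X p) (Y p) = curvature S.g X Y S.ξ p :=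
  TensorialAt.mkHom₂_apply _ _ hX hY

/-- The projection `I - η ⊗ ξ` is invariant under `ξ`, since `L_ξ η = 0` and `L_ξ ξ = 0`. -/
lemma mlieBracket_ξ_proj {X : VecField n M} {p : M} (hX : SmoothAt X p) :
    mlieBracket (𝓡 n) S.ξ (fun q ↦ S.proj q (X q)) p =
      S.proj p (mlieBracket (𝓡 n) S.ξ X p) := by
  have h1 : (fun q ↦ S.proj q (X q)) = fun q ↦ X q + (-S.η q (X q)) • S.ξ q := by
    ext1 q; simp [proj, sub_eq_add_neg]
  have h2 := S.diffAt_η hX.diffAt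
  have h3 : MDifferentiableAt (𝓡 n) 𝓘(ℝ, ℝ) (fun q ↦ -S.η q (X q)) p := h2.neg
  rw [h1, mlieBracket_fun_add_right hX.diffAt (DiffAt.smul h3 (S.smooth_ξ.diffAt p)),
    mlieBracket_fun_smul_right h3 (S.smooth_ξ.diffAt p), proj, hS.η_lie hX, mvfderiv_fun_neg]
  simp [sub_eq_add_neg]

lemma h_B_add_B_h (p : M) (v : TangentSpace (𝓡 n) p) :
    S.h p (S.B p v) + S.B p (S.h p v) = 0 := by
  simp [B, hS.h_φ]

/-- Put `A = ∇ξ = P - B`. From `∇_ξ ξ = 0` and `∇_ξ(AX) = [ξ, AX] + A²X` one gets `R(X, ξ)ξ = -(L_ξ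
A)X - A²X`. Here `-L_ξ A = L_ξ B` because `L_ξ P = 0`, and `A² = P - 2B + B²`. -/
lemma curvature_ξ {X : VecField n M} {p : M} (hX : SmoothAt X p) :
    curvature S.g X S.ξ S.ξ p =
      (mlieBracket (𝓡 n) S.ξ (fun q ↦ S.B q (X q)) p - S.B p (mlieBracket (𝓡 n) S.ξ X p))
        - (S.proj p (X p) - (2 : ℝ) • S.B p (X p) + S.B p (S.B p (X p))) := by
  have hA := hS.diffAt_nabla_ξ hX.diffAt
  have h0 : (fun q ↦ leviCivita S.g S.ξ q (S.ξ q)) = (0 : VecField n M) := by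
    ext1 q; simp [hS.nabla_ξ_ξ]
  have t := leviCivita_torsion S.g (S.smooth_ξ.diffAt p) hA
  have h1 : mlieBracket (𝓡 n) S.ξ (fun q ↦ leviCivita S.g S.ξ q (X q)) p =
      mlieBracket (𝓡 n) S.ξ (fun q ↦ S.proj q (X q)) p
        - mlieBracket (𝓡 n) S.ξ (fun q ↦ S.B q (X q)) p := by
    rw [eq_sub_iff_add_eq, ← mlieBracket_fun_add_right hA (S.diffAt_B hX.diffAt)]
    congr 1
    ext1 q
    simp [hS.nabla_ξ]
  rw [h1, hS.mlieBracket_ξ_proj hX, sub_eq_iff_eq_add] at t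
  unfold curvature
  rw [h0, (leviCivita S.g).zero, t, mlieBracket_swap_apply (V := X), hS.nabla_ξ p (X p),
    map_neg, map_sub, hS.nabla_ξ, hS.nabla_ξ, hS.nabla_ξ, proj_of_η_eq_zero (S.η_proj _ _),
    proj_of_η_eq_zero (hS.η_B _ _)]
  have : S.B p (S.proj p (X p)) = S.B p (X p) := by simp [proj, hS.B_ξ]
  rw [this]
  simp
  module

/-- Differentiating `φB + Bφ = 0` along `ξ` produces, besides these two terms, `2(hB + Bh)`, which
vanishes. -/
lemma φ_lie_B {X : VecField n M} {p : M} (hX : DiffAt X p) :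
    S.φ p (mlieBracket (𝓡 n) S.ξ (fun q ↦ S.B q (X q)) p - S.B p (mlieBracket (𝓡 n) S.ξ X p))
      + (mlieBracket (𝓡 n) S.ξ (fun q ↦ S.B q (S.φ q (X q))) p
        - S.B p (mlieBracket (𝓡 n) S.ξ (fun q ↦ S.φ q (X q)) p)) = 0 := by
  have h1 : (fun q ↦ S.B q (S.φ q (X q))) = fun q ↦ (-1 : ℝ) • S.φ q (S.B q (X q)) := by
    ext1 q; rw [hS.B_φ, hS.φ_B]; simp
  rw [h1, mlieBracket_fun_smul_right mdifferentiableAt_const (S.diffAt_φ (S.diffAt_B hX)),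
    mlieBracket_ξ_φ S hX, mlieBracket_ξ_φ S (S.diffAt_B hX)]
  simp only [map_sub, map_add, map_smul, hS.B_φ, hS.φ_B, mvfderiv_const, _root_.zero_apply]
  have := hS.h_B_add_B_h p (X p)
  rw [add_eq_zero_iff_eq_neg] at this
  rw [this]
  module

section GeneralizedKMu

variable {k μ : M → ℝ} (hK : S.IsGeneralizedKMu k μ)
include hK

lemma lie_B_aux {X : VecField n M} {p : M} (hX : SmoothAt X p) :
    mlieBracket (𝓡 n) S.ξ (fun q ↦ S.B q (X q)) p - S.B p (mlieBracket (𝓡 n) S.ξ X p) =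
      (k p + 1) • S.proj p (X p) + μ p • S.h p (X p) - (2 : ℝ) • S.B p (X p)
        + S.B p (S.B p (X p)) := by
  have h := hK p X S.ξ hX (S.smooth_ξ p)
  rw [hS.curvature_ξ hX, S.η_ξ, hS.h_ξ, sub_eq_iff_eq_add] at h
  rw [h]
  simp only [one_smul, smul_zero, sub_zero, proj]
  module

/-- In `lie_B_aux` the terms in `h` and `B` anticommute with `φ`, while `(k + 1)P + B²` commutes
with it. By `φ_lie_B` the commuting part is annihilated by `φ`, and being horizontal it is zero. -/
lemma B_B (p : M) (v : TangentSpace (𝓡 n) p) :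
    S.B p (S.B p v) = -(k p + 1) • S.proj p v := by
  set X : VecField n M := extendVec v
  have hX : SmoothAt X p := smoothAt_ext v
  have hXp : X p = v := by simp [X]
  have h1 := hS.φ_lie_B hX.diffAt
  rw [hS.lie_B_aux hK hX, hS.lie_B_aux hK (S.smoothAt_φ hX), hXp] at h1
  simp only [map_add, map_sub, map_smul, φ_proj, proj_of_η_eq_zero (S.η_φ p v), hS.h_φ, hS.φ_B,
    hS.B_φ] at h1
  have h2 : S.B p (S.h p v) = - S.h p (S.B p v) :=
    eq_neg_of_add_eq_zero_right (hS.h_B_add_B_h p v)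
  rw [h2] at h1
  have h3 : S.h p (S.B p v) = (k p + 1) • S.φ p v := by
    have : (2 : ℝ) • (S.h p (S.B p v) - (k p + 1) • S.φ p v) = 0 := by
      rw [← neg_eq_zero, ← h1]
      module
    simpa [sub_eq_zero] using this
  change S.φ p (S.h p (S.B p v)) = _
  rw [h3, map_smul, S.φ_φ', smul_neg, neg_smul]

lemma lie_B {X : VecField n M} {p : M} (hX : SmoothAt X p) :
    mlieBracket (𝓡 n) S.ξ (fun q ↦ S.B q (X q)) p - S.B p (mlieBracket (𝓡 n) S.ξ X p) =
      μ p • S.h p (X p) - (2 : ℝ) • S.B p (X p) := by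
  rw [hS.lie_B_aux hK hX, hS.B_B hK]
  module

/-- `L_ξ(B²)` is computed twice: from `B² = -(k + 1)P` it is `-ξ(k)P`, and from `L_ξ B = μh - 2B` it
is `μ(hB + Bh) - 4B² = 4(k + 1)P`. -/
lemma deriv_k_ξ_smul (hk : ContMDiff (𝓡 n) 𝓘(ℝ, ℝ) ∞ k) {X : VecField n M} {p : M}
    (hX : SmoothAt X p) :
    mvfderiv (𝓡 n) k p (S.ξ p) • S.proj p (X p) = (-4 * (k p + 1)) • S.proj p (X p) := by
  have hkp : MDifferentiableAt (𝓡 n) 𝓘(ℝ, ℝ) k p := (hk p).mdifferentiableAt (by simp)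
  have hkp' : MDifferentiableAt (𝓡 n) 𝓘(ℝ, ℝ) (fun q ↦ -(k q + 1)) p :=
    (hkp.add mdifferentiableAt_const).neg
  have h1 := hS.lie_B hK (S.smoothAt_B hX)
  have h2 := hS.lie_B hK hX
  simp_rw [hS.B_B hK] at h1
  rw [mlieBracket_fun_smul_right hkp' (diffAt_proj hX.diffAt), hS.mlieBracket_ξ_proj hX,
    eq_add_of_sub_eq h2] at h1
  have h3 : mvfderiv (𝓡 n) (fun q ↦ -(k q + 1)) p (S.ξ p) = - mvfderiv (𝓡 n) k p (S.ξ p) := by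
    rw [mvfderiv_fun_neg, mvfderiv_fun_add hkp mdifferentiableAt_const, mvfderiv_const]
    simp
  have h4 : S.B p (S.h p (X p)) = - S.h p (S.B p (X p)) :=
    eq_neg_of_add_eq_zero_right (hS.h_B_add_B_h p _)
  rw [h3] at h1
  simp only [map_add, map_sub, map_smul, hS.B_B hK, h4] at h1
  rw [← sub_eq_zero] at h1 ⊢
  rw [← neg_eq_zero, ← h1]
  module

end GeneralizedKMu

end IsAlmostKenmotsu

end AlmostContactMetric

end

/-! ### Coordinate fields and coordinate forms of a chart -/

section

section Charts

variable {n : ℕ} {M : Type*} [TopologicalSpace M]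
  [ChartedSpace (EuclideanSpace ℝ (Fin n)) M] [IsManifold (𝓡 n) ∞ M]
  {e : OpenPartialHomeomorph M (EuclideanSpace ℝ (Fin n))}

lemma contMDiffAt_coord (he : e ∈ IsManifold.maximalAtlas (𝓡 n) ∞ M) {q : M} (hq : q ∈ e.source)
    (i : Fin n) : ContMDiffAt (𝓡 n) 𝓘(ℝ, ℝ) ∞ (fun q' ↦ e q' i) q := by
  have h1 := contMDiffAt_of_mem_maximalAtlas he hq
  have h2 : ContMDiffAt 𝓘(ℝ, EuclideanSpace ℝ (Fin n)) 𝓘(ℝ, ℝ) ∞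
      (EuclideanSpace.proj i : EuclideanSpace ℝ (Fin n) →L[ℝ] ℝ) (e q) :=
    (EuclideanSpace.proj i : EuclideanSpace ℝ (Fin n) →L[ℝ] ℝ).contMDiff.contMDiffAt
  exact h2.comp q h1

lemma chart_mdifferentiable (he : e ∈ IsManifold.maximalAtlas (𝓡 n) ∞ M) :
    e.MDifferentiable (𝓡 n) 𝓘(ℝ, EuclideanSpace ℝ (Fin n)) :=
  ⟨(contMDiffOn_of_mem_maximalAtlas he).mdifferentiableOn (by simp),
    (contMDiffOn_symm_of_mem_maximalAtlas he).mdifferentiableOn (by simp)⟩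

/-- The derivative of a chart at a point of its domain, as a continuous linear equivalence. -/
def chartDeriv (he : e ∈ IsManifold.maximalAtlas (𝓡 n) ∞ M) {q : M} (hq : q ∈ e.source) :
    TangentSpace (𝓡 n) q ≃L[ℝ] EuclideanSpace ℝ (Fin n) :=
  (chart_mdifferentiable he).mfderiv hq

lemma chartDeriv_coe (he : e ∈ IsManifold.maximalAtlas (𝓡 n) ∞ M) {q : M} (hq : q ∈ e.source) :
    (chartDeriv he hq : TangentSpace (𝓡 n) q →L[ℝ] EuclideanSpace ℝ (Fin n)) =
      mfderiv (𝓡 n) 𝓘(ℝ, EuclideanSpace ℝ (Fin n)) e q := rfl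

lemma coordForm_apply (he : e ∈ IsManifold.maximalAtlas (𝓡 n) ∞ M) {q : M} (hq : q ∈ e.source)
    (i : Fin n) (v : TangentSpace (𝓡 n) q) : coordForm e i q v = chartDeriv he hq v i := by
  have h1 := (contMDiffAt_of_mem_maximalAtlas he hq).mdifferentiableAt (by simp)
  have h2 : MDifferentiableAt 𝓘(ℝ, EuclideanSpace ℝ (Fin n)) 𝓘(ℝ, ℝ)
      (EuclideanSpace.proj i : EuclideanSpace ℝ (Fin n) →L[ℝ] ℝ) (e q) :=
    (EuclideanSpace.proj i : EuclideanSpace ℝ (Fin n) →L[ℝ] ℝ).contMDiff.contMDiffAt.mdifferentiableAt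
      (n := ∞) (by simp)
  have h3 := mvfderiv_comp_apply q h2 h1 v
  refine Eq.trans h3 ?_
  have h4 : mvfderiv 𝓘(ℝ, EuclideanSpace ℝ (Fin n))
    (EuclideanSpace.proj i : EuclideanSpace ℝ (Fin n) →L[ℝ] ℝ) (e q) =
      (EuclideanSpace.proj i : EuclideanSpace ℝ (Fin n) →L[ℝ] ℝ) := by
    ext u
    have := (EuclideanSpace.proj i : EuclideanSpace ℝ (Fin n) →L[ℝ] ℝ).fderiv (x := e q)
    unfold mvfderiv
    rw [mfderiv_eq_fderiv, this]
    rfl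
  rw [h4]
  rfl

lemma coordField_apply (he : e ∈ IsManifold.maximalAtlas (𝓡 n) ∞ M) {q : M} (hq : q ∈ e.source)
    (i : Fin n) : coordField e i q = (chartDeriv he hq).symm (EuclideanSpace.single i 1) := by
  unfold coordField
  rw [mpullback_apply, ← chartDeriv_coe he hq]
  erw [ContinuousLinearMap.inverse_equiv]
  rfl

lemma coordForm_coordField (he : e ∈ IsManifold.maximalAtlas (𝓡 n) ∞ M) {q : M}
    (hq : q ∈ e.source) (i j : Fin n) :
    coordForm e i q (coordField e j q) = if i = j then 1 else 0 := by
  rw [coordForm_apply he hq, coordField_apply he hq]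
  simp

lemma sum_coordForm_smul (he : e ∈ IsManifold.maximalAtlas (𝓡 n) ∞ M) {q : M}
    (hq : q ∈ e.source) (v : TangentSpace (𝓡 n) q) :
    v = ∑ i, coordForm e i q v • coordField e i q := by
  apply (chartDeriv he hq).injective
  rw [map_sum]
  ext j
  simp [coordForm_apply he hq, coordField_apply he hq, Pi.single_apply]

/-- The constant vector field `u` on Euclidean space. -/
def constField (u : EuclideanSpace ℝ (Fin n)) : VecField n (EuclideanSpace ℝ (Fin n)) :=
  fun y ↦ (NormedSpace.fromTangentSpace y).symm u

lemma smoothAt_constField (u y : EuclideanSpace ℝ (Fin n)) : SmoothAt (constField u) y :=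
  contMDiffAt_vectorSpace_iff_contDiffAt.2 contDiffAt_const

lemma mlieBracket_constField (u v y : EuclideanSpace ℝ (Fin n)) :
    mlieBracket (𝓡 n) (constField u) (constField v) y = 0 := by
  rw [← mlieBracketWithin_univ, mlieBracketWithin_eq_lieBracketWithin]
  have h : lieBracketWithin ℝ (fun _ : EuclideanSpace ℝ (Fin n) ↦ u)
      (fun _ : EuclideanSpace ℝ (Fin n) ↦ v) Set.univ y = 0 := by
    rw [lieBracketWithin_univ]
    simp [lieBracket]
  exact h

lemma smoothAt_coordField (he : e ∈ IsManifold.maximalAtlas (𝓡 n) ∞ M) {q : M}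
    (hq : q ∈ e.source) (i : Fin n) : SmoothAt (coordField e i) q := by
  have : IsManifold (𝓡 n) 1 M := IsManifold.of_le (n := ∞) (by simp)
  refine ContMDiffAt.mpullback_vectorField_preimage (n := ∞) (smoothAt_constField _ _)
    (contMDiffAt_of_mem_maximalAtlas he hq) ⟨chartDeriv he hq, rfl⟩ (by simp)

/-- Coordinate fields are pullbacks of constant fields, and pullback commutes with brackets. -/
lemma mlieBracket_coordField (he : e ∈ IsManifold.maximalAtlas (𝓡 n) ∞ M) {q : M}
    (hq : q ∈ e.source) (i j : Fin n) :
    mlieBracket (𝓡 n) (coordField e i) (coordField e j) q = 0 := by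
  have : IsManifold (𝓡 n) (minSmoothness ℝ 2) M :=
    IsManifold.of_le (n := ∞) (by simp; exact WithTop.coe_le_coe.2 (le_top : (2 : ℕ∞) ≤ ⊤))
  have h := mpullback_mlieBracket (n := ∞) (f := e) (x₀ := q)
    (smoothAt_constField (EuclideanSpace.single i (1 : ℝ)) (e q)).diffAt
    (smoothAt_constField (EuclideanSpace.single j (1 : ℝ)) (e q)).diffAt
    (contMDiffAt_of_mem_maximalAtlas he hq)
    (by simp; exact WithTop.coe_le_coe.2 (le_top : (2 : ℕ∞) ≤ ⊤))
  rw [mpullback_apply, mlieBracket_constField, map_zero] at h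
  exact h.symm

end Charts

end

/-! ### Functions of a single coordinate -/

section

lemma eq_zero_of_eq_neg {V : Type*} [AddCommGroup V] [Module ℝ V] {x : V} (h : x = -x) :
    x = 0 := by
  have h2 : (2 : ℝ) • x = 0 := by
    rw [two_smul]
    exact eq_neg_iff_add_eq_zero.1 h
  simpa using h2

section ChartCalculus

variable {n : ℕ} {M : Type*} [TopologicalSpace M]
  [ChartedSpace (EuclideanSpace ℝ (Fin n)) M] [IsManifold (𝓡 n) ∞ M]
  {e : OpenPartialHomeomorph M (EuclideanSpace ℝ (Fin n))}

lemma mlieBracket_congr_left {X Y Z : VecField n M} {p : M} (h : ∀ᶠ q in 𝓝 p, X q = Y q) :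
    mlieBracket (𝓡 n) X Z p = mlieBracket (𝓡 n) Y Z p :=
  Filter.EventuallyEq.mlieBracket_vectorField_eq h (Eventually.of_forall fun _ ↦ rfl)

lemma mvfderiv_comp_hasDerivAt {u : M → ℝ} {f : ℝ → ℝ} {f' : ℝ} {q : M}
    (hf : HasDerivAt f f' (u q)) (hu : MDifferentiableAt (𝓡 n) 𝓘(ℝ, ℝ) u q)
    (v : TangentSpace (𝓡 n) q) :
    mvfderiv (𝓡 n) (fun q' ↦ f (u q')) q v = f' * mvfderiv (𝓡 n) u q v := by
  have h := mvfderiv_comp_apply (f := u) (g := f) q hf.differentiableAt.mdifferentiableAt hu v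
  refine Eq.trans h ?_
  have h1 : mvfderiv 𝓘(ℝ, ℝ) f (u q) = fderiv ℝ f (u q) := by
    unfold mvfderiv
    rw [mfderiv_eq_fderiv]
    rfl
  rw [h1, hf.hasFDerivAt.fderiv]
  exact (ContinuousLinearMap.toSpanSingleton_apply ℝ f' _).trans (mul_comm _ _)

lemma mdifferentiableAt_comp_hasDerivAt {u : M → ℝ} {f : ℝ → ℝ} {f' : ℝ} {q : M}
    (hf : HasDerivAt f f' (u q)) (hu : MDifferentiableAt (𝓡 n) 𝓘(ℝ, ℝ) u q) :
    MDifferentiableAt (𝓡 n) 𝓘(ℝ, ℝ) (fun q' ↦ f (u q')) q :=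
  (hf.differentiableAt.mdifferentiableAt).comp q hu

/-- Near `e q i`, the function `f` is the restriction of `F` to the `i`-th coordinate line through
`q`. This is needed because the normal form asserts no regularity of the matrix `G`; it has to be
recovered from the metric. -/
lemma differentiableAt_of_comp_coord (he : e ∈ IsManifold.maximalAtlas (𝓡 n) ∞ M) {q : M}
    (hq : q ∈ e.source) {i : Fin n} {f : ℝ → ℝ} {F : M → ℝ}
    (hF : MDifferentiableAt (𝓡 n) 𝓘(ℝ, ℝ) F q) (hFf : ∀ q' ∈ e.source, F q' = f (e q' i)) :
    DifferentiableAt ℝ f (e q i) := by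
  let L : ℝ → EuclideanSpace ℝ (Fin n) := fun s ↦ e q + (s - e q i) • EuclideanSpace.single i 1
  have hL : DifferentiableAt ℝ L (e q i) := by fun_prop
  have hL0 : L (e q i) = e q := by simp [L]
  have h1 : MDifferentiableAt 𝓘(ℝ, ℝ) (𝓡 n) (fun s ↦ e.symm (L s)) (e q i) := by
    have h2 : MDifferentiableAt (𝓡 n) (𝓡 n) e.symm (L (e q i)) := by
      rw [hL0]
      exact (contMDiffAt_symm_of_mem_maximalAtlas he (e.map_source hq)).mdifferentiableAt (by simp)
    exact h2.comp (e q i) hL.mdifferentiableAt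
  have h3 : MDifferentiableAt 𝓘(ℝ, ℝ) 𝓘(ℝ, ℝ) (fun s ↦ F (e.symm (L s))) (e q i) := by
    have h4 : MDifferentiableAt (𝓡 n) 𝓘(ℝ, ℝ) F (e.symm (L (e q i))) := by
      rwa [hL0, e.left_inv hq]
    exact h4.comp (e q i) h1
  refine h3.differentiableAt.congr_of_eventuallyEq ?_
  have h5 : ∀ᶠ s in 𝓝 (e q i), L s ∈ e.target := by
    refine hL.continuousAt.eventually_mem (e.open_target.mem_nhds ?_)
    rw [hL0]; exact e.map_source hq
  filter_upwards [h5] with s hs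
  rw [hFf _ (e.map_target hs), e.right_inv hs]
  simp [L]

lemma mvfderiv_comp_coord_eq_zero (he : e ∈ IsManifold.maximalAtlas (𝓡 n) ∞ M) {q : M}
    (hq : q ∈ e.source) {i j : Fin n} (hij : i ≠ j) {f : ℝ → ℝ} {F : M → ℝ}
    (hF : MDifferentiableAt (𝓡 n) 𝓘(ℝ, ℝ) F q) (hFf : ∀ q' ∈ e.source, F q' = f (e q' i)) :
    mvfderiv (𝓡 n) F q (coordField e j q) = 0 := by
  have h1 := (differentiableAt_of_comp_coord he hq hF hFf).hasDerivAt
  have h2 : ∀ᶠ q' in 𝓝 q, F q' = f (e q' i) :=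
    eventually_of_mem (e.open_source.mem_nhds hq) hFf
  rw [mvfderiv_congr h2, mvfderiv_comp_hasDerivAt (u := fun q ↦ e q i) h1
    ((contMDiffAt_coord he hq i).mdifferentiableAt (by simp))]
  have := coordForm_coordField he hq i j
  rw [if_neg hij] at this
  unfold coordForm at this
  rw [this, mul_zero]

end ChartCalculus

/-! ### From the normal form to the nullity condition -/

section NormalForm

variable {M : Type*} [TopologicalSpace M]
  [ChartedSpace (EuclideanSpace ℝ (Fin 3)) M] [IsManifold (𝓡 3) ∞ M]
  {e : OpenPartialHomeomorph M (EuclideanSpace ℝ (Fin 3))}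

lemma HasComponents.apply_coordField {A : EndField 3 M} {a : ℝ → Matrix (Fin 2) (Fin 2) ℝ}
    (hA : HasComponents e A a) (he : e ∈ IsManifold.maximalAtlas (𝓡 3) ∞ M) {q : M}
    (hq : q ∈ e.source) (j : Fin 2) :
    A q (coordField e j.castSucc q) = ∑ i : Fin 2, a (e q 2) i j • coordField e i.castSucc q := by
  rw [hA q hq]
  simp [coordForm_coordField he hq]

namespace IsNormalForm

variable {S : AlmostContactMetric 3 M} {k μ : M → ℝ} {m : ℝ → ℝ}
  {a b c G : ℝ → Matrix (Fin 2) (Fin 2) ℝ}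
  (H : IsNormalForm S k μ e m a b c G) (hS : S.IsAlmostKenmotsu)
  (he : e ∈ IsManifold.maximalAtlas (𝓡 3) ∞ M)
include H he

lemma η_coordField {q : M} (hq : q ∈ e.source) (j : Fin 2) :
    S.η q (coordField e j.castSucc q) = 0 := by
  rw [H.η_eq q hq, coordForm_coordField he hq]
  fin_cases j <;> simp

lemma inner_coordField {q : M} (hq : q ∈ e.source) (i j : Fin 2) :
    S.g.inner q (coordField e i.castSucc q) (coordField e j.castSucc q) = G (e q 2) i j := by
  rw [H.g_eq q hq]
  simp only [coordForm_coordField he hq]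
  fin_cases i <;> fin_cases j <;> simp [Fin.sum_univ_two]

lemma mvfderiv_inner {q : M} (hq : q ∈ e.source) (i j l : Fin 2) :
    mvfderiv (𝓡 3) (fun q' ↦ S.g.inner q' (coordField e i.castSucc q') (coordField e j.castSucc q'))
      q (coordField e l.castSucc q) = 0 := by
  refine mvfderiv_comp_coord_eq_zero he hq (i := 2) (f := fun t ↦ G t i j) ?_
    (S.g.diffAt (smoothAt_coordField he hq _).diffAt (smoothAt_coordField he hq _).diffAt) ?_
  · fin_cases l <;> simp
  · intro q' hq'
    exact H.inner_coordField he hq' i j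

lemma leviCivita_swap {q : M} (hq : q ∈ e.source) (i j : Fin 3) :
    leviCivita S.g (coordField e i) q (coordField e j q) =
      leviCivita S.g (coordField e j) q (coordField e i q) := by
  have h := leviCivita_torsion S.g (smoothAt_coordField he hq j).diffAt
    (smoothAt_coordField he hq i).diffAt
  rw [mlieBracket_coordField he hq, sub_eq_zero] at h
  exact h

/-- The quantity is symmetric in `i, j`, since coordinate fields commute, and skew in `i, l`, since
the `G i l` are constant in the directions `∂ⱼ`. A tensor with both symmetries is zero. -/
lemma inner_leviCivita {q : M} (hq : q ∈ e.source) (i j l : Fin 2) :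
    S.g.inner q (leviCivita S.g (coordField e i.castSucc) q (coordField e j.castSucc q))
      (coordField e l.castSucc q) = 0 := by
  have key : ∀ i j l : Fin 2,
      S.g.inner q (leviCivita S.g (coordField e i.castSucc) q (coordField e j.castSucc q))
        (coordField e l.castSucc q) =
      - S.g.inner q (leviCivita S.g (coordField e l.castSucc) q (coordField e j.castSucc q))
        (coordField e i.castSucc q) := by
    intro i j l
    have h := leviCivita_metric S.g (smoothAt_coordField he hq i.castSucc).diffAt
      (smoothAt_coordField he hq l.castSucc).diffAt (coordField e j.castSucc q)
    rw [H.mvfderiv_inner he hq i l j, S.g.symm q (coordField e i.castSucc q)] at h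
    linarith
  have sw := fun i j l : Fin 2 ↦ congrArg (fun u ↦ S.g.inner q u (coordField e l.castSucc q))
    (H.leviCivita_swap he hq i.castSucc j.castSucc)
  linarith [key i j l, sw l j i, key j l i, sw i l j, key l i j, sw j i l]

/-- Only the `ξ`-component survives `inner_leviCivita`; differentiating `g(∂ᵢ, ξ) = 0` along `∂ⱼ`
identifies it. -/
lemma leviCivita_coordField {q : M} (hq : q ∈ e.source) (i j : Fin 2) :
    leviCivita S.g (coordField e i.castSucc) q (coordField e j.castSucc q) =
      (- S.g.inner q (leviCivita S.g S.ξ q (coordField e j.castSucc q))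
        (coordField e i.castSucc q)) • S.ξ q := by
  apply inner_ext S.g
  intro w
  have hξ : S.g.inner q (leviCivita S.g (coordField e i.castSucc) q (coordField e j.castSucc q))
      (S.ξ q) = - S.g.inner q (leviCivita S.g S.ξ q (coordField e j.castSucc q))
        (coordField e i.castSucc q) := by
    have h := leviCivita_metric S.g (smoothAt_coordField he hq i.castSucc).diffAt
      (S.smooth_ξ.diffAt q) (coordField e j.castSucc q)
    have h0 : ∀ᶠ q' in 𝓝 q, S.g.inner q' (coordField e i.castSucc q') (S.ξ q') = 0 := by
      filter_upwards [e.open_source.mem_nhds hq] with q' hq'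
      rw [S.inner_ξ_right, H.η_coordField he hq']
    rw [mvfderiv_eventually_const h0, S.g.symm q (coordField e i.castSucc q)] at h
    linarith
  rw [sum_coordForm_smul he hq w, Fin.sum_univ_castSucc]
  have h2 : coordField e (Fin.last 2) q = S.ξ q := (H.ξ_eq q hq).symm
  simp only [map_add, map_sum, map_smul, H.inner_leviCivita he hq, h2, hξ, _root_.smul_apply,
    S.inner_ξ, H.η_coordField he hq, S.η_ξ]
  simp

include hS

lemma nabla_ξ_coordField {q : M} (hq : q ∈ e.source) (j : Fin 2) :
    leviCivita S.g S.ξ q (coordField e j.castSucc q) =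
      coordField e j.castSucc q - ∑ i : Fin 2, c (e q 2) i j • coordField e i.castSucc q := by
  rw [hS.nabla_ξ, AlmostContactMetric.proj_of_η_eq_zero (H.η_coordField he hq j), H.B_eq.apply_coordField he hq]

/-- The coefficients of `∇_{∂ⱼ} ξ = ∂ⱼ - B∂ⱼ` are constant along `∂₁` and `∂₂`, so every second
derivative is a multiple of `ξ`. The two multiples agree because `g(∇_{∂ᵢ} ξ, B∂ⱼ)` is symmetric in
`i, j`: `∇ξ = P - B` is symmetric and commutes with `B`. -/
lemma curvature_coordField {q : M} (hq : q ∈ e.source) :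
    curvature S.g (coordField e (0 : Fin 2).castSucc) (coordField e (1 : Fin 2).castSucc) S.ξ q
      = 0 := by
  have hd := fun i : Fin 2 ↦ (smoothAt_coordField he hq i.castSucc).diffAt
  have ht := (contMDiffAt_coord he hq 2).mdifferentiableAt (by simp)
  have hD : ∀ i j : Fin 2, leviCivita S.g
      (fun q' ↦ leviCivita S.g S.ξ q' (coordField e j.castSucc q')) q (coordField e i.castSucc q) =
      leviCivita S.g (coordField e j.castSucc) q (coordField e i.castSucc q)
        - ∑ s : Fin 2, c (e q 2) s j •
          leviCivita S.g (coordField e s.castSucc) q (coordField e i.castSucc q) := by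
    intro i j
    have hA : ∀ᶠ q' in 𝓝 q, leviCivita S.g S.ξ q' (coordField e j.castSucc q') =
        coordField e j.castSucc q' - (c (e q' 2) 0 j • coordField e (0 : Fin 2).castSucc q'
          + c (e q' 2) 1 j • coordField e (1 : Fin 2).castSucc q') := by
      filter_upwards [e.open_source.mem_nhds hq] with q' hq'
      rw [H.nabla_ξ_coordField hS he hq', Fin.sum_univ_two]
    have hc := fun s ↦ mdifferentiableAt_comp_hasDerivAt (u := fun q' ↦ e q' 2) (H.deriv_B q hq s j) ht
    have hc0 : ∀ s, mvfderiv (𝓡 3) (fun q' ↦ c (e q' 2) s j) q (coordField e i.castSucc q) = 0 := by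
      intro s
      refine mvfderiv_comp_coord_eq_zero he hq (i := 2) (f := fun t ↦ c t s j) ?_ (hc s) ?_
      · fin_cases i <;> simp
      · intros; rfl
    rw [leviCivita_congr S.g (hS.diffAt_nabla_ξ (hd j)) hA, leviCivita_sub S.g (hd j)
      (DiffAt.add (DiffAt.smul (hc 0) (hd 0)) (DiffAt.smul (hc 1) (hd 1))),
      leviCivita_add S.g (DiffAt.smul (hc 0) (hd 0)) (DiffAt.smul (hc 1) (hd 1)),
      leviCivita_smul S.g (hc 0) (hd 0), leviCivita_smul S.g (hc 1) (hd 1), hc0, hc0,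
      Fin.sum_univ_two]
    simp
  have hB : ∀ i j : Fin 2, ∑ s : Fin 2, c (e q 2) s j *
      S.g.inner q (leviCivita S.g S.ξ q (coordField e i.castSucc q)) (coordField e s.castSucc q) =
      S.g.inner q (leviCivita S.g S.ξ q (coordField e i.castSucc q))
        (S.B q (coordField e j.castSucc q)) := by
    intro i j
    rw [H.B_eq.apply_coordField he hq, map_sum]
    simp
  unfold curvature
  rw [hD 0 1, hD 1 0, mlieBracket_coordField he hq, map_zero, sub_zero,
    H.leviCivita_swap he hq]
  have h01 := hB 0 1
  have h10 := hB 1 0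
  have hs : S.g.inner q (leviCivita S.g S.ξ q (coordField e (0 : Fin 2).castSucc q))
        (S.B q (coordField e (1 : Fin 2).castSucc q)) =
      S.g.inner q (leviCivita S.g S.ξ q (coordField e (1 : Fin 2).castSucc q))
        (S.B q (coordField e (0 : Fin 2).castSucc q)) := by
    rw [hS.nabla_ξ, hS.nabla_ξ, AlmostContactMetric.proj_of_η_eq_zero (H.η_coordField he hq _),
      AlmostContactMetric.proj_of_η_eq_zero (H.η_coordField he hq _), map_sub, map_sub, _root_.sub_apply,
      _root_.sub_apply, S.g.symm q (S.B q _) (S.B q _), ← hS.B_symm, S.g.symm q (S.B q _)]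
  rw [hs, ← h10] at h01
  simp only [H.leviCivita_coordField he hq]
  simp only [Fin.sum_univ_two] at h01 ⊢
  simp only [smul_smul, ← add_smul, sub_sub_sub_cancel_left, ← sub_smul]
  rw [smul_eq_zero]
  left
  linarith

/-- As `ξ = ∂/∂t` commutes with the `∂ⱼ`, `L_ξ B` has components `dB/dt`. In `curvature_ξ` the terms
`2B` cancel, and `-1 - exp(-4t) = k` remains. -/
lemma curvature_coordField_ξ {q : M} (hq : q ∈ e.source) (j : Fin 2) :
    curvature S.g (coordField e j.castSucc) S.ξ S.ξ q =
      k q • coordField e j.castSucc q + μ q • S.h q (coordField e j.castSucc q) := by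
  have hd := fun i : Fin 2 ↦ (smoothAt_coordField he hq i.castSucc).diffAt
  have ht := (contMDiffAt_coord he hq 2).mdifferentiableAt (by simp)
  have hξ : ∀ᶠ q' in 𝓝 q, S.ξ q' = coordField e 2 q' :=
    eventually_of_mem (e.open_source.mem_nhds hq) H.ξ_eq
  have hc := fun s ↦ mdifferentiableAt_comp_hasDerivAt (u := fun q' ↦ e q' 2) (H.deriv_B q hq s j) ht
  have hc1 : ∀ s, mvfderiv (𝓡 3) (fun q' ↦ c (e q' 2) s j) q (coordField e 2 q) =
      m (e q 2) * b (e q 2) s j - 2 * c (e q 2) s j := by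
    intro s
    rw [mvfderiv_comp_hasDerivAt (u := fun q' ↦ e q' 2) (H.deriv_B q hq s j) ht]
    have := coordForm_coordField he hq 2 2
    rw [if_pos rfl] at this
    unfold coordForm at this
    rw [this, mul_one]
  have hB : ∀ᶠ q' in 𝓝 q, S.B q' (coordField e j.castSucc q') =
      c (e q' 2) 0 j • coordField e (0 : Fin 2).castSucc q'
        + c (e q' 2) 1 j • coordField e (1 : Fin 2).castSucc q' := by
    filter_upwards [e.open_source.mem_nhds hq] with q' hq'
    rw [H.B_eq.apply_coordField he hq', Fin.sum_univ_two]
  have hBB : S.B q (S.B q (coordField e j.castSucc q)) =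
      Real.exp (-4 * e q 2) • coordField e j.castSucc q := by
    have h := H.B_sq q hq
    have h' : ∀ l, c (e q 2) l 0 * c (e q 2) 0 j + c (e q 2) l 1 * c (e q 2) 1 j =
        (Real.exp (-4 * e q 2) • (1 : Matrix (Fin 2) (Fin 2) ℝ)) l j := by
      intro l
      rw [← h, Matrix.mul_apply, Fin.sum_univ_two]
    have h0 := h' 0
    have h1 := h' 1
    rw [hB.self_of_nhds, map_add, map_smul, map_smul, H.B_eq.apply_coordField he hq,
      H.B_eq.apply_coordField he hq, Fin.sum_univ_two, Fin.sum_univ_two]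
    have : ∀ u v : TangentSpace (𝓡 3) q, c (e q 2) 0 j • (c (e q 2) 0 0 • u + c (e q 2) 1 0 • v)
        + c (e q 2) 1 j • (c (e q 2) 0 1 • u + c (e q 2) 1 1 • v) =
        (c (e q 2) 0 0 * c (e q 2) 0 j + c (e q 2) 0 1 * c (e q 2) 1 j) • u
          + (c (e q 2) 1 0 * c (e q 2) 0 j + c (e q 2) 1 1 * c (e q 2) 1 j) • v := by
      intro u v; module
    rw [this, h0, h1]
    fin_cases j <;> simp
  rw [hS.curvature_ξ (smoothAt_coordField he hq _), mlieBracket_congr_left hξ,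
    mlieBracket_congr_left hξ, mlieBracket_coordField he hq, map_zero, sub_zero,
    mlieBracket_congr_right hB, mlieBracket_fun_add_right (DiffAt.smul (hc 0) (hd 0))
      (DiffAt.smul (hc 1) (hd 1)), mlieBracket_fun_smul_right (hc 0) (hd 0),
    mlieBracket_fun_smul_right (hc 1) (hd 1), hc1, hc1, mlieBracket_coordField he hq,
    mlieBracket_coordField he hq, hBB, hB.self_of_nhds, H.h_eq.apply_coordField he hq,
    AlmostContactMetric.proj_of_η_eq_zero (H.η_coordField he hq _), H.k_eq q hq, H.μ_eq q hq, Fin.sum_univ_two]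
  module

lemma curvatureHom_ξ {q : M} (hq : q ∈ e.source) (v : TangentSpace (𝓡 3) q) :
    hS.curvatureHom q v (S.ξ q) = k q • S.proj q v + μ q • S.h q v := by
  have h0 : hS.curvatureHom q (S.ξ q) (S.ξ q) = 0 := by
    rw [hS.curvatureHom_apply (S.smooth_ξ.diffAt q) (S.smooth_ξ.diffAt q)]
    have := AlmostContactMetric.curvature_swap S.g S.ξ S.ξ S.ξ q
    exact eq_zero_of_eq_neg this
  have hj : ∀ j : Fin 2, hS.curvatureHom q (coordField e j.castSucc q) (S.ξ q) =
      k q • coordField e j.castSucc q + μ q • S.h q (coordField e j.castSucc q) := by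
    intro j
    rw [hS.curvatureHom_apply (smoothAt_coordField he hq _).diffAt (S.smooth_ξ.diffAt q),
      H.curvature_coordField_ξ hS he hq]
  have h2 : coordField e (Fin.last 2) q = S.ξ q := (H.ξ_eq q hq).symm
  have hv := sum_coordForm_smul he hq v
  rw [Fin.sum_univ_castSucc, h2, Fin.sum_univ_two] at hv
  rw [hv, AlmostContactMetric.proj]
  simp only [map_add, map_smul, _root_.add_apply, _root_.smul_apply, h0, hj,
    H.η_coordField he hq, S.η_ξ, hS.h_ξ]
  module

/-- An alternating bilinear map is determined by its values on pairs from the basis `∂₁, ∂₂, ξ`, and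
these are known. -/
lemma curvatureHom_eq {q : M} (hq : q ∈ e.source) (v w : TangentSpace (𝓡 3) q) :
    hS.curvatureHom q v w = k q • (S.η q w • v - S.η q v • w)
      + μ q • (S.η q w • S.h q v - S.η q v • S.h q w) := by
  have sw : ∀ v w, hS.curvatureHom q v w = - hS.curvatureHom q w v := by
    intro v w
    have h1 := hS.curvatureHom_apply (diffAt_ext v) (diffAt_ext w)
    have h2 := hS.curvatureHom_apply (diffAt_ext w) (diffAt_ext v)
    simp only [FiberBundle.extend_apply_self] at h1 h2
    rw [h1, h2, AlmostContactMetric.curvature_swap]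
  have h01 : hS.curvatureHom q (coordField e (0 : Fin 2).castSucc q)
      (coordField e (1 : Fin 2).castSucc q) = 0 := by
    rw [hS.curvatureHom_apply (smoothAt_coordField he hq _).diffAt
      (smoothAt_coordField he hq _).diffAt, H.curvature_coordField hS he hq]
  have h10 := sw (coordField e (1 : Fin 2).castSucc q) (coordField e (0 : Fin 2).castSucc q)
  rw [h01, neg_zero] at h10
  have hii : ∀ v, hS.curvatureHom q v v = 0 := fun v ↦ eq_zero_of_eq_neg (sw v v)
  have h2 : coordField e (Fin.last 2) q = S.ξ q := (H.ξ_eq q hq).symm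
  have hv := sum_coordForm_smul he hq v
  have hw := sum_coordForm_smul he hq w
  rw [Fin.sum_univ_castSucc, h2, Fin.sum_univ_two] at hv hw
  have hξ : ∀ v, hS.curvatureHom q (S.ξ q) v = -(k q • S.proj q v + μ q • S.h q v) := by
    intro v
    rw [sw, H.curvatureHom_ξ hS he hq]
  rw [hv, hw]
  simp only [map_add, map_smul, _root_.add_apply, _root_.smul_apply, hii, h01, h10,
    H.curvatureHom_ξ hS he hq, hξ, H.η_coordField he hq, S.η_ξ, hS.h_ξ,
    AlmostContactMetric.proj_of_η_eq_zero (H.η_coordField he hq _)]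
  module

end IsNormalForm

theorem isGeneralizedKMu_of_isNormalForm {S : AlmostContactMetric 3 M}
    (hS : S.IsAlmostKenmotsu) {k μ : M → ℝ}
    (H : ∀ p : M, ∃ e ∈ IsManifold.maximalAtlas (𝓡 3) ∞ M, p ∈ e.source ∧
      ∃ (m : ℝ → ℝ) (a b c G : ℝ → Matrix (Fin 2) (Fin 2) ℝ), IsNormalForm S k μ e m a b c G) :
    S.IsGeneralizedKMu k μ := by
  intro p X Y hX hY
  obtain ⟨e, he, hp, m, a, b, c, G, h⟩ := H p
  rw [← hS.curvatureHom_apply hX.diffAt hY.diffAt, h.curvatureHom_eq hS he hp]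

end NormalForm

end

/-! ### Local potentials: the Poincaré lemma on a manifold -/

section

section LocalTools

variable {n : ℕ} {M : Type*} [TopologicalSpace M]
  [ChartedSpace (EuclideanSpace ℝ (Fin n)) M] [IsManifold (𝓡 n) ∞ M]
  {e : OpenPartialHomeomorph M (EuclideanSpace ℝ (Fin n))}

lemma contDiffAt_comp_symm (he : e ∈ IsManifold.maximalAtlas (𝓡 n) ∞ M) {F : M → ℝ}
    {y : EuclideanSpace ℝ (Fin n)} (hy : y ∈ e.target)
    (hF : ContMDiffAt (𝓡 n) 𝓘(ℝ, ℝ) ∞ F (e.symm y)) :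
    ContDiffAt ℝ ∞ (fun y ↦ F (e.symm y)) y :=
  (hF.comp y (contMDiffAt_symm_of_mem_maximalAtlas he hy)).contDiffAt

lemma differentiableAt_comp_symm (he : e ∈ IsManifold.maximalAtlas (𝓡 n) ∞ M) {F : M → ℝ}
    {y : EuclideanSpace ℝ (Fin n)} (hy : y ∈ e.target)
    (hF : MDifferentiableAt (𝓡 n) 𝓘(ℝ, ℝ) F (e.symm y)) :
    DifferentiableAt ℝ (fun y ↦ F (e.symm y)) y :=
  (hF.comp y ((contMDiffAt_symm_of_mem_maximalAtlas he hy).mdifferentiableAt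
    (by simp))).differentiableAt

lemma contMDiffAt_comp_chart (he : e ∈ IsManifold.maximalAtlas (𝓡 n) ∞ M)
    {f : EuclideanSpace ℝ (Fin n) → ℝ} {q : M} (hq : q ∈ e.source)
    (hf : ContDiffAt ℝ ∞ f (e q)) : ContMDiffAt (𝓡 n) 𝓘(ℝ, ℝ) ∞ (fun q ↦ f (e q)) q :=
  hf.contMDiffAt.comp q (contMDiffAt_of_mem_maximalAtlas he hq)

lemma mvfderiv_comp_chart (he : e ∈ IsManifold.maximalAtlas (𝓡 n) ∞ M)
    {f : EuclideanSpace ℝ (Fin n) → ℝ} {q : M} (hq : q ∈ e.source)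
    (hf : DifferentiableAt ℝ f (e q)) (v : TangentSpace (𝓡 n) q) :
    mvfderiv (𝓡 n) (fun q ↦ f (e q)) q v = fderiv ℝ f (e q) (chartDeriv he hq v) := by
  have h := mvfderiv_comp_apply (f := e) (g := f) q hf.mdifferentiableAt
    ((contMDiffAt_of_mem_maximalAtlas he hq).mdifferentiableAt (by simp)) v
  refine Eq.trans h ?_
  have h1 : mvfderiv 𝓘(ℝ, EuclideanSpace ℝ (Fin n)) f (e q) = fderiv ℝ f (e q) := by
    unfold mvfderiv
    rw [mfderiv_eq_fderiv]
    rfl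
  rw [h1]
  rfl

lemma fderiv_comp_symm (he : e ∈ IsManifold.maximalAtlas (𝓡 n) ∞ M) {F : M → ℝ} {q : M}
    (hq : q ∈ e.source) (hF : MDifferentiableAt (𝓡 n) 𝓘(ℝ, ℝ) F q)
    (v : TangentSpace (𝓡 n) q) :
    fderiv ℝ (fun y ↦ F (e.symm y)) (e q) (chartDeriv he hq v) = mvfderiv (𝓡 n) F q v := by
  have hd : DifferentiableAt ℝ (fun y ↦ F (e.symm y)) (e q) :=
    differentiableAt_comp_symm he (e.map_source hq) (by rwa [e.left_inv hq])
  rw [← mvfderiv_comp_chart he hq hd]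
  refine DFunLike.congr_fun (mvfderiv_congr ?_) v
  filter_upwards [e.open_source.mem_nhds hq] with q' hq'
  rw [e.left_inv hq']

lemma fderiv_comp_symm_single (he : e ∈ IsManifold.maximalAtlas (𝓡 n) ∞ M) {F : M → ℝ} {q : M}
    (hq : q ∈ e.source) (hF : MDifferentiableAt (𝓡 n) 𝓘(ℝ, ℝ) F q) (i : Fin n) :
    fderiv ℝ (fun y ↦ F (e.symm y)) (e q) (EuclideanSpace.single i 1) =
      mvfderiv (𝓡 n) F q (coordField e i q) := by
  rw [← fderiv_comp_symm he hq hF, coordField_apply he hq, ContinuousLinearEquiv.apply_symm_apply]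

/-- Around every point of its domain, a chart is a bijection between an open set on which a given
property holds and a ball. -/
lemma exists_ball_chart {q : M} (hq : q ∈ e.source) {P : M → Prop} (hP : ∀ᶠ q' in 𝓝 q, P q') :
    ∃ r > 0, ∀ y ∈ Metric.ball (e q) r, y ∈ e.target ∧ P (e.symm y) := by
  have h1 : ∀ᶠ y in 𝓝 (e q), y ∈ e.target := e.open_target.mem_nhds (e.map_source hq)
  have h2 : ∀ᶠ y in 𝓝 (e q), P (e.symm y) :=
    (e.tendsto_symm hq).eventually hP
  exact Metric.eventually_nhds_iff_ball.1 (h1.and h2)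

lemma eventually_const_of_mvfderiv_eq_zero {F : M → ℝ} {p : M}
    (hF : ∀ᶠ q in 𝓝 p, MDifferentiableAt (𝓡 n) 𝓘(ℝ, ℝ) F q ∧ mvfderiv (𝓡 n) F q = 0) :
    ∀ᶠ q in 𝓝 p, F q = F p := by
  set e := chartAt (EuclideanSpace ℝ (Fin n)) p
  have he : e ∈ IsManifold.maximalAtlas (𝓡 n) ∞ M := IsManifold.chart_mem_maximalAtlas p
  have hp : p ∈ e.source := mem_chart_source _ p
  obtain ⟨r, hr, h⟩ := exists_ball_chart hp hF
  have hconst : ∀ y ∈ Metric.ball (e p) r, F (e.symm y) = F (e.symm (e p)) := by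
    intro y hy
    refine Metric.isOpen_ball.is_const_of_fderiv_eq_zero (𝕜 := ℝ)
      (convex_ball (e p) r).isPreconnected (f := fun y ↦ F (e.symm y)) (s := Metric.ball (e p) r)
      ?_ ?_ hy (Metric.mem_ball_self hr)
    · intro z hz
      exact (differentiableAt_comp_symm he (h z hz).1 (h z hz).2.1).differentiableWithinAt
    · intro z hz
      have hz' := h z hz
      ext w
      have := fderiv_comp_symm he (e.map_target hz'.1) hz'.2.1
        ((chartDeriv he (e.map_target hz'.1)).symm w)
      rw [ContinuousLinearEquiv.apply_symm_apply, e.right_inv hz'.1] at this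
      rw [this]
      exact DFunLike.congr_fun hz'.2.2 _
  have h3 : ∀ᶠ q in 𝓝 p, e q ∈ Metric.ball (e p) r :=
    (e.continuousAt hp).eventually_mem (Metric.isOpen_ball.mem_nhds (Metric.mem_ball_self hr))
  filter_upwards [h3, e.open_source.mem_nhds hp] with q hq hq'
  have := hconst _ hq
  rwa [e.left_inv hq', e.left_inv hp] at this

/-- A vector field with symmetric covariant derivative is locally a gradient. -/
lemma exists_potential (g : Metric n M) {V : VecField n M} {p : M}
    (hV : ∀ᶠ q in 𝓝 p, SmoothAt V q)
    (hsymm : ∀ᶠ q in 𝓝 p, ∀ v w : TangentSpace (𝓡 n) q,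
      g.inner q (leviCivita g V q v) w = g.inner q (leviCivita g V q w) v) :
    ∃ x : M → ℝ, ∀ᶠ q in 𝓝 p, ContMDiffAt (𝓡 n) 𝓘(ℝ, ℝ) ∞ x q ∧
      ∀ v : TangentSpace (𝓡 n) q, mvfderiv (𝓡 n) x q v = g.inner q (V q) v := by
  set e := chartAt (EuclideanSpace ℝ (Fin n)) p
  have he : e ∈ IsManifold.maximalAtlas (𝓡 n) ∞ M := IsManifold.chart_mem_maximalAtlas p
  have hp : p ∈ e.source := mem_chart_source _ p
  obtain ⟨r, hr, h⟩ := exists_ball_chart hp (hV.and hsymm)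
  let F : Fin n → M → ℝ := fun j q ↦ g.inner q (V q) (coordField e j q)
  let P : Fin n → (EuclideanSpace ℝ (Fin n) →L[ℝ] ℝ) := fun j ↦ EuclideanSpace.proj j
  -- The form `g(V, ·)` read in the chart; a primitive of it on a ball is the required potential.
  let α : EuclideanSpace ℝ (Fin n) → EuclideanSpace ℝ (Fin n) →L[ℝ] ℝ :=
    fun y ↦ ∑ j, F j (e.symm y) • P j
  have hFs : ∀ y ∈ Metric.ball (e p) r, ∀ j, ContMDiffAt (𝓡 n) 𝓘(ℝ, ℝ) ∞ (F j) (e.symm y) :=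
    fun y hy j ↦ g.smoothAt (h y hy).2.1 (smoothAt_coordField he (e.map_target (h y hy).1) j)
  have hαs : ∀ y ∈ Metric.ball (e p) r, ContDiffAt ℝ ∞ α y := by
    intro y hy
    refine ContDiffAt.sum fun j _ ↦ ?_
    exact (contDiffAt_comp_symm he (h y hy).1 (hFs y hy j)).smul contDiffAt_const
  have hder : ∀ y ∈ Metric.ball (e p) r, ∀ u w, fderiv ℝ α y u w =
      ∑ i, ∑ j, u i * w j * fderiv ℝ (fun y ↦ F j (e.symm y)) y (EuclideanSpace.single i 1) := by
    intro y hy u w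
    have hd : ∀ j, DifferentiableAt ℝ (fun y ↦ F j (e.symm y)) y := fun j ↦
      (contDiffAt_comp_symm he (h y hy).1 (hFs y hy j)).differentiableAt (by simp)
    have h1 : HasFDerivAt α
        (∑ j, (fderiv ℝ (fun y ↦ F j (e.symm y)) y).smulRight (P j)) y := by
      refine HasFDerivAt.fun_sum fun j _ ↦ ?_
      exact (hd j).hasFDerivAt.smul_const (P j)
    rw [h1.fderiv]
    have hu : u = ∑ i, u i • EuclideanSpace.single i (1 : ℝ) := by
      ext i
      simp [Pi.single_apply]
    conv_lhs => rw [hu]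
    simp only [_root_.sum_apply, ContinuousLinearMap.smulRight_apply, map_sum, map_smul,
      _root_.smul_apply, smul_eq_mul]
    refine Finset.sum_congr rfl fun i _ ↦ ?_
    rw [Finset.mul_sum]
    refine Finset.sum_congr rfl fun j _ ↦ ?_
    change u i * (_ * w j) = _
    ring
  obtain ⟨f, hf⟩ := (convex_ball (e p) r).exists_forall_hasFDerivAt_of_fderiv_symmetric
    Metric.isOpen_ball
    (fun y hy ↦ ((hαs y hy).differentiableAt (by simp)).differentiableWithinAt) (by
      intro y hy u w
      rw [hder y hy, hder y hy, Finset.sum_comm]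
      refine Finset.sum_congr rfl fun j _ ↦ Finset.sum_congr rfl fun i _ ↦ ?_
      have hsrc := e.map_target (h y hy).1
      have hX := fun i ↦ (smoothAt_coordField he hsrc i).diffAt
      -- Both terms are symmetric in `i, j`: the first by hypothesis, the second because `∇` is
      -- torsion free and coordinate fields commute.
      have key : ∀ i j, fderiv ℝ (fun y ↦ F j (e.symm y)) y (EuclideanSpace.single i 1) =
          g.inner (e.symm y) (leviCivita g V (e.symm y) (coordField e i (e.symm y)))
            (coordField e j (e.symm y)) + g.inner (e.symm y) (V (e.symm y))
            (leviCivita g (coordField e j) (e.symm y) (coordField e i (e.symm y))) := by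
        intro i j
        have h1 := fderiv_comp_symm_single he hsrc ((hFs y hy j).mdifferentiableAt (by simp)) i
        rw [e.right_inv (h y hy).1] at h1
        rw [h1, leviCivita_metric g (h y hy).2.1.diffAt (hX j)]
      have ht := leviCivita_torsion g (hX i) (hX j)
      rw [mlieBracket_coordField he hsrc, sub_eq_zero] at ht
      rw [key, key, (h y hy).2.2, ht]
      ring)
  refine ⟨fun q ↦ f (e q), ?_⟩
  -- The primitive is smooth because its derivative `α` is.
  have hfs : ContDiffOn ℝ ∞ f (Metric.ball (e p) r) := by
    rw [contDiffOn_infty_iff_fderiv_of_isOpen Metric.isOpen_ball]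
    refine ⟨fun y hy ↦ (hf y hy).differentiableAt.differentiableWithinAt, ?_⟩
    refine ContDiffOn.congr (f := α) (fun y hy ↦ (hαs y hy).contDiffWithinAt) ?_
    exact fun y hy ↦ (hf y hy).fderiv
  have h3 : ∀ᶠ q in 𝓝 p, e q ∈ Metric.ball (e p) r :=
    (e.continuousAt hp).eventually_mem (Metric.isOpen_ball.mem_nhds (Metric.mem_ball_self hr))
  filter_upwards [h3, e.open_source.mem_nhds hp] with q hq hq'
  have hfq : ContDiffAt ℝ ∞ f (e q) := hfs.contDiffAt (Metric.isOpen_ball.mem_nhds hq)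
  refine ⟨contMDiffAt_comp_chart he hq' hfq, fun v ↦ ?_⟩
  rw [mvfderiv_comp_chart he hq' (hf _ hq).differentiableAt, (hf _ hq).fderiv]
  conv_rhs => rw [sum_coordForm_smul he hq' v]
  have hF : ∀ j, F j (e.symm (e q)) = F j q := fun j ↦ by rw [e.left_inv hq']
  simp only [α, hF, _root_.sum_apply, _root_.smul_apply, map_sum, map_smul, smul_eq_mul]
  refine Finset.sum_congr rfl fun j _ ↦ ?_
  rw [coordForm_apply he hq', mul_comm]
  rfl

end LocalTools

end

/-! ### Construction of charts, and linear differential equations -/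

section

section ChartConstruction

variable {n : ℕ} {M : Type*} [TopologicalSpace M]
  [ChartedSpace (EuclideanSpace ℝ (Fin n)) M] [IsManifold (𝓡 n) ∞ M]

/-- Functions `x₁, …, xₙ` that are smooth near `p` and have linearly independent differentials are
the coordinates of a chart around `p`. -/
lemma exists_chart_of_coord {p : M} {x : Fin n → M → ℝ} {P : M → Prop}
    (hx : ∀ᶠ q in 𝓝 p, (∀ i, ContMDiffAt (𝓡 n) 𝓘(ℝ, ℝ) ∞ (x i) q) ∧
      ∀ v : TangentSpace (𝓡 n) q, (∀ i, mvfderiv (𝓡 n) (x i) q v = 0) → v = 0)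
    (hP : ∀ᶠ q in 𝓝 p, P q) :
    ∃ e ∈ IsManifold.maximalAtlas (𝓡 n) ∞ M, p ∈ e.source ∧
      ∀ q ∈ e.source, (∀ i, e q i = x i q) ∧ P q := by
  set e₀ := chartAt (EuclideanSpace ℝ (Fin n)) p
  have he₀ : e₀ ∈ IsManifold.maximalAtlas (𝓡 n) ∞ M := IsManifold.chart_mem_maximalAtlas p
  have hp : p ∈ e₀.source := mem_chart_source _ p
  obtain ⟨r, hr, h⟩ := exists_ball_chart hp (hx.and hP)
  let F : EuclideanSpace ℝ (Fin n) → EuclideanSpace ℝ (Fin n) :=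
    fun y ↦ WithLp.toLp 2 fun i ↦ x i (e₀.symm y)
  have hFs : ∀ y ∈ Metric.ball (e₀ p) r, ContDiffAt ℝ ∞ F y := fun y hy ↦
    contDiffAt_euclidean.2 fun i ↦ contDiffAt_comp_symm he₀ (h y hy).1 ((h y hy).2.1.1 i)
  have hFd : ∀ y ∈ Metric.ball (e₀ p) r, ∃ A : EuclideanSpace ℝ (Fin n) ≃L[ℝ]
      EuclideanSpace ℝ (Fin n), HasFDerivAt F
        (A : EuclideanSpace ℝ (Fin n) →L[ℝ] EuclideanSpace ℝ (Fin n)) y := by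
    intro y hy
    have hd := (hFs y hy).differentiableAt (by simp)
    have hsrc := e₀.map_target (h y hy).1
    have hinj : Function.Injective (fderiv ℝ F y).toLinearMap := by
      rw [injective_iff_map_eq_zero]
      intro w hw
      have key : (chartDeriv he₀ hsrc).symm w = 0 := by
        refine (h y hy).2.1.2 _ fun i ↦ ?_
        rw [← fderiv_comp_symm he₀ hsrc (((h y hy).2.1.1 i).mdifferentiableAt (by simp)),
          ContinuousLinearEquiv.apply_symm_apply, e₀.right_inv (h y hy).1]
        have h1 : HasFDerivAt (fun y ↦ F y i)
            ((EuclideanSpace.proj i : EuclideanSpace ℝ (Fin n) →L[ℝ] ℝ) ∘L fderiv ℝ F y) y :=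
          (EuclideanSpace.proj i : EuclideanSpace ℝ (Fin n) →L[ℝ] ℝ).hasFDerivAt.comp y
            hd.hasFDerivAt
        have h2 : fderiv ℝ (fun y ↦ x i (e₀.symm y)) y = _ := h1.fderiv
        rw [h2]
        have h3 : fderiv ℝ F y w = 0 := hw
        simp [h3]
      simpa using key
    let A := (LinearEquiv.ofInjectiveEndo _ hinj).toContinuousLinearEquiv
    refine ⟨A, ?_⟩
    have : (A : EuclideanSpace ℝ (Fin n) →L[ℝ] EuclideanSpace ℝ (Fin n)) = fderiv ℝ F y := by
      ext w; rfl
    rw [this]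
    exact hd.hasFDerivAt
  have hmem : e₀ p ∈ Metric.ball (e₀ p) r := Metric.mem_ball_self hr
  obtain ⟨A, hA⟩ := hFd _ hmem
  -- The inverse function theorem at the centre, restricted to the ball: there `dF` is invertible at
  -- every point, so the inverse is smooth on the whole target.
  let ψ := ((hFs _ hmem).toOpenPartialHomeomorph F hA (by simp)).restrOpen
    (Metric.ball (e₀ p) r) Metric.isOpen_ball
  have hψF : (ψ : EuclideanSpace ℝ (Fin n) → EuclideanSpace ℝ (Fin n)) = F := rfl
  have hψ : ψ.source ⊆ Metric.ball (e₀ p) r := fun y hy ↦ hy.2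
  have hψp : e₀ p ∈ ψ.source :=
    ⟨(hFs _ hmem).mem_toOpenPartialHomeomorph_source hA (by simp), hmem⟩
  have hψs : ∀ z ∈ ψ.target, ContDiffAt ℝ ∞ ψ.symm z := by
    intro z hz
    have hz' := hψ (ψ.map_target hz)
    obtain ⟨A', hA'⟩ := hFd _ hz'
    exact ψ.contDiffAt_symm hz hA' (hFs _ hz')
  refine ⟨e₀ ≫ₕ ψ, ?_, ?_, ?_⟩
  · refine OpenPartialHomeomorph.mem_maximalAtlas_of_contMDiffOn _ ?_ ?_
    · intro q hq
      rw [OpenPartialHomeomorph.trans_source] at hq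
      have h1 : ContMDiffAt 𝓘(ℝ, EuclideanSpace ℝ (Fin n)) (𝓡 n) ∞ F (e₀ q) :=
        (hFs _ (hψ hq.2)).contMDiffAt
      exact (h1.comp q (contMDiffAt_of_mem_maximalAtlas he₀ hq.1)).contMDiffWithinAt
    · intro z hz
      rw [OpenPartialHomeomorph.trans_target] at hz
      have h1 : ContMDiffAt (𝓡 n) 𝓘(ℝ, EuclideanSpace ℝ (Fin n)) ∞ ψ.symm z :=
        (hψs z hz.1).contMDiffAt
      exact ((contMDiffAt_symm_of_mem_maximalAtlas he₀ hz.2).comp z h1).contMDiffWithinAt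
  · rw [OpenPartialHomeomorph.trans_source]
    exact ⟨hp, hψp⟩
  · intro q hq
    rw [OpenPartialHomeomorph.trans_source] at hq
    have h1 := (h _ (hψ hq.2)).2.2
    rw [e₀.left_inv hq.1] at h1
    refine ⟨fun i ↦ ?_, h1⟩
    change x i (e₀.symm (e₀ q)) = x i q
    rw [e₀.left_inv hq.1]

/-- A function whose differential is a multiple of `dt ≠ 0` is locally a function of `t`. -/
lemma exists_factor_of_mvfderiv {p : M} {t μ : M → ℝ}
    (ht : ∀ᶠ q in 𝓝 p, ContMDiffAt (𝓡 n) 𝓘(ℝ, ℝ) ∞ t q)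
    (hμ : ∀ᶠ q in 𝓝 p, ContMDiffAt (𝓡 n) 𝓘(ℝ, ℝ) ∞ μ q)
    (ht0 : ∃ v : TangentSpace (𝓡 n) p, mvfderiv (𝓡 n) t p v ≠ 0)
    (hker : ∀ᶠ q in 𝓝 p, ∀ v : TangentSpace (𝓡 n) q,
      mvfderiv (𝓡 n) t q v = 0 → mvfderiv (𝓡 n) μ q v = 0) :
    ∃ m : ℝ → ℝ, (∀ᶠ s in 𝓝 (t p), ContDiffAt ℝ ∞ m s) ∧ ∀ᶠ q in 𝓝 p, μ q = m (t q) := by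
  set e₀ := chartAt (EuclideanSpace ℝ (Fin n)) p
  have he₀ : e₀ ∈ IsManifold.maximalAtlas (𝓡 n) ∞ M := IsManifold.chart_mem_maximalAtlas p
  have hp : p ∈ e₀.source := mem_chart_source _ p
  obtain ⟨i₀, hi₀⟩ : ∃ i, mvfderiv (𝓡 n) t p (coordField e₀ i p) ≠ 0 := by
    by_contra! hcon
    obtain ⟨v, hv⟩ := ht0
    apply hv
    rw [sum_coordForm_smul he₀ hp v, map_sum]
    simp [hcon]
  have hcont : ContinuousAt (fun q ↦ mvfderiv (𝓡 n) t q (coordField e₀ i₀ q)) p := by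
    have h1 : ContinuousAt (fun y ↦ fderiv ℝ (fun y ↦ t (e₀.symm y)) y
        (EuclideanSpace.single i₀ 1)) (e₀ p) := by
      have h2 : ContDiffAt ℝ ∞ (fun y ↦ t (e₀.symm y)) (e₀ p) :=
        contDiffAt_comp_symm he₀ (e₀.map_source hp)
          (by rw [e₀.left_inv hp]; exact ht.self_of_nhds)
      exact (h2.continuousAt_fderiv (by simp)).clm_apply continuousAt_const
    have h3 := ContinuousAt.comp (f := e₀) (x := p) h1 (e₀.continuousAt hp)
    refine h3.congr ?_
    filter_upwards [e₀.open_source.mem_nhds hp, ht] with q hq htq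
    exact fderiv_comp_symm_single he₀ hq (htq.mdifferentiableAt (by simp)) i₀
  -- Exchanging a coordinate along which `t` has nonzero derivative for `t` itself keeps the
  -- differentials independent near `p`.
  let x : Fin n → M → ℝ := fun i q ↦ if i = i₀ then t q else e₀ q i
  obtain ⟨e, he, hpe, hex⟩ := exists_chart_of_coord (p := p) (x := x)
    (P := fun q ↦ ContMDiffAt (𝓡 n) 𝓘(ℝ, ℝ) ∞ μ q ∧ ∀ v : TangentSpace (𝓡 n) q,
      mvfderiv (𝓡 n) t q v = 0 → mvfderiv (𝓡 n) μ q v = 0) (by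
    filter_upwards [ht, hcont.eventually_ne hi₀, e₀.open_source.mem_nhds hp] with q h1 h2 h3
    refine ⟨fun i ↦ ?_, fun v hv ↦ ?_⟩
    · by_cases hi : i = i₀
      · simpa [x, hi] using h1
      · simpa [x, hi] using contMDiffAt_coord he₀ h3 i
    · have h4 : ∀ i, i ≠ i₀ → coordForm e₀ i q v = 0 := by
        intro i hi
        have := hv i
        simp only [x, hi, if_false] at this
        exact this
      have h5 := hv i₀
      simp only [x, if_true] at h5
      have h6 : v = coordForm e₀ i₀ q v • coordField e₀ i₀ q := by
        conv_lhs => rw [sum_coordForm_smul he₀ h3 v]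
        refine Finset.sum_eq_single i₀ (fun i _ hi ↦ ?_) (by simp)
        rw [h4 i hi, zero_smul]
      rw [h6, map_smul, smul_eq_mul, mul_eq_zero] at h5
      rw [h6, h5.resolve_right h2, zero_smul]) (hμ.and hker)
  have het : ∀ q ∈ e.source, e q i₀ = t q := fun q hq ↦ by simpa [x] using (hex q hq).1 i₀
  have hform : ∀ q ∈ e.source, coordForm e i₀ q = mvfderiv (𝓡 n) t q := by
    intro q hq
    refine mvfderiv_congr ?_
    filter_upwards [e.open_source.mem_nhds hq] with q' hq' using het q' hq'
  obtain ⟨r, hr, h⟩ := exists_ball_chart hpe (P := fun _ ↦ True) (by simp)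
  -- The coordinate line through `e p` in the direction of `t`; `m` is `μ` along this line.
  let γ : ℝ → EuclideanSpace ℝ (Fin n) :=
    fun s ↦ e p + (s - t p) • EuclideanSpace.single i₀ (1 : ℝ)
  have hγ : ContDiff ℝ ∞ γ := by fun_prop
  have hγp : γ (t p) = e p := by simp [γ]
  have hball : ∀ᶠ y in 𝓝 (e p), y ∈ Metric.ball (e p) r := Metric.ball_mem_nhds _ hr
  have hγb : ∀ᶠ s in 𝓝 (t p), γ s ∈ Metric.ball (e p) r := by
    have := hγ.continuous.continuousAt (x := t p)
    rw [ContinuousAt, hγp] at this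
    exact this.eventually hball
  have hμs : ∀ y ∈ Metric.ball (e p) r, ContDiffAt ℝ ∞ (fun y ↦ μ (e.symm y)) y := fun y hy ↦
    contDiffAt_comp_symm he (h y hy).1 (hex _ (e.map_target (h y hy).1)).2.1
  refine ⟨fun s ↦ μ (e.symm (γ s)), ?_, ?_⟩
  · filter_upwards [hγb] with s hs
    exact (hμs _ hs).comp s hγ.contDiffAt
  · have htc : ContinuousAt t p := ht.self_of_nhds.continuousAt
    filter_upwards [htc.eventually hγb, (e.continuousAt hpe).eventually hball,
      e.open_source.mem_nhds hpe] with q hq1 hq2 hq3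
    -- The segment from `γ (t q)` to `e q` lies in the ball and in a level set of `t`, so `μ` is
    -- constant along it.
    have hseg : ∀ τ ∈ Set.Icc (0 : ℝ) 1,
        γ (t q) + τ • (e q - γ (t q)) ∈ Metric.ball (e p) r := by
      intro τ hτ
      exact (convex_ball (e p) r).add_smul_sub_mem hq1 hq2 hτ
    have hdiff : (e q - γ (t q)) i₀ = 0 := by
      simp [γ, het q hq3, het p hpe]
    have hder : ∀ τ ∈ Set.Icc (0 : ℝ) 1,
        HasDerivAt (fun τ : ℝ ↦ μ (e.symm (γ (t q) + τ • (e q - γ (t q))))) 0 τ := by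
      intro τ hτ
      have hb := hseg τ hτ
      have hsrc := e.map_target (h _ hb).1
      have h1 := ((hμs _ hb).differentiableAt (by simp)).hasFDerivAt
      have h2 : HasDerivAt (fun τ : ℝ ↦ γ (t q) + τ • (e q - γ (t q))) (e q - γ (t q)) τ := by
        simpa using ((hasDerivAt_id τ).smul_const (e q - γ (t q))).const_add (γ (t q))
      have h3 := h1.comp_hasDerivAt τ h2
      refine h3.congr_deriv ?_
      have h4 := fderiv_comp_symm he hsrc ((hex _ hsrc).2.1.mdifferentiableAt (by simp))
        ((chartDeriv he hsrc).symm (e q - γ (t q)))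
      rw [ContinuousLinearEquiv.apply_symm_apply, e.right_inv (h _ hb).1] at h4
      rw [h4]
      refine (hex _ hsrc).2.2 _ ?_
      rw [← hform _ hsrc, coordForm_apply he hsrc, ContinuousLinearEquiv.apply_symm_apply, hdiff]
    have h5 := constant_of_derivWithin_zero (f := fun τ : ℝ ↦
      μ (e.symm (γ (t q) + τ • (e q - γ (t q))))) (a := 0) (b := 1)
      (fun τ hτ ↦ (hder τ hτ).differentiableAt.differentiableWithinAt)
      (fun τ hτ ↦ by
        have hτ' : τ ∈ Set.Icc (0 : ℝ) 1 := ⟨hτ.1, hτ.2.le⟩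
        exact (hder τ hτ').hasDerivWithinAt.derivWithin (uniqueDiffOn_Icc_zero_one τ hτ'))
      1 (by simp)
    simpa [e.left_inv hq3] using h5

end ChartConstruction

section LinearODE

/-- Smooth solutions of a planar linear system with smooth coefficients. -/
lemma exists_linear_ode {a b c d : ℝ → ℝ} {t₀ : ℝ} (ha : ∀ᶠ s in 𝓝 t₀, ContDiffAt ℝ ∞ a s)
    (hb : ∀ᶠ s in 𝓝 t₀, ContDiffAt ℝ ∞ b s) (hc : ∀ᶠ s in 𝓝 t₀, ContDiffAt ℝ ∞ c s)
    (hd : ∀ᶠ s in 𝓝 t₀, ContDiffAt ℝ ∞ d s) (x₀ y₀ : ℝ) :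
    ∃ x y : ℝ → ℝ, x t₀ = x₀ ∧ y t₀ = y₀ ∧ ∀ᶠ s in 𝓝 t₀,
      HasDerivAt x (a s * x s + b s * y s) s ∧ HasDerivAt y (c s * x s + d s * y s) s ∧
      ContDiffAt ℝ ∞ x s ∧ ContDiffAt ℝ ∞ y s := by
  obtain ⟨δ, hδ, hcoef⟩ := Metric.eventually_nhds_iff_ball.1 (ha.and (hb.and (hc.and hd)))
  -- Time is added as a first component, to make the system autonomous; `hfst` recovers it
  -- afterwards.
  let f : ℝ × ℝ × ℝ → ℝ × ℝ × ℝ := fun z ↦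
    (1, a z.1 * z.2.1 + b z.1 * z.2.2, c z.1 * z.2.1 + d z.1 * z.2.2)
  have hf : ∀ z : ℝ × ℝ × ℝ, z.1 ∈ Metric.ball t₀ δ → ContDiffAt ℝ ∞ f z := by
    intro z hz
    obtain ⟨h1, h2, h3, h4⟩ := hcoef _ hz
    have k1 : ContDiffAt ℝ ∞ (fun z : ℝ × ℝ × ℝ ↦ z.1) z := contDiffAt_fst
    have k2 : ContDiffAt ℝ ∞ (fun z : ℝ × ℝ × ℝ ↦ z.2.1) z := contDiffAt_snd.fst
    have k3 : ContDiffAt ℝ ∞ (fun z : ℝ × ℝ × ℝ ↦ z.2.2) z := contDiffAt_snd.snd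
    exact contDiffAt_const.prodMk ((((h1.comp z k1).mul k2).add ((h2.comp z k1).mul k3)).prodMk
      (((h3.comp z k1).mul k2).add ((h4.comp z k1).mul k3)))
  obtain ⟨α, hα0, ε, hε, hα⟩ :=
    ((hf (t₀, x₀, y₀) (Metric.mem_ball_self hδ)).of_le
      (by simp)).exists_forall_mem_closedBall_exists_eq_forall_mem_Ioo_hasDerivAt₀ t₀
  have h1 : ∀ s ∈ Set.Ioo (t₀ - ε) (t₀ + ε), HasDerivAt (fun s ↦ (α s).1) 1 s := fun s hs ↦
    (hα s hs).fst
  have hfst : ∀ s ∈ Set.Ioo (t₀ - ε) (t₀ + ε), (α s).1 = s := by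
    intro s hs
    have h2 : ∀ s ∈ Set.Ioo (t₀ - ε) (t₀ + ε), HasDerivAt (fun s ↦ (α s).1 - s) 0 s := by
      intro s hs
      exact ((h1 s hs).sub (hasDerivAt_id s)).congr_deriv (sub_self 1)
    have h3 := isOpen_Ioo.is_const_of_deriv_eq_zero (convex_Ioo (t₀ - ε) (t₀ + ε)).isPreconnected
      (fun s hs ↦ (h2 s hs).differentiableAt.differentiableWithinAt)
      (fun s hs ↦ (h2 s hs).deriv) hs (y := t₀) ⟨by linarith, by linarith⟩
    rw [hα0] at h3
    simpa [sub_eq_zero] using h3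
  set ρ := min ε δ / 2 with hρ
  have hρ0 : 0 < ρ := by positivity
  have hρε : ρ < ε := by have := min_le_left ε δ; have := lt_min hε hδ; linarith
  have hρδ : ρ < δ := by have := min_le_right ε δ; have := lt_min hε hδ; linarith
  have hsub : Set.Icc (t₀ - ρ) (t₀ + ρ) ⊆ Set.Ioo (t₀ - ε) (t₀ + ε) := fun s hs ↦
    ⟨by linarith [hs.1], by linarith [hs.2]⟩
  -- So far the solution is only differentiable; regularity of the right-hand side passes to it. The
  -- radius `ρ` is below both the existence time `ε` and the radius `δ` on which the coefficients
  -- are smooth.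
  have hsmooth : ContDiffOn ℝ ∞ α (Set.Icc (t₀ - ρ) (t₀ + ρ)) := by
    refine ODE.contDiffOn_enat_Icc_of_hasDerivWithinAt (f := fun _ z ↦ f z)
      (u := {z | z.1 ∈ Metric.ball t₀ δ}) (n := ⊤) ?_
      (fun s hs ↦ (hα s (hsub hs)).hasDerivWithinAt) ?_
    · intro z hz
      exact ((hf z.2 hz.2).comp z contDiffAt_snd).contDiffWithinAt
    · intro s hs
      rw [Set.mem_ofPred_eq]
      rw [hfst s (hsub hs), Metric.mem_ball, Real.dist_eq, abs_lt]
      exact ⟨by linarith [hs.1], by linarith [hs.2]⟩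
  refine ⟨fun s ↦ (α s).2.1, fun s ↦ (α s).2.2, by simp [hα0], by simp [hα0], ?_⟩
  filter_upwards [Ioo_mem_nhds (by linarith : t₀ - ρ < t₀) (by linarith : t₀ < t₀ + ρ)] with s hs
  have hs' := hsub (Set.Ioo_subset_Icc_self hs)
  have hd' := hα s hs'
  have hsm : ContDiffAt ℝ ∞ α s := hsmooth.contDiffAt (Icc_mem_nhds hs.1 hs.2)
  have e1 := hd'.snd.fst
  have e2 := hd'.snd.snd
  simp only [f, hfst s hs'] at e1 e2
  exact ⟨e1, e2, hsm.snd.fst, hsm.snd.snd⟩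

end LinearODE

end

/-! ### The function `k` and the global time `t` -/

section

namespace AlmostContactMetric

variable {M : Type*} [TopologicalSpace M]
  [ChartedSpace (EuclideanSpace ℝ (Fin 3)) M] [IsManifold (𝓡 3) ∞ M]

lemma exists_horizontal (S : AlmostContactMetric 3 M) (p : M) :
    ∃ v : TangentSpace (𝓡 3) p, v ≠ 0 ∧ S.η p v = 0 := by
  have h : LinearMap.ker (show EuclideanSpace ℝ (Fin 3) →ₗ[ℝ] ℝ from (S.η p).toLinearMap) ≠ ⊥ :=
    LinearMap.ker_ne_bot_of_finrank_lt (by simp)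
  obtain ⟨v, hv, hv0⟩ := Submodule.exists_mem_ne_zero_of_ne_bot h
  exact ⟨v, hv0, hv⟩

variable {S : AlmostContactMetric 3 M} {k μ : M → ℝ}

namespace IsAlmostKenmotsu

variable (hS : S.IsAlmostKenmotsu)
include hS

lemma exists_primitive_η (p : M) : ∃ τ : M → ℝ, ∀ᶠ q in 𝓝 p,
    ContMDiffAt (𝓡 3) 𝓘(ℝ, ℝ) ∞ τ q ∧
      ∀ v : TangentSpace (𝓡 3) q, mvfderiv (𝓡 3) τ q v = S.η q v := by
  obtain ⟨τ, hτ⟩ := exists_potential S.g (V := S.ξ) (p := p)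
    (Eventually.of_forall fun q ↦ S.smooth_ξ.smoothAt q)
    (Eventually.of_forall fun q ↦ hS.nabla_ξ_symm q)
  refine ⟨τ, hτ.mono fun q hq ↦ ⟨hq.1, fun v ↦ ?_⟩⟩
  rw [hq.2, S.inner_ξ]

variable (hK : S.IsGeneralizedKMu k μ)
include hK

lemma inner_B_B (p : M) (v : TangentSpace (𝓡 3) p) (hv : S.η p v = 0) :
    S.g.inner p (S.B p v) (S.B p v) = -(k p + 1) * S.g.inner p v v := by
  rw [hS.B_symm, hS.B_B hK, map_smul, AlmostContactMetric.proj_of_η_eq_zero hv, smul_eq_mul]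

/-- For horizontal `v ≠ 0`, `0 ≤ |Bv|² = -(k + 1)|v|²`. -/
lemma k_le (p : M) : k p ≤ -1 := by
  obtain ⟨v, hv0, hv⟩ := S.exists_horizontal p
  have h1 := hS.inner_B_B hK p v hv
  have h2 := S.g.pos p v hv0
  have h3 : 0 ≤ S.g.inner p (S.B p v) (S.B p v) := by
    by_cases h : S.B p v = 0
    · simp [h]
    · exact (S.g.pos p _ h).le
  rw [h1] at h3
  have := nonneg_of_mul_nonneg_left h3 h2
  linarith

lemma h_eq_zero_of_k_eq {p : M} (hkp : k p = -1) : S.h p = 0 := by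
  ext1 v
  have h0 : S.B p (S.proj p v) = S.B p v := by
    simp [proj, hS.B_ξ]
  have h1 := hS.inner_B_B hK p (S.proj p v) (AlmostContactMetric.η_proj p v)
  rw [hkp, h0] at h1
  have h2 : S.B p v = 0 := by
    by_contra h
    have := S.g.pos p _ h
    rw [h1] at this
    simp at this
  have h3 := hS.φ_B p v
  rw [h2, map_zero] at h3
  simpa using h3.symm

variable (hk : ContMDiff (𝓡 3) 𝓘(ℝ, ℝ) ∞ k)
  (hdk : ∀ (p : M) (v w : TangentSpace (𝓡 3) p),
    mvfderiv (𝓡 3) k p v * S.η p w - mvfderiv (𝓡 3) k p w * S.η p v = 0)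
include hk hdk

/-- Pairing `dk ∧ η = 0` with `ξ` gives `dk = ξ(k)η`, and a nonzero horizontal vector lets `ξ(k)` be
read off from `deriv_k_ξ_smul`. -/
lemma mvfderiv_k (p : M) (v : TangentSpace (𝓡 3) p) :
    mvfderiv (𝓡 3) k p v = -4 * (k p + 1) * S.η p v := by
  obtain ⟨u, hu0, hu⟩ := S.exists_horizontal p
  have h1 := hS.deriv_k_ξ_smul hK hk (smoothAt_ext u)
  have h2 : extendVec u p = u := by simp
  rw [h2, AlmostContactMetric.proj_of_η_eq_zero hu] at h1
  have h3 := smul_left_injective ℝ hu0 h1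
  have h4 := hdk p v (S.ξ p)
  rw [S.η_ξ, h3] at h4
  linarith

/-- If `dτ = η` locally, then `(k + 1)exp(4τ)` is locally constant, so the closed set `k = -1` is
also open. By connectedness it is empty or everything, and in the latter case `h` would vanish
identically. -/
lemma k_ne [ConnectedSpace M] (hh : ∃ p : M, S.h p ≠ 0) (p : M) : k p ≠ -1 := by
  have hopen : IsOpen {q | k q = -1} := by
    rw [isOpen_iff_mem_nhds]
    intro q hq
    obtain ⟨τ, hτ⟩ := hS.exists_primitive_η q
    have hconst := eventually_const_of_mvfderiv_eq_zero
      (F := fun q ↦ (k q + 1) * Real.exp (4 * τ q)) (p := q) (by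
      filter_upwards [hτ] with q' hq'
      have hk' : MDifferentiableAt (𝓡 3) 𝓘(ℝ, ℝ) (fun q ↦ k q + 1) q' :=
        ((hk q').mdifferentiableAt (by simp)).add mdifferentiableAt_const
      have hτ' := hq'.1.mdifferentiableAt (by simp : (∞ : WithTop ℕ∞) ≠ 0)
      have hexp : HasDerivAt (fun s : ℝ ↦ Real.exp (4 * s)) (Real.exp (4 * τ q') * 4) (τ q') := by
        simpa using ((hasDerivAt_id (τ q')).const_mul 4).exp
      have he := mdifferentiableAt_comp_hasDerivAt hexp hτ'
      refine ⟨hk'.mul he, ?_⟩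
      ext v
      rw [mvfderiv_fun_mul hk' he]
      have h1 : mvfderiv (𝓡 3) (fun q ↦ k q + 1) q' v = -4 * (k q' + 1) * S.η q' v := by
        rw [mvfderiv_fun_add ((hk q').mdifferentiableAt (by simp)) mdifferentiableAt_const,
          ← hS.mvfderiv_k hK hk hdk, _root_.add_apply,
          mvfderiv_eventually_const (c := 1) (Eventually.of_forall fun _ ↦ rfl), add_zero]
      simp only [_root_.add_apply, _root_.smul_apply, smul_eq_mul, _root_.zero_apply]
      rw [h1, mvfderiv_comp_hasDerivAt hexp hτ', hq'.2]
      ring)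
    filter_upwards [hconst] with q' hq'
    have hq0 : k q = -1 := hq
    rw [hq0] at hq'
    have : k q' + 1 = 0 := by
      simpa [Real.exp_ne_zero] using hq'
    change k q' = -1
    linarith
  have hclosed : IsClosed {q | k q = -1} := isClosed_eq hk.continuous continuous_const
  rcases isClopen_iff.1 ⟨hclosed, hopen⟩ with h | h
  · intro hp
    have : p ∈ {q | k q = -1} := hp
    rw [h] at this
    exact this
  · obtain ⟨q, hq⟩ := hh
    have : q ∈ {q | k q = -1} := by rw [h]; trivial
    exact absurd (hS.h_eq_zero_of_k_eq hK this) hq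

/-- The function `t` with `dt = η` and `k = -1 - exp (-4 t)`. -/
lemma exists_global_time [ConnectedSpace M] (hh : ∃ p : M, S.h p ≠ 0) :
    ∃ t : M → ℝ, ContMDiff (𝓡 3) 𝓘(ℝ, ℝ) ∞ t ∧
      (∀ (q : M) (v : TangentSpace (𝓡 3) q), mvfderiv (𝓡 3) t q v = S.η q v) ∧
      ∀ q, k q = -1 - Real.exp (-4 * t q) := by
  have hpos : ∀ q, 0 < -1 - k q := fun q ↦ by
    have := lt_of_le_of_ne (hS.k_le hK q) (hS.k_ne hK hk hdk hh q)
    linarith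
  refine ⟨fun q ↦ -(1 / 4) * Real.log (-1 - k q), fun q ↦ ?_, fun q v ↦ ?_, fun q ↦ ?_⟩
  · have h1 : ContDiffAt ℝ ∞ (fun s ↦ -(1 / 4) * Real.log (-1 - s)) (k q) :=
      contDiffAt_const.mul ((contDiffAt_const.sub contDiffAt_id).log (hpos q).ne')
    exact h1.contMDiffAt.comp q (hk q)
  · have h1 : HasDerivAt (fun s : ℝ ↦ -(1 / 4) * Real.log (-1 - s))
        (-(1 / 4) * (-1 / (-1 - k q))) (k q) := by
      have := (((hasDerivAt_id (k q)).const_sub (-1)).log (hpos q).ne').const_mul (-(1 / 4) : ℝ)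
      simpa using this
    rw [mvfderiv_comp_hasDerivAt h1 ((hk q).mdifferentiableAt (by simp)),
      hS.mvfderiv_k hK hk hdk]
    have := (hpos q).ne'
    field_simp
    ring
  · have : -4 * (-(1 / 4) * Real.log (-1 - k q)) = Real.log (-1 - k q) := by ring
    rw [this, Real.exp_log (hpos q)]
    ring

end IsAlmostKenmotsu

end AlmostContactMetric

end

/-! ### Orthonormal eigenframes of `B` -/

section

variable {M : Type*} [TopologicalSpace M]
  [ChartedSpace (EuclideanSpace ℝ (Fin 3)) M] [IsManifold (𝓡 3) ∞ M]

/-- Every tangent vector extends to a vector field that is smooth in a neighbourhood. -/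
lemma exists_eventually_smoothAt {n : ℕ} {M : Type*} [TopologicalSpace M]
    [ChartedSpace (EuclideanSpace ℝ (Fin n)) M] [IsManifold (𝓡 n) ∞ M] {p : M}
    (v : TangentSpace (𝓡 n) p) :
    ∃ W : VecField n M, W p = v ∧ ∀ᶠ q in 𝓝 p, SmoothAt W q := by
  have : IsManifold (𝓡 n) 1 M := IsManifold.of_le (n := ∞) (by simp)
  set e := chartAt (EuclideanSpace ℝ (Fin n)) p
  have he : e ∈ IsManifold.maximalAtlas (𝓡 n) ∞ M := IsManifold.chart_mem_maximalAtlas p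
  have hp : p ∈ e.source := mem_chart_source _ p
  refine ⟨mpullback (𝓡 n) (𝓡 n) e (constField (chartDeriv he hp v)), ?_, ?_⟩
  · rw [mpullback_apply, ← chartDeriv_coe he hp]
    erw [ContinuousLinearMap.inverse_equiv]
    exact (chartDeriv he hp).symm_apply_apply v
  · filter_upwards [e.open_source.mem_nhds hp] with q hq
    exact ContMDiffAt.mpullback_vectorField_preimage (n := ∞) (smoothAt_constField _ _)
      (contMDiffAt_of_mem_maximalAtlas he hq) ⟨chartDeriv he hq, rfl⟩ (by simp)

/-- At `q`, the fields `e₁, e₂` are smooth, and `(e₁, e₂, ξ)` is an orthonormal basis of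
eigenvectors of `B` with eigenvalues `l, -l, 0` such that `e₂ = -φ e₁`. -/
structure IsAdaptedFrame (S : AlmostContactMetric 3 M) (l : ℝ) (e₁ e₂ : VecField 3 M) (q : M) :
    Prop where
  smooth₁ : SmoothAt e₁ q
  smooth₂ : SmoothAt e₂ q
  η₁ : S.η q (e₁ q) = 0
  η₂ : S.η q (e₂ q) = 0
  inner₁₁ : S.g.inner q (e₁ q) (e₁ q) = 1
  inner₂₂ : S.g.inner q (e₂ q) (e₂ q) = 1
  inner₁₂ : S.g.inner q (e₁ q) (e₂ q) = 0
  inner₂₁ : S.g.inner q (e₂ q) (e₁ q) = 0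
  φ₁ : S.φ q (e₁ q) = - e₂ q
  φ₂ : S.φ q (e₂ q) = e₁ q
  B₁ : S.B q (e₁ q) = l • e₁ q
  B₂ : S.B q (e₂ q) = - l • e₂ q
  h₁ : S.h q (e₁ q) = l • e₂ q
  h₂ : S.h q (e₂ q) = l • e₁ q
  sum_eq : ∀ v : TangentSpace (𝓡 3) q,
    v = S.g.inner q v (e₁ q) • e₁ q + S.g.inner q v (e₂ q) • e₂ q + S.η q v • S.ξ q

namespace AlmostContactMetric

/-- Three orthonormal vectors form a basis. -/
lemma eq_sum_of_orthonormal (S : AlmostContactMetric 3 M) {q : M} {a b : TangentSpace (𝓡 3) q}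
    (ha : S.η q a = 0) (hb : S.η q b = 0) (haa : S.g.inner q a a = 1) (hbb : S.g.inner q b b = 1)
    (hab : S.g.inner q a b = 0) (v : TangentSpace (𝓡 3) q) :
    v = S.g.inner q v a • a + S.g.inner q v b • b + S.η q v • S.ξ q := by
  have hba : S.g.inner q b a = 0 := by rw [S.g.symm, hab]
  let L : EuclideanSpace ℝ (Fin 3) →ₗ[ℝ] (Fin 3 → ℝ) :=
    LinearMap.pi ![(S.g.inner q a).toLinearMap, (S.g.inner q b).toLinearMap, (S.η q).toLinearMap]
  have hL : ∀ w : TangentSpace (𝓡 3) q, L w = ![S.g.inner q a w, S.g.inner q b w, S.η q w] := by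
    intro w
    ext i
    fin_cases i <;> rfl
  have hsurj : Function.Surjective L := by
    intro c
    refine ⟨(c 0 • a + c 1 • b + c 2 • S.ξ q : TangentSpace (𝓡 3) q), ?_⟩
    rw [hL]
    ext i
    fin_cases i <;>
      simp [haa, hab, hba, hbb, S.inner_ξ_right, ha, hb, S.η_ξ]
  have hinj := (LinearMap.injective_iff_surjective_of_finrank_eq_finrank (by simp)).2 hsurj
  refine hinj ?_
  rw [hL, hL]
  ext i
  fin_cases i <;>
    simp [haa, hab, hba, hbb, S.inner_ξ_right, ha, hb, S.η_ξ, S.g.symm q v]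

variable {S : AlmostContactMetric 3 M} {k μ : M → ℝ}

namespace IsAlmostKenmotsu

variable (hS : S.IsAlmostKenmotsu)
include hS

/-- `φ` is skew, isometric on horizontal vectors, and anticommutes with `B`. One unit eigenvector
for `l` therefore yields, through `-φ`, an orthogonal one for `-l`. -/
lemma isAdaptedFrame_of_unit {l : ℝ} {e₁ : VecField 3 M} {q : M} (h : SmoothAt e₁ q)
    (hη : S.η q (e₁ q) = 0) (hu : S.g.inner q (e₁ q) (e₁ q) = 1)
    (hB : S.B q (e₁ q) = l • e₁ q) :
    IsAdaptedFrame S l e₁ (fun q ↦ - S.φ q (e₁ q)) q := by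
  have hφφ : S.φ q (S.φ q (e₁ q)) = - e₁ q := by
    rw [S.φ_φ, hη, zero_smul, add_zero]
  have hh : S.h q (e₁ q) = - (l • S.φ q (e₁ q)) := by
    have := hS.φ_B q (e₁ q)
    rw [hB, map_smul] at this
    rw [this, neg_neg]
  have h22 : S.g.inner q (S.φ q (e₁ q)) (S.φ q (e₁ q)) = 1 := by
    rw [S.inner_φ_φ, hu, hη]; simp
  have h12 : S.g.inner q (e₁ q) (S.φ q (e₁ q)) = 0 := by
    have := S.inner_φ_left q (e₁ q) (e₁ q)
    rw [S.g.symm] at this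
    linarith
  have h21 : S.g.inner q (S.φ q (e₁ q)) (e₁ q) = 0 := by rw [S.g.symm, h12]
  refine ⟨h, (S.smoothAt_φ h).neg, hη, by simp [S.η_φ], hu, by simp [h22], by simp [h12],
    by simp [h21], by simp, by simp [hφφ], hB, ?_, by simp [hh], ?_, fun v ↦ ?_⟩
  · simp [hS.B_φ, hh]
  · simp [hS.h_φ, hh, hφφ]
  · exact S.eq_sum_of_orthonormal hη (by simp [S.η_φ]) hu (by simp [h22]) (by simp [h12]) v

/-- As `B² = l²P`, the operator `B + lP` maps into the `l`-eigenspace, so applying it to a local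
field and normalising gives `e₁`. It does not kill all horizontal vectors: if `Bv = -lv`, then
`B(φv) = lφv`. -/
lemma exists_adaptedFrame {l : M → ℝ} {p : M} (hl : ∀ᶠ q in 𝓝 p,
      ContMDiffAt (𝓡 3) 𝓘(ℝ, ℝ) ∞ l q ∧ 0 < l q ∧ ∀ v, S.B q (S.B q v) = l q ^ 2 • S.proj q v) :
    ∃ e₁ e₂ : VecField 3 M, ∀ᶠ q in 𝓝 p, IsAdaptedFrame S (l q) e₁ e₂ q := by
  obtain ⟨w, hw, hw0⟩ : ∃ w : TangentSpace (𝓡 3) p,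
      S.η p w = 0 ∧ S.B p w + l p • S.proj p w ≠ 0 := by
    obtain ⟨v, hv0, hv⟩ := S.exists_horizontal p
    by_cases hv1 : S.B p v + l p • S.proj p v = 0
    · refine ⟨S.φ p v, S.η_φ p v, fun h ↦ ?_⟩
      rw [AlmostContactMetric.proj_of_η_eq_zero hv, add_eq_zero_iff_eq_neg] at hv1
      have h1 : S.h p v = l p • S.φ p v := by
        have := hS.φ_B p v
        rw [hv1, map_neg, map_smul] at this
        exact (neg_injective this).symm
      rw [hS.B_φ, h1, AlmostContactMetric.proj_of_η_eq_zero (S.η_φ p v), ← add_smul,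
        smul_eq_zero] at h
      rcases h with h | h
      · linarith [hl.self_of_nhds.2.1]
      · have h2 := S.inner_φ_φ p v v
        rw [h, hv] at h2
        have := S.g.pos p v hv0
        simp at h2
        linarith
    · exact ⟨v, hv, hv1⟩
  obtain ⟨W, hWp, hW⟩ := exists_eventually_smoothAt w
  let U : VecField 3 M := fun q ↦ S.B q (W q) + l q • S.proj q (W q)
  have hBU : ∀ᶠ q in 𝓝 p, S.B q (U q) = l q • U q := by
    filter_upwards [hl] with q hq
    have h1 : S.B q (S.proj q (W q)) = S.B q (W q) := by
      simp [proj, hS.B_ξ]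
    simp only [U, map_add, map_smul, h1, hq.2.2]
    module
  have hηU : ∀ q, S.η q (U q) = 0 := fun q ↦ by
    simp [U, hS.η_B, AlmostContactMetric.η_proj]
  have hU : ∀ᶠ q in 𝓝 p, SmoothAt U q := by
    filter_upwards [hl, hW] with q hq hWq
    exact (S.smoothAt_B hWq).add
      (SmoothAt.smul hq.1 (AlmostContactMetric.smoothAt_proj hWq))
  have hUp := hU.self_of_nhds
  have hUp0 : U p ≠ 0 := by simpa only [U, hWp] using hw0
  have hN : ∀ᶠ q in 𝓝 p, 0 < S.g.inner q (U q) (U q) :=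
    (S.g.smoothAt hUp hUp).continuousAt.eventually (lt_mem_nhds (S.g.pos p _ hUp0))
  let e₁ : VecField 3 M := fun q ↦ (√(S.g.inner q (U q) (U q)))⁻¹ • U q
  refine ⟨e₁, fun q ↦ - S.φ q (e₁ q), ?_⟩
  filter_upwards [hN, hU, hBU] with q hq hUq hBq
  have hs : 0 < √(S.g.inner q (U q) (U q)) := Real.sqrt_pos.2 hq
  refine hS.isAdaptedFrame_of_unit ?_ (by simp [e₁, hηU]) ?_ ?_
  · refine SmoothAt.smul ?_ hUq
    have h1 : ContDiffAt ℝ ∞ (fun s ↦ (√s)⁻¹) (S.g.inner q (U q) (U q)) :=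
      (contDiffAt_id.sqrt hq.ne').inv hs.ne'
    exact ContMDiffAt.comp (I' := 𝓘(ℝ, ℝ)) (g := fun s : ℝ ↦ (√s)⁻¹)
      (f := fun q ↦ S.g.inner q (U q) (U q)) q h1.contMDiffAt (S.g.smoothAt hUq hUq)
  · simp only [e₁, map_smul, _root_.smul_apply, smul_eq_mul]
    have := Real.mul_self_sqrt hq.le
    field_simp
    nlinarith
  · simp only [e₁, map_smul, hBq]
    rw [smul_comm]

end IsAlmostKenmotsu

end AlmostContactMetric

end

/-! ### Brackets of the eigenframe, and horizontal constancy of `μ` -/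

section

variable {M : Type*} [TopologicalSpace M]
  [ChartedSpace (EuclideanSpace ℝ (Fin 3)) M] [IsManifold (𝓡 3) ∞ M]
  {S : AlmostContactMetric 3 M} {k μ l : M → ℝ} {e₁ e₂ : VecField 3 M} {p : M}

/-- A unit vector field is orthogonal to its covariant derivatives. -/
lemma inner_leviCivita_self {n : ℕ} {M : Type*} [TopologicalSpace M]
    [ChartedSpace (EuclideanSpace ℝ (Fin n)) M] [IsManifold (𝓡 n) ∞ M] (g : Metric n M)
    {X : VecField n M} {p : M} (hX : DiffAt X p) (h : ∀ᶠ q in 𝓝 p, g.inner q (X q) (X q) = 1)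
    (v : TangentSpace (𝓡 n) p) : g.inner p (leviCivita g X p v) (X p) = 0 := by
  have h1 := leviCivita_metric g hX hX v
  rw [mvfderiv_eventually_const h, g.symm p (X p)] at h1
  linarith

namespace IsAdaptedFrame

lemma mvfderiv_eq_zero (hl : ∀ v : TangentSpace (𝓡 3) p, mvfderiv (𝓡 3) l p v = -2 * l p * S.η p v)
    {v : TangentSpace (𝓡 3) p} (hv : S.η p v = 0) : mvfderiv (𝓡 3) l p v = 0 := by
  rw [hl, hv, mul_zero]

variable (hF : ∀ᶠ q in 𝓝 p, IsAdaptedFrame S (l q) e₁ e₂ q) (hS : S.IsAlmostKenmotsu)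
  (hK : S.IsGeneralizedKMu k μ) (hlp : 0 < l p) (hls : MDifferentiableAt (𝓡 3) 𝓘(ℝ, ℝ) l p)
  (hl : ∀ v : TangentSpace (𝓡 3) p, mvfderiv (𝓡 3) l p v = -2 * l p * S.η p v)
include hF hS hK hlp hls hl

/-- The `e₁`-component is `-g(∇_{e₁} ξ, e₁)`, since `∇_ξ e₁` is orthogonal to the unit field `e₁`.
Pairing `(L_ξ B)e₁ = μhe₁ - 2Be₁` with `e₂` gives `2l g([ξ, e₁], e₂) = μl`. -/
lemma mlieBracket_ξ₁ : mlieBracket (𝓡 3) S.ξ e₁ p =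
    (-(1 - l p)) • e₁ p + (μ p / 2) • e₂ p := by
  have F := hF.self_of_nhds
  have hη : S.η p (mlieBracket (𝓡 3) S.ξ e₁ p) = 0 := by
    rw [hS.η_lie F.smooth₁, mvfderiv_eventually_const (hF.mono fun q hq ↦ hq.η₁)]
  have h1 := hS.lie_B hK F.smooth₁
  rw [mlieBracket_congr_right (hF.mono fun q hq ↦ hq.B₁),
    mlieBracket_fun_smul_right hls F.smooth₁.diffAt, hl, S.η_ξ, F.h₁, F.B₁] at h1
  have h2 := leviCivita_torsion S.g (S.smooth_ξ.diffAt p) F.smooth₁.diffAt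
  have h3 : S.g.inner p (mlieBracket (𝓡 3) S.ξ e₁ p) (e₁ p) = -(1 - l p) := by
    rw [← h2, hS.nabla_ξ, F.B₁, AlmostContactMetric.proj_of_η_eq_zero F.η₁]
    simp only [map_sub, map_smul, _root_.sub_apply, _root_.smul_apply, smul_eq_mul,
      inner_leviCivita_self S.g F.smooth₁.diffAt (hF.mono fun q hq ↦ hq.inner₁₁), F.inner₁₁]
    ring
  have h4 := F.sum_eq (mlieBracket (𝓡 3) S.ξ e₁ p)
  rw [h3, hη, zero_smul, add_zero] at h4
  have h5 := congrArg (fun w ↦ S.g.inner p w (e₂ p)) h1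
  rw [h4] at h5 ⊢
  simp only [map_sub, map_add, map_smul, _root_.sub_apply, _root_.add_apply, _root_.smul_apply,
    smul_eq_mul, F.B₁, F.B₂, F.inner₁₂, F.inner₂₂] at h5
  have h6 : S.g.inner p (mlieBracket (𝓡 3) S.ξ e₁ p) (e₂ p) = μ p / 2 := by
    apply mul_left_cancel₀ hlp.ne'
    linarith
  rw [h6]

/-- This is `mlieBracket_ξ₁` transported by `L_ξ φ = 2h`, as `e₂ = -φe₁`. -/
lemma mlieBracket_ξ₂ : mlieBracket (𝓡 3) S.ξ e₂ p =
    (-(μ p / 2)) • e₁ p + (-(1 + l p)) • e₂ p := by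
  have F := hF.self_of_nhds
  have h1 := AlmostContactMetric.mlieBracket_ξ_φ S F.smooth₁.diffAt
  have h2 : mlieBracket (𝓡 3) S.ξ (fun q ↦ S.φ q (e₁ q)) p = - mlieBracket (𝓡 3) S.ξ e₂ p := by
    rw [mlieBracket_congr_right (Z := fun q ↦ (-1 : ℝ) • e₂ q) (hF.mono fun q hq ↦ by
      simp [hq.φ₁]), mlieBracket_fun_smul_right mdifferentiableAt_const F.smooth₂.diffAt,
      mvfderiv_eventually_const (c := -1) (Eventually.of_forall fun _ ↦ rfl)]
    simp
  rw [h2, mlieBracket_ξ₁ hF hS hK hlp hls hl, map_add, map_smul, map_smul, F.φ₁, F.φ₂,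
    F.h₁, neg_eq_iff_eq_neg] at h1
  rw [h1]
  module

/-- The nullity condition gives `R(e₁, e₂)ξ = 0`. Since `∇_{e₁} ξ = (1 - l)e₁`, `∇_{e₂} ξ = (1 +
l)e₂` and `l` is constant horizontally, this reads `l(∇_{e₁} e₂ + ∇_{e₂} e₁) + B[e₁, e₂] = 0`. By
orthogonality of a unit field to its derivatives, its components are `±2l` times those of `[e₁,
e₂]`. -/
lemma mlieBracket₁₂ : mlieBracket (𝓡 3) e₁ e₂ p = 0 := by
  have F := hF.self_of_nhds
  have hη : S.η p (mlieBracket (𝓡 3) e₁ e₂ p) = 0 := by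
    rw [hS.η_mlieBracket F.smooth₁ F.smooth₂,
      mvfderiv_eventually_const (hF.mono fun q hq ↦ hq.η₁),
      mvfderiv_eventually_const (hF.mono fun q hq ↦ hq.η₂), sub_zero]
  have hR := hK p e₁ e₂ F.smooth₁ F.smooth₂
  have n1 : ∀ᶠ q in 𝓝 p, (1 - l q) • e₁ q = leviCivita S.g S.ξ q (e₁ q) := by
    filter_upwards [hF] with q hq
    rw [hS.nabla_ξ, AlmostContactMetric.proj_of_η_eq_zero hq.η₁, hq.B₁]
    module
  have n2 : ∀ᶠ q in 𝓝 p, (1 + l q) • e₂ q = leviCivita S.g S.ξ q (e₂ q) := by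
    filter_upwards [hF] with q hq
    rw [hS.nabla_ξ, AlmostContactMetric.proj_of_η_eq_zero hq.η₂, hq.B₂]
    module
  have d1 : MDifferentiableAt (𝓡 3) 𝓘(ℝ, ℝ) (fun q ↦ 1 - l q) p := mdifferentiableAt_const.sub hls
  have d2 : MDifferentiableAt (𝓡 3) 𝓘(ℝ, ℝ) (fun q ↦ 1 + l q) p := mdifferentiableAt_const.add hls
  have c1 : mvfderiv (𝓡 3) (fun q ↦ 1 - l q) p (e₂ p) = 0 := by
    rw [mvfderiv_fun_sub mdifferentiableAt_const hls, _root_.sub_apply,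
      mvfderiv_eq_zero hl F.η₂,
      mvfderiv_eventually_const (c := 1) (Eventually.of_forall fun _ ↦ rfl), sub_zero]
  have c2 : mvfderiv (𝓡 3) (fun q ↦ 1 + l q) p (e₁ p) = 0 := by
    rw [mvfderiv_fun_add mdifferentiableAt_const hls, _root_.add_apply,
      mvfderiv_eq_zero hl F.η₁,
      mvfderiv_eventually_const (c := 1) (Eventually.of_forall fun _ ↦ rfl), add_zero]
  unfold curvature at hR
  rw [← leviCivita_congr S.g (DiffAt.smul d1 F.smooth₁.diffAt) n1,
    ← leviCivita_congr S.g (DiffAt.smul d2 F.smooth₂.diffAt) n2,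
    leviCivita_smul S.g d1 F.smooth₁.diffAt, leviCivita_smul S.g d2 F.smooth₂.diffAt, c1, c2,
    hS.nabla_ξ, AlmostContactMetric.proj_of_η_eq_zero hη, F.η₁, F.η₂] at hR
  have ht := leviCivita_torsion S.g F.smooth₁.diffAt F.smooth₂.diffAt
  set a := leviCivita S.g e₂ p (e₁ p)
  set b := leviCivita S.g e₁ p (e₂ p)
  have ha : S.g.inner p a (e₂ p) = 0 :=
    inner_leviCivita_self S.g F.smooth₂.diffAt (hF.mono fun q hq ↦ hq.inner₂₂) _
  have hb : S.g.inner p b (e₁ p) = 0 :=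
    inner_leviCivita_self S.g F.smooth₁.diffAt (hF.mono fun q hq ↦ hq.inner₁₁) _
  have t1 := congrArg (fun w ↦ S.g.inner p w (e₁ p)) ht
  have t2 := congrArg (fun w ↦ S.g.inner p w (e₂ p)) ht
  have r1 := congrArg (fun w ↦ S.g.inner p w (e₁ p)) hR
  have r2 := congrArg (fun w ↦ S.g.inner p w (e₂ p)) hR
  simp only [map_sub, map_add, map_smul, _root_.sub_apply, _root_.add_apply, _root_.smul_apply,
    smul_eq_mul, hS.B_symm, F.B₁, F.B₂, ha, hb, mul_zero, add_zero, sub_zero, zero_sub,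
    map_zero, _root_.zero_apply, zero_smul] at t1 t2 r1 r2
  have h1 : S.g.inner p (mlieBracket (𝓡 3) e₁ e₂ p) (e₁ p) = 0 := by
    apply (mul_eq_zero.1 (_ : l p * _ = 0)).resolve_left hlp.ne'
    rw [t1] at r1
    linarith
  have h2 : S.g.inner p (mlieBracket (𝓡 3) e₁ e₂ p) (e₂ p) = 0 := by
    apply (mul_eq_zero.1 (_ : l p * _ = 0)).resolve_left hlp.ne'
    have : S.g.inner p b (e₂ p) = - S.g.inner p (mlieBracket (𝓡 3) e₁ e₂ p) (e₂ p) := by linarith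
    rw [this] at r2
    linarith
  rw [F.sum_eq (mlieBracket (𝓡 3) e₁ e₂ p), h1, h2, hη]
  simp

end IsAdaptedFrame

/-- In an adapted frame, the Jacobi identity shows that `μ` is constant in horizontal
directions. -/
lemma IsAdaptedFrame.mvfderiv_μ_eq_zero (hS : S.IsAlmostKenmotsu) (hK : S.IsGeneralizedKMu k μ)
    (hF : ∀ᶠ q in 𝓝 p, IsAdaptedFrame S (l q) e₁ e₂ q)
    (hl : ∀ᶠ q in 𝓝 p, 0 < l q ∧ MDifferentiableAt (𝓡 3) 𝓘(ℝ, ℝ) l q ∧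
      ∀ v : TangentSpace (𝓡 3) q, mvfderiv (𝓡 3) l q v = -2 * l q * S.η q v)
    (hμ : MDifferentiableAt (𝓡 3) 𝓘(ℝ, ℝ) μ p) {v : TangentSpace (𝓡 3) p} (hv : S.η p v = 0) :
    mvfderiv (𝓡 3) μ p v = 0 := by
  have : IsManifold (𝓡 3) (minSmoothness ℝ 3) M :=
    IsManifold.of_le (n := ∞) (by simp; exact WithTop.coe_le_coe.2 (le_top : (3 : ℕ∞) ≤ ⊤))
  have h2 : minSmoothness ℝ 2 ≤ ∞ := by
    simp; exact WithTop.coe_le_coe.2 (le_top : (2 : ℕ∞) ≤ ⊤)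
  have F := hF.self_of_nhds
  obtain ⟨hlp, hls, hld⟩ := hl.self_of_nhds
  -- Once the known brackets are inserted, the Jacobi identity for `ξ, e₁, e₂` reduces to `e₁(μ)e₁ +
  -- e₂(μ)e₂ = 0`.
  have hJ := leibniz_identity_mlieBracket_apply ((S.smooth_ξ.smoothAt p).of_le h2)
    (F.smooth₁.of_le h2) (F.smooth₂.of_le h2)
  have hE := (hF.eventually_nhds.and hl)
  have b12 := hE.mono fun q hq ↦ mlieBracket₁₂ hq.1 hS hK hq.2.1 hq.2.2.1 hq.2.2.2
  have b1 := hE.mono fun q hq ↦ mlieBracket_ξ₁ hq.1 hS hK hq.2.1 hq.2.2.1 hq.2.2.2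
  have b2 := hE.mono fun q hq ↦ mlieBracket_ξ₂ hq.1 hS hK hq.2.1 hq.2.2.1 hq.2.2.2
  have s1 := F.smooth₁.diffAt
  have s2 := F.smooth₂.diffAt
  have cst : ∀ c : ℝ, ∀ w, mvfderiv (𝓡 3) (fun _ : M ↦ c) p w = 0 := fun c w ↦
    mvfderiv_eventually_const (c := c) (Eventually.of_forall fun _ ↦ rfl) w
  have l0 : ∀ w, S.η p w = 0 → mvfderiv (𝓡 3) l p w = 0 := fun w hw ↦ mvfderiv_eq_zero hld hw
  have dμ : MDifferentiableAt (𝓡 3) 𝓘(ℝ, ℝ) (fun q ↦ 2⁻¹ * μ q) p := mdifferentiableAt_const.mul hμ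
  have dμ' : MDifferentiableAt (𝓡 3) 𝓘(ℝ, ℝ) (fun q ↦ -2⁻¹ * μ q) p :=
    mdifferentiableAt_const.mul hμ
  have vμ : ∀ c : ℝ, ∀ w, mvfderiv (𝓡 3) (fun q ↦ c * μ q) p w = c * mvfderiv (𝓡 3) μ p w := by
    intro c w
    rw [mvfderiv_fun_mul mdifferentiableAt_const hμ]
    simp [cst]
  have dl : MDifferentiableAt (𝓡 3) 𝓘(ℝ, ℝ) (fun q ↦ l q - 1) p := hls.sub mdifferentiableAt_const
  have dl' : MDifferentiableAt (𝓡 3) 𝓘(ℝ, ℝ) (fun q ↦ -1 - l q) p := mdifferentiableAt_const.sub hls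
  have vl : ∀ w, S.η p w = 0 → mvfderiv (𝓡 3) (fun q ↦ l q - 1) p w = 0 := by
    intro w hw
    rw [mvfderiv_fun_sub hls mdifferentiableAt_const, _root_.sub_apply, l0 w hw, cst, sub_zero]
  have vl' : ∀ w, S.η p w = 0 → mvfderiv (𝓡 3) (fun q ↦ -1 - l q) p w = 0 := by
    intro w hw
    rw [mvfderiv_fun_sub mdifferentiableAt_const hls, _root_.sub_apply, l0 w hw, cst, sub_zero]
  rw [mlieBracket_eq_zero_of_eventually b12, mlieBracket_swap_apply (W := e₂),
    mlieBracket_congr_right (X := e₂) (Z := fun q ↦ (l q - 1) • e₁ q + (2⁻¹ * μ q) • e₂ q)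
      (b1.mono fun q hq ↦ by rw [hq]; module),
    mlieBracket_congr_right (X := e₁) (Z := fun q ↦ (-2⁻¹ * μ q) • e₁ q + (-1 - l q) • e₂ q)
      (b2.mono fun q hq ↦ by rw [hq]; module),
    mlieBracket_fun_add_right (DiffAt.smul dl s1) (DiffAt.smul dμ s2),
    mlieBracket_fun_add_right (DiffAt.smul dμ' s1) (DiffAt.smul dl' s2),
    mlieBracket_fun_smul_right dl s1, mlieBracket_fun_smul_right dμ s2,
    mlieBracket_fun_smul_right dμ' s1, mlieBracket_fun_smul_right dl' s2,
    mlieBracket_swap_apply (V := e₂), b12.self_of_nhds, vl _ F.η₂, vl' _ F.η₁, vμ, vμ] at hJ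
  simp only [mlieBracket_self, Pi.zero_apply, neg_zero, smul_zero, zero_smul, zero_add, add_zero]
    at hJ
  have g1 := congrArg (fun w ↦ S.g.inner p w (e₁ p)) hJ
  have g2 := congrArg (fun w ↦ S.g.inner p w (e₂ p)) hJ
  simp only [map_zero, map_add, map_neg, map_smul, _root_.zero_apply, _root_.add_apply,
    _root_.neg_apply, _root_.smul_apply, smul_eq_mul, F.inner₁₁, F.inner₂₂, F.inner₁₂, F.inner₂₁]
    at g1 g2
  have z1 : mvfderiv (𝓡 3) μ p (e₁ p) = 0 := by linarith
  have z2 : mvfderiv (𝓡 3) μ p (e₂ p) = 0 := by linarith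
  rw [F.sum_eq v, hv]
  simp [z1, z2]

end

/-! ### Closed forms `u(t)θ₁ + v(t)θ₂` and the chart they define -/

section

/-- The right-hand side is the exterior derivative of `g(V, ·)`; the identity turns the symmetry
required by `exists_potential` into bracket computations. -/
lemma inner_leviCivita_sub {n : ℕ} {M : Type*} [TopologicalSpace M]
    [ChartedSpace (EuclideanSpace ℝ (Fin n)) M] [IsManifold (𝓡 n) ∞ M] (g : Metric n M)
    {V X Y : VecField n M} {p : M} (hV : DiffAt V p) (hX : DiffAt X p) (hY : DiffAt Y p) :
    g.inner p (leviCivita g V p (X p)) (Y p) - g.inner p (leviCivita g V p (Y p)) (X p) =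
      mvfderiv (𝓡 n) (fun q ↦ g.inner q (V q) (Y q)) p (X p)
        - mvfderiv (𝓡 n) (fun q ↦ g.inner q (V q) (X q)) p (Y p)
        - g.inner p (V p) (mlieBracket (𝓡 n) X Y p) := by
  rw [leviCivita_metric g hV hY, leviCivita_metric g hV hX, ← leviCivita_torsion g hX hY, map_sub]
  ring

variable {M : Type*} [TopologicalSpace M]
  [ChartedSpace (EuclideanSpace ℝ (Fin 3)) M] [IsManifold (𝓡 3) ∞ M]
  {S : AlmostContactMetric 3 M} {k μ t : M → ℝ} {e₁ e₂ : VecField 3 M} {p : M}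

/-- The linear system satisfied by the coefficients of the coordinate differentials in an adapted
frame. -/
def IsCoeff (m u v : ℝ → ℝ) (s : ℝ) : Prop :=
  HasDerivAt u (-(1 - Real.exp (-2 * s)) * u s + m s / 2 * v s) s ∧
    HasDerivAt v (-(m s / 2) * u s + -(1 + Real.exp (-2 * s)) * v s) s ∧
    ContDiffAt ℝ ∞ u s ∧ ContDiffAt ℝ ∞ v s

lemma exists_isCoeff {m : ℝ → ℝ} {t₀ : ℝ} (hm : ∀ᶠ s in 𝓝 t₀, ContDiffAt ℝ ∞ m s) (u₀ v₀ : ℝ) :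
    ∃ u v : ℝ → ℝ, u t₀ = u₀ ∧ v t₀ = v₀ ∧ ∀ᶠ s in 𝓝 t₀, IsCoeff m u v s := by
  have he : ContDiff ℝ ∞ fun s : ℝ ↦ Real.exp (-2 * s) := by fun_prop
  exact exists_linear_ode
    (Eventually.of_forall fun s ↦ (contDiff_const.sub he).neg.contDiffAt)
    (hm.mono fun s hs ↦ hs.div_const 2) (hm.mono fun s hs ↦ (hs.div_const 2).neg)
    (Eventually.of_forall fun s ↦ (contDiff_const.add he).neg.contDiffAt) u₀ v₀

/-- Liouville's formula: the system has trace `-(1 - λ) - (1 + λ) = -2`, so the determinant times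
`exp(2s)` is constant. -/
lemma IsCoeff.det_eq {m u v u' v' : ℝ → ℝ} {t₀ : ℝ} (h : ∀ᶠ s in 𝓝 t₀, IsCoeff m u v s)
    (h' : ∀ᶠ s in 𝓝 t₀, IsCoeff m u' v' s)
    (h₀ : u t₀ * v' t₀ - v t₀ * u' t₀ = Real.exp (-2 * t₀)) :
    ∀ᶠ s in 𝓝 t₀, u s * v' s - v s * u' s = Real.exp (-2 * s) := by
  obtain ⟨r, hr, hb⟩ := Metric.eventually_nhds_iff_ball.1 (h.and h')
  have hd : ∀ s ∈ Metric.ball t₀ r,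
      HasDerivAt (fun s ↦ (u s * v' s - v s * u' s) * Real.exp (2 * s)) 0 s := by
    intro s hs
    obtain ⟨⟨h1, h2, -⟩, h3, h4, -⟩ := hb s hs
    have hexp : HasDerivAt (fun s : ℝ ↦ Real.exp (2 * s)) (Real.exp (2 * s) * 2) s := by
      simpa using ((hasDerivAt_id s).const_mul 2).exp
    refine (((h1.fun_mul h4).fun_sub (h2.fun_mul h3)).fun_mul hexp).congr_deriv ?_
    ring
  filter_upwards [Metric.ball_mem_nhds t₀ hr] with s hs
  have h5 := Metric.isOpen_ball.is_const_of_deriv_eq_zero (convex_ball t₀ r).isPreconnected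
    (fun s hs ↦ (hd s hs).differentiableAt.differentiableWithinAt)
    (fun s hs ↦ (hd s hs).deriv) hs (Metric.mem_ball_self hr)
  simp only [h₀, ← Real.exp_add] at h5
  have h6 : -2 * t₀ + 2 * t₀ = 0 := by ring
  rw [h6, Real.exp_zero] at h5
  rw [neg_mul, Real.exp_neg]
  exact eq_inv_of_mul_eq_one_left h5

/-- Solutions of the linear system give closed `1`-forms, hence coordinate functions. -/
lemma exists_coord_of_isCoeff (hS : S.IsAlmostKenmotsu) (hK : S.IsGeneralizedKMu k μ)
    (ht : ContMDiff (𝓡 3) 𝓘(ℝ, ℝ) ∞ t)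
    (hdt : ∀ (q : M) (v : TangentSpace (𝓡 3) q), mvfderiv (𝓡 3) t q v = S.η q v)
    (hF : ∀ᶠ q in 𝓝 p, IsAdaptedFrame S (Real.exp (-2 * t q)) e₁ e₂ q)
    {m u v : ℝ → ℝ} (hm : ∀ᶠ q in 𝓝 p, μ q = m (t q)) (h : ∀ᶠ s in 𝓝 (t p), IsCoeff m u v s) :
    ∃ x : M → ℝ, ∀ᶠ q in 𝓝 p, ContMDiffAt (𝓡 3) 𝓘(ℝ, ℝ) ∞ x q ∧
      ∀ w : TangentSpace (𝓡 3) q, mvfderiv (𝓡 3) x q w =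
        u (t q) * S.g.inner q w (e₁ q) + v (t q) * S.g.inner q w (e₂ q) := by
  have hq : ∀ᶠ q in 𝓝 p, IsCoeff m u v (t q) := ht.continuous.continuousAt.eventually h
  -- The metric dual of `uθ₁ + vθ₂`. In `e31` and `e32` the linear system cancels the bracket terms;
  -- in `e12` everything vanishes because `[e₁, e₂] = 0` and `dt(eᵢ) = 0`.
  let V : VecField 3 M := fun q ↦ u (t q) • e₁ q + v (t q) • e₂ q
  have hV : ∀ᶠ q in 𝓝 p, SmoothAt V q := by
    filter_upwards [hF, hq] with q F hq
    have k1 : ContMDiffAt (𝓡 3) 𝓘(ℝ, ℝ) ∞ (fun q ↦ u (t q)) q :=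
      ContMDiffAt.comp (I' := 𝓘(ℝ, ℝ)) (g := u) (f := t) q hq.2.2.1.contMDiffAt (ht q)
    have k2 : ContMDiffAt (𝓡 3) 𝓘(ℝ, ℝ) ∞ (fun q ↦ v (t q)) q :=
      ContMDiffAt.comp (I' := 𝓘(ℝ, ℝ)) (g := v) (f := t) q hq.2.2.2.contMDiffAt (ht q)
    exact (SmoothAt.smul k1 F.smooth₁).add (SmoothAt.smul k2 F.smooth₂)
  obtain ⟨x, hx⟩ := exists_potential S.g hV (by
    filter_upwards [hF.eventually_nhds, hq, hV, hm] with q hFq hcq hVq hmq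
    have F := hFq.self_of_nhds
    have htd := (ht q).mdifferentiableAt (by simp : (∞ : WithTop ℕ∞) ≠ 0)
    have hexp : HasDerivAt (fun s : ℝ ↦ Real.exp (-2 * s)) (Real.exp (-2 * t q) * -2) (t q) := by
      simpa using ((hasDerivAt_id (t q)).const_mul (-2)).exp
    have hls := mdifferentiableAt_comp_hasDerivAt hexp htd
    have hld : ∀ v : TangentSpace (𝓡 3) q, mvfderiv (𝓡 3) (fun q ↦ Real.exp (-2 * t q)) q v =
        -2 * Real.exp (-2 * t q) * S.η q v := by
      intro v
      rw [mvfderiv_comp_hasDerivAt hexp htd, hdt]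
      ring
    have hlp := Real.exp_pos (-2 * t q)
    have b12 := IsAdaptedFrame.mlieBracket₁₂ hFq hS hK hlp hls hld
    have b1 := IsAdaptedFrame.mlieBracket_ξ₁ hFq hS hK hlp hls hld
    have b2 := IsAdaptedFrame.mlieBracket_ξ₂ hFq hS hK hlp hls hld
    have i1 : ∀ᶠ q' in 𝓝 q, S.g.inner q' (V q') (e₁ q') = u (t q') := by
      filter_upwards [hFq] with q' F'
      simp [V, F'.inner₁₁, F'.inner₂₁]
    have i2 : ∀ᶠ q' in 𝓝 q, S.g.inner q' (V q') (e₂ q') = v (t q') := by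
      filter_upwards [hFq] with q' F'
      simp [V, F'.inner₁₂, F'.inner₂₂]
    have i3 : ∀ᶠ q' in 𝓝 q, S.g.inner q' (V q') (S.ξ q') = 0 := by
      filter_upwards [hFq] with q' F'
      simp [V, S.inner_ξ_right, F'.η₁, F'.η₂]
    have s1 := F.smooth₁.diffAt
    have s2 := F.smooth₂.diffAt
    have s3 := S.smooth_ξ.diffAt q
    have e12 := inner_leviCivita_sub S.g hVq.diffAt s1 s2
    have e31 := inner_leviCivita_sub S.g hVq.diffAt s3 s1
    have e32 := inner_leviCivita_sub S.g hVq.diffAt s3 s2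
    rw [mvfderiv_congr i1, mvfderiv_congr i2, b12, mvfderiv_comp_hasDerivAt hcq.1 htd,
      mvfderiv_comp_hasDerivAt hcq.2.1 htd, hdt, hdt, F.η₁, F.η₂] at e12
    rw [mvfderiv_congr i1, mvfderiv_eventually_const i3, b1, mvfderiv_comp_hasDerivAt hcq.1 htd,
      hdt, S.η_ξ] at e31
    rw [mvfderiv_congr i2, mvfderiv_eventually_const i3, b2, mvfderiv_comp_hasDerivAt hcq.2.1 htd,
      hdt, S.η_ξ] at e32
    simp only [map_add, map_smul, map_zero, smul_eq_mul, i1.self_of_nhds, i2.self_of_nhds, hmq,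
      mul_zero, sub_zero, mul_one] at e12 e31 e32
    intro a b
    rw [F.sum_eq a, F.sum_eq b]
    generalize S.g.inner q a (e₁ q) = a₁
    generalize S.g.inner q a (e₂ q) = a₂
    generalize S.η q a = a₃
    generalize S.g.inner q b (e₁ q) = b₁
    generalize S.g.inner q b (e₂ q) = b₂
    generalize S.η q b = b₃
    simp only [map_add, map_smul, _root_.add_apply, _root_.smul_apply, smul_eq_mul]
    linear_combination (a₁ * b₂ - a₂ * b₁) * e12 + (a₃ * b₁ - a₁ * b₃) * e31
      + (a₃ * b₂ - a₂ * b₃) * e32)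
  refine ⟨x, hx.mono fun q hq ↦ ⟨hq.1, fun w ↦ ?_⟩⟩
  rw [hq.2]
  simp [V, S.g.symm q w]

/-- At `q`, the differentials of the coordinates of `e` have coefficients `(u, v)`, `(u', v')`
with respect to an adapted frame, and the third coordinate has differential `η`. -/
structure IsFrameChart (S : AlmostContactMetric 3 M)
    (e : OpenPartialHomeomorph M (EuclideanSpace ℝ (Fin 3))) (e₁ e₂ : VecField 3 M)
    (u v u' v' : ℝ → ℝ) (q : M) : Prop where
  frame : IsAdaptedFrame S (Real.exp (-2 * e q 2)) e₁ e₂ q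
  det : u (e q 2) * v' (e q 2) - v (e q 2) * u' (e q 2) = Real.exp (-2 * e q 2)
  form₀ : ∀ w : TangentSpace (𝓡 3) q, coordForm e 0 q w =
    u (e q 2) * S.g.inner q w (e₁ q) + v (e q 2) * S.g.inner q w (e₂ q)
  form₁ : ∀ w : TangentSpace (𝓡 3) q, coordForm e 1 q w =
    u' (e q 2) * S.g.inner q w (e₁ q) + v' (e q 2) * S.g.inner q w (e₂ q)
  form₂ : ∀ w : TangentSpace (𝓡 3) q, coordForm e 2 q w = S.η q w

/-- Two independent solutions of the linear system give closed forms with primitives `x₀, x₁`.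
Together with `t` these have independent differentials, since the determinant is `exp(-2t) ≠ 0`. -/
lemma exists_frameChart (hS : S.IsAlmostKenmotsu) (hK : S.IsGeneralizedKMu k μ)
    (hμ : ContMDiff (𝓡 3) 𝓘(ℝ, ℝ) ∞ μ) (ht : ContMDiff (𝓡 3) 𝓘(ℝ, ℝ) ∞ t)
    (hdt : ∀ (q : M) (v : TangentSpace (𝓡 3) q), mvfderiv (𝓡 3) t q v = S.η q v)
    (hk : ∀ q, k q = -1 - Real.exp (-4 * t q)) (p : M) :
    ∃ e ∈ IsManifold.maximalAtlas (𝓡 3) ∞ M, p ∈ e.source ∧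
      ∃ (e₁ e₂ : VecField 3 M) (m u v u' v' : ℝ → ℝ), ∀ q ∈ e.source,
        IsFrameChart S e e₁ e₂ u v u' v' q ∧ e q 2 = t q ∧ μ q = m (e q 2) ∧
          IsCoeff m u v (e q 2) ∧ IsCoeff m u' v' (e q 2) := by
  have hl : ∀ q, 0 < Real.exp (-2 * t q) ∧
      MDifferentiableAt (𝓡 3) 𝓘(ℝ, ℝ) (fun q ↦ Real.exp (-2 * t q)) q ∧
      ∀ v : TangentSpace (𝓡 3) q, mvfderiv (𝓡 3) (fun q ↦ Real.exp (-2 * t q)) q v =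
        -2 * Real.exp (-2 * t q) * S.η q v := by
    intro q
    have htd := (ht q).mdifferentiableAt (by simp : (∞ : WithTop ℕ∞) ≠ 0)
    have hexp : HasDerivAt (fun s : ℝ ↦ Real.exp (-2 * s)) (Real.exp (-2 * t q) * -2) (t q) := by
      simpa using ((hasDerivAt_id (t q)).const_mul (-2)).exp
    refine ⟨Real.exp_pos _, mdifferentiableAt_comp_hasDerivAt (u := t) hexp htd, fun v ↦ ?_⟩
    rw [mvfderiv_comp_hasDerivAt hexp htd, hdt]
    ring
  obtain ⟨e₁, e₂, hF⟩ := hS.exists_adaptedFrame (l := fun q ↦ Real.exp (-2 * t q)) (p := p)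
    (Eventually.of_forall fun q ↦ ⟨by
      have h1 : ContDiff ℝ ∞ fun s : ℝ ↦ Real.exp (-2 * s) := by fun_prop
      exact ContMDiffAt.comp (I' := 𝓘(ℝ, ℝ)) (g := fun s : ℝ ↦ Real.exp (-2 * s)) (f := t) q
        h1.contDiffAt.contMDiffAt (ht q), Real.exp_pos _, fun v ↦ by
      rw [hS.B_B hK, hk, ← Real.exp_nat_mul]
      congr 1
      push_cast
      ring_nf⟩)
  obtain ⟨m, hm, hμm⟩ := exists_factor_of_mvfderiv (p := p) (t := t) (μ := μ)
    (Eventually.of_forall ht) (Eventually.of_forall hμ) ⟨S.ξ p, by simp [hdt, S.η_ξ]⟩ (by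
      filter_upwards [hF.eventually_nhds] with q hFq v hv
      rw [hdt] at hv
      exact IsAdaptedFrame.mvfderiv_μ_eq_zero hS hK hFq (Eventually.of_forall hl)
        ((hμ q).mdifferentiableAt (by simp)) hv)
  -- The two initial vectors `(1, 0)` and `(0, exp(-2t(p)))` are chosen so that the determinant is
  -- exactly `exp(-2t)`; this normalises `Φ₁₂` to `exp(2t)`.
  obtain ⟨u, v, hu0, hv0, h⟩ := exists_isCoeff hm 1 0
  obtain ⟨u', v', hu0', hv0', h'⟩ := exists_isCoeff hm 0 (Real.exp (-2 * t p))
  have hdet := IsCoeff.det_eq h h' (by rw [hu0, hv0, hu0', hv0']; ring)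
  obtain ⟨x₀, hx₀⟩ := exists_coord_of_isCoeff hS hK ht hdt hF hμm h
  obtain ⟨x₁, hx₁⟩ := exists_coord_of_isCoeff hS hK ht hdt hF hμm h'
  have htc : ContinuousAt t p := ht.continuous.continuousAt
  have hall := hF.and (hμm.and ((htc.eventually h).and ((htc.eventually h').and
    ((htc.eventually hdet).and (hx₀.and hx₁)))))
  obtain ⟨e, he, hp, hex⟩ := exists_chart_of_coord (x := ![x₀, x₁, t]) (by
    filter_upwards [hall] with q ⟨F, _, _, _, hd, h0, h1⟩
    refine ⟨fun i ↦ ?_, fun w hw ↦ ?_⟩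
    · fin_cases i
      exacts [h0.1, h1.1, ht q]
    · have w0 : mvfderiv (𝓡 3) x₀ q w = 0 := hw 0
      have w1 : mvfderiv (𝓡 3) x₁ q w = 0 := hw 1
      have w2 : mvfderiv (𝓡 3) t q w = 0 := hw 2
      rw [h0.2] at w0
      rw [h1.2] at w1
      rw [hdt] at w2
      have hne := (Real.exp_pos (-2 * t q)).ne'
      rw [← hd] at hne
      have z1 : S.g.inner q w (e₁ q) = 0 := by
        apply mul_left_cancel₀ hne
        linear_combination v' (t q) * w0 - v (t q) * w1
      have z2 : S.g.inner q w (e₂ q) = 0 := by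
        apply mul_left_cancel₀ hne
        linear_combination -u' (t q) * w0 + u (t q) * w1
      rw [F.sum_eq w, z1, z2, w2]
      simp) hall
  have hform : ∀ q ∈ e.source, ∀ i, coordForm e i q = mvfderiv (𝓡 3) (![x₀, x₁, t] i) q := by
    intro q hq i
    refine mvfderiv_congr ?_
    filter_upwards [e.open_source.mem_nhds hq] with q' hq' using (hex q' hq').1 i
  refine ⟨e, he, hp, e₁, e₂, m, u, v, u', v', fun q hq ↦ ?_⟩
  obtain ⟨hcoord, F, hmq, hc, hc', hd, h0, h1⟩ := hex q hq
  have hte : e q 2 = t q := hcoord 2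
  rw [hte]
  refine ⟨⟨?_, ?_, fun w ↦ ?_, fun w ↦ ?_, fun w ↦ ?_⟩, rfl, hmq, hc, hc'⟩
  · rw [hte]; exact F
  · rw [hte]; exact hd
  · rw [hte, hform q hq]; exact h0.2 w
  · rw [hte, hform q hq]; exact h1.2 w
  · rw [hform q hq]; exact hdt q w

end

/-! ### Components of the tensors in the chart -/

section

variable {M : Type*} [TopologicalSpace M]
  [ChartedSpace (EuclideanSpace ℝ (Fin 3)) M] [IsManifold (𝓡 3) ∞ M]
  {S : AlmostContactMetric 3 M} {e : OpenPartialHomeomorph M (EuclideanSpace ℝ (Fin 3))}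
  {e₁ e₂ : VecField 3 M} {u v u' v' : ℝ → ℝ}

namespace IsFrameChart

section Pointwise

variable {q : M} (C : IsFrameChart S e e₁ e₂ u v u' v' q)
  (he : e ∈ IsManifold.maximalAtlas (𝓡 3) ∞ M) (hq : q ∈ e.source)
include C he hq

lemma frame₁_eq : e₁ q = u (e q 2) • coordField e 0 q + u' (e q 2) • coordField e 1 q := by
  have h := sum_coordForm_smul he hq (e₁ q)
  rw [Fin.sum_univ_three, C.form₀, C.form₁, C.form₂, C.frame.inner₁₁, C.frame.inner₁₂,
    C.frame.η₁] at h
  simpa using h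

lemma frame₂_eq : e₂ q = v (e q 2) • coordField e 0 q + v' (e q 2) • coordField e 1 q := by
  have h := sum_coordForm_smul he hq (e₂ q)
  rw [Fin.sum_univ_three, C.form₀, C.form₁, C.form₂, C.frame.inner₂₁, C.frame.inner₂₂,
    C.frame.η₂] at h
  simpa using h

lemma ξ_eq : S.ξ q = coordField e 2 q := by
  have h := sum_coordForm_smul he hq (S.ξ q)
  rw [Fin.sum_univ_three, C.form₀, C.form₁, C.form₂, S.inner_ξ, S.inner_ξ, C.frame.η₁,
    C.frame.η₂, S.η_ξ] at h
  simpa using h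

/-- Cramer's rule for `frame₁_eq` and `frame₂_eq`; the factor `exp(2t)` is the inverse determinant.
-/
lemma coordField_zero_eq : coordField e 0 q =
    Real.exp (2 * e q 2) • (v' (e q 2) • e₁ q - u' (e q 2) • e₂ q) := by
  have h : Real.exp (2 * e q 2) * Real.exp (-2 * e q 2) = 1 := by
    rw [← Real.exp_add, neg_mul, add_neg_cancel, Real.exp_zero]
  rw [C.frame₁_eq he hq, C.frame₂_eq he hq]
  have h1 : Real.exp (2 * e q 2) * (u (e q 2) * v' (e q 2) - v (e q 2) * u' (e q 2)) = 1 := by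
    rw [C.det, h]
  calc coordField e 0 q = (1 : ℝ) • coordField e 0 q := (one_smul _ _).symm
    _ = _ := by rw [← h1]; module

lemma coordField_one_eq : coordField e 1 q =
    Real.exp (2 * e q 2) • (u (e q 2) • e₂ q - v (e q 2) • e₁ q) := by
  have h : Real.exp (2 * e q 2) * Real.exp (-2 * e q 2) = 1 := by
    rw [← Real.exp_add, neg_mul, add_neg_cancel, Real.exp_zero]
  rw [C.frame₁_eq he hq, C.frame₂_eq he hq]
  have h1 : Real.exp (2 * e q 2) * (u (e q 2) * v' (e q 2) - v (e q 2) * u' (e q 2)) = 1 := by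
    rw [C.det, h]
  calc coordField e 1 q = (1 : ℝ) • coordField e 1 q := (one_smul _ _).symm
    _ = _ := by rw [← h1]; module

end Pointwise

/-- A tensor field with matrix `τ` in the adapted frame has components `a` in the coordinates,
where `a Q = Q τ` for the transition matrix `Q`. -/
lemma hasComponents (C : ∀ q ∈ e.source, IsFrameChart S e e₁ e₂ u v u' v' q)
    (he : e ∈ IsManifold.maximalAtlas (𝓡 3) ∞ M) {A : EndField 3 M}
    {a τ : ℝ → Matrix (Fin 2) (Fin 2) ℝ} (hξ : ∀ q ∈ e.source, A q (S.ξ q) = 0)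
    (h₁ : ∀ q ∈ e.source, A q (e₁ q) = τ (e q 2) 0 0 • e₁ q + τ (e q 2) 1 0 • e₂ q)
    (h₂ : ∀ q ∈ e.source, A q (e₂ q) = τ (e q 2) 0 1 • e₁ q + τ (e q 2) 1 1 • e₂ q)
    (ha : ∀ q ∈ e.source, a (e q 2) * !![u (e q 2), v (e q 2); u' (e q 2), v' (e q 2)] =
      !![u (e q 2), v (e q 2); u' (e q 2), v' (e q 2)] * τ (e q 2)) :
    HasComponents e A a := by
  intro q hq w
  have hC := C q hq
  have ha := ha q hq
  have a00 := congrFun (congrFun ha 0) 0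
  have a01 := congrFun (congrFun ha 0) 1
  have a10 := congrFun (congrFun ha 1) 0
  have a11 := congrFun (congrFun ha 1) 1
  simp only [Matrix.mul_apply, Fin.sum_univ_two, Matrix.of_apply, Matrix.cons_val',
    Matrix.cons_val_zero, Matrix.cons_val_one, Matrix.cons_val_fin_one] at a00 a01 a10 a11
  simp only [Fin.sum_univ_two, Fin.castSucc_zero, Fin.castSucc_one, hC.form₀, hC.form₁]
  conv_lhs => rw [hC.frame.sum_eq w]
  generalize S.g.inner q w (e₁ q) = x
  generalize S.g.inner q w (e₂ q) = y
  simp only [map_add, map_smul, hξ q hq, h₁ q hq, h₂ q hq]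
  rw [hC.frame₁_eq he hq, hC.frame₂_eq he hq]
  have k0 : x * (τ (e q 2) 0 0 * u (e q 2) + τ (e q 2) 1 0 * v (e q 2))
      + y * (τ (e q 2) 0 1 * u (e q 2) + τ (e q 2) 1 1 * v (e q 2)) =
      a (e q 2) 0 0 * (u (e q 2) * x + v (e q 2) * y)
      + a (e q 2) 0 1 * (u' (e q 2) * x + v' (e q 2) * y) := by
    linear_combination -x * a00 - y * a01
  have k1 : x * (τ (e q 2) 0 0 * u' (e q 2) + τ (e q 2) 1 0 * v' (e q 2))
      + y * (τ (e q 2) 0 1 * u' (e q 2) + τ (e q 2) 1 1 * v' (e q 2)) =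
      a (e q 2) 1 0 * (u (e q 2) * x + v (e q 2) * y)
      + a (e q 2) 1 1 * (u' (e q 2) * x + v' (e q 2) * y) := by
    linear_combination -x * a10 - y * a11
  refine Eq.trans (b := (_ : ℝ) • coordField e 0 q + (_ : ℝ) • coordField e 1 q) ?_
    (Eq.trans (congrArg₂ (fun α β : ℝ ↦ α • coordField e 0 q + β • coordField e 1 q) k0 k1) ?_)
  · module
  · module

end IsFrameChart

/-- The components of `φ` in the coordinates with transition matrix `!![u, v; u', v']`. -/
def φComponents (u v u' v' : ℝ → ℝ) (s : ℝ) : Matrix (Fin 2) (Fin 2) ℝ :=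
  !![-Real.exp (2 * s) * (u s * u' s + v s * v' s), Real.exp (2 * s) * (u s * u s + v s * v s);
    -Real.exp (2 * s) * (u' s * u' s + v' s * v' s), Real.exp (2 * s) * (u s * u' s + v s * v' s)]

/-- The components of `h` in the coordinates with transition matrix `!![u, v; u', v']`. -/
def hComponents (u v u' v' : ℝ → ℝ) (s : ℝ) : Matrix (Fin 2) (Fin 2) ℝ :=
  !![v s * v' s - u s * u' s, u s * u s - v s * v s;
    v' s * v' s - u' s * u' s, u s * u' s - v s * v' s]

/-- The components of `B` in the coordinates with transition matrix `!![u, v; u', v']`. -/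
def BComponents (u v u' v' : ℝ → ℝ) (s : ℝ) : Matrix (Fin 2) (Fin 2) ℝ :=
  !![u s * v' s + v s * u' s, -2 * (u s * v s);
    2 * (u' s * v' s), -(u s * v' s + v s * u' s)]

/-- The components of `g` in the coordinates with transition matrix `!![u, v; u', v']`. -/
def gComponents (u v u' v' : ℝ → ℝ) (s : ℝ) : Matrix (Fin 2) (Fin 2) ℝ :=
  Real.exp (2 * s) ^ 2 • !![u' s * u' s + v' s * v' s, -(u s * u' s + v s * v' s);
    -(u s * u' s + v s * v' s), u s * u s + v s * v s]

section Derivatives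

variable {m : ℝ → ℝ} {s : ℝ} (h : IsCoeff m u v s) (h' : IsCoeff m u' v' s)
include h h'

/-- In the product rule the terms in `μ` cancel and the factor `exp(2s)` absorbs the damping. What
remains carries `exp(2s)λ = 1`, which removes the exponential. -/
lemma hasDerivAt_φComponents (i j : Fin 2) :
    HasDerivAt (fun s ↦ φComponents u v u' v' s i j) (2 * hComponents u v u' v' s i j) s := by
  obtain ⟨hu, hv, -⟩ := h
  obtain ⟨hu', hv', -⟩ := h'
  have hE : HasDerivAt (fun s : ℝ ↦ Real.exp (2 * s)) (Real.exp (2 * s) * 2) s := by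
    simpa using ((hasDerivAt_id s).const_mul 2).exp
  have hl : Real.exp (2 * s) * Real.exp (-2 * s) = 1 := by
    rw [← Real.exp_add, neg_mul, add_neg_cancel, Real.exp_zero]
  fin_cases i <;> fin_cases j
  · refine (hE.fun_neg.fun_mul ((hu.fun_mul hu').fun_add (hv.fun_mul hv'))).congr_deriv ?_
    simp [hComponents]
    rw [neg_mul] at hl
    linear_combination (-2 * u s * u' s + 2 * v s * v' s) * hl
  · refine (hE.fun_mul ((hu.fun_mul hu).fun_add (hv.fun_mul hv))).congr_deriv ?_
    simp [hComponents]
    rw [neg_mul] at hl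
    linear_combination (2 * u s * u s - 2 * v s * v s) * hl
  · refine (hE.fun_neg.fun_mul ((hu'.fun_mul hu').fun_add (hv'.fun_mul hv'))).congr_deriv ?_
    simp [hComponents]
    rw [neg_mul] at hl
    linear_combination (-2 * u' s * u' s + 2 * v' s * v' s) * hl
  · refine (hE.fun_mul ((hu.fun_mul hu').fun_add (hv.fun_mul hv'))).congr_deriv ?_
    simp [hComponents]
    rw [neg_mul] at hl
    linear_combination (2 * u s * u' s - 2 * v s * v' s) * hl

lemma hasDerivAt_hComponents (i j : Fin 2) :
    HasDerivAt (fun s ↦ hComponents u v u' v' s i j)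
      (2 * Real.exp (-2 * s) ^ 2 * φComponents u v u' v' s i j - 2 * hComponents u v u' v' s i j
        - m s * BComponents u v u' v' s i j) s := by
  obtain ⟨hu, hv, -⟩ := h
  obtain ⟨hu', hv', -⟩ := h'
  have hl : Real.exp (2 * s) * Real.exp (-2 * s) = 1 := by
    rw [← Real.exp_add, neg_mul, add_neg_cancel, Real.exp_zero]
  fin_cases i <;> fin_cases j
  · refine ((hv.fun_mul hv').fun_sub (hu.fun_mul hu')).congr_deriv ?_
    simp [hComponents, φComponents, BComponents]
    rw [neg_mul] at hl
    linear_combination 2 * Real.exp (-(2 * s)) * (u s * u' s + v s * v' s) * hl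
  · refine ((hu.fun_mul hu).fun_sub (hv.fun_mul hv)).congr_deriv ?_
    simp [hComponents, φComponents, BComponents]
    rw [neg_mul] at hl
    linear_combination -2 * Real.exp (-(2 * s)) * (u s * u s + v s * v s) * hl
  · refine ((hv'.fun_mul hv').fun_sub (hu'.fun_mul hu')).congr_deriv ?_
    simp [hComponents, φComponents, BComponents]
    rw [neg_mul] at hl
    linear_combination 2 * Real.exp (-(2 * s)) * (u' s * u' s + v' s * v' s) * hl
  · refine ((hu.fun_mul hu').fun_sub (hv.fun_mul hv')).congr_deriv ?_
    simp [hComponents, φComponents, BComponents]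
    rw [neg_mul] at hl
    linear_combination -2 * Real.exp (-(2 * s)) * (u s * u' s + v s * v' s) * hl

lemma hasDerivAt_BComponents (i j : Fin 2) :
    HasDerivAt (fun s ↦ BComponents u v u' v' s i j)
      (m s * hComponents u v u' v' s i j - 2 * BComponents u v u' v' s i j) s := by
  obtain ⟨hu, hv, -⟩ := h
  obtain ⟨hu', hv', -⟩ := h'
  fin_cases i <;> fin_cases j
  · refine ((hu.fun_mul hv').fun_add (hv.fun_mul hu')).congr_deriv ?_
    simp [hComponents, BComponents]
    ring
  · refine ((hu.fun_mul hv).const_mul (-2)).congr_deriv ?_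
    simp [hComponents, BComponents]
    ring
  · refine ((hu'.fun_mul hv').const_mul 2).congr_deriv ?_
    simp [hComponents, BComponents]
    ring
  · refine ((hu.fun_mul hv').fun_add (hv.fun_mul hu')).fun_neg.congr_deriv ?_
    simp [hComponents, BComponents]
    ring

end Derivatives

/-- In the adapted frame `φ, h, B` have simple matrices `τ`. Their coordinate components are `QτQ⁻¹`
with `Q = !![u, v; u', v']` and `det Q = exp(-2t)`, so every check is a polynomial identity modulo
the value of the determinant. -/
theorem isNormalForm_of_isFrameChart {k μ t : M → ℝ} {m : ℝ → ℝ} (hS : S.IsAlmostKenmotsu)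
    (he : e ∈ IsManifold.maximalAtlas (𝓡 3) ∞ M) (hk : ∀ q, k q = -1 - Real.exp (-4 * t q))
    (H : ∀ q ∈ e.source, IsFrameChart S e e₁ e₂ u v u' v' q ∧ e q 2 = t q ∧ μ q = m (e q 2) ∧
      IsCoeff m u v (e q 2) ∧ IsCoeff m u' v' (e q 2)) :
    IsNormalForm S k μ e m (φComponents u v u' v') (hComponents u v u' v')
      (BComponents u v u' v') (gComponents u v u' v') := by
  have C := fun q hq ↦ (H q hq).1
  have hl : ∀ s : ℝ, Real.exp (2 * s) * Real.exp (-2 * s) = 1 := fun s ↦ by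
    rw [← Real.exp_add, neg_mul, add_neg_cancel, Real.exp_zero]
  have hEd : ∀ q ∈ e.source, Real.exp (2 * e q 2) *
      (u (e q 2) * v' (e q 2) - v (e q 2) * u' (e q 2)) = 1 := fun q hq ↦ by
    rw [(C q hq).det, hl]
  refine ⟨fun q hq ↦ ?_, fun q hq ↦ (H q hq).2.2.1, ?_, fun q hq ↦ (C q hq).ξ_eq he hq,
    fun q hq ↦ ?_, fun q hq a b ↦ ?_, fun q hq ↦ ?_, fun q hq ↦ ?_, fun q hq ↦ ?_, ?_, ?_,
    fun q hq ↦ ?_, fun q hq ↦ hasDerivAt_φComponents (H q hq).2.2.2.1 (H q hq).2.2.2.2,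
    fun q hq ↦ hasDerivAt_hComponents (H q hq).2.2.2.1 (H q hq).2.2.2.2,
    fun q hq ↦ hasDerivAt_BComponents (H q hq).2.2.2.1 (H q hq).2.2.2.2⟩
  · rw [hk, (H q hq).2.1]
  · refine IsFrameChart.hasComponents C he (τ := fun _ ↦ !![0, 1; -1, 0])
      (fun q _ ↦ S.φ_ξ q) (fun q hq ↦ by simp [(C q hq).frame.φ₁])
      (fun q hq ↦ by simp [(C q hq).frame.φ₂]) fun q hq ↦ ?_
    have hd := hEd q hq
    ext i j
    fin_cases i <;> fin_cases j <;> simp [φComponents, Matrix.mul_apply, Fin.sum_univ_two]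
    · linear_combination -v (e q 2) * hd
    · linear_combination u (e q 2) * hd
    · linear_combination -v' (e q 2) * hd
    · linear_combination u' (e q 2) * hd
  · ext1 w
    exact ((C q hq).form₂ w).symm
  · have hC := C q hq
    have hd := hEd q hq
    simp only [Fin.sum_univ_two, Fin.castSucc_zero, Fin.castSucc_one, hC.form₀, hC.form₁, hC.form₂]
    conv_lhs => rw [hC.frame.sum_eq a]
    simp only [map_add, map_smul, _root_.add_apply, _root_.smul_apply, smul_eq_mul, S.inner_ξ]
    rw [S.g.symm q (e₁ q) b, S.g.symm q (e₂ q) b]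
    simp [gComponents]
    -- With `D = exp(2t) det Q`, the components of `g` give `D²` times the horizontal inner product,
    -- and `D² - 1 = (D + 1)(D - 1)`.
    linear_combination (-1) * (S.g.inner q a (e₁ q) * S.g.inner q b (e₁ q)
      + S.g.inner q a (e₂ q) * S.g.inner q b (e₂ q)) * (Real.exp (2 * e q 2) *
      (u (e q 2) * v' (e q 2) - v (e q 2) * u' (e q 2)) + 1) * hd
  · have hC := C q hq
    have F := hC.frame
    have hd := hEd q hq
    rw [AlmostContactMetric.Φ, hC.coordField_zero_eq he hq, hC.coordField_one_eq he hq]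
    simp only [map_sub, map_smul, _root_.sub_apply, _root_.smul_apply, smul_eq_mul, F.φ₁, F.φ₂,
      map_neg, F.inner₁₁, F.inner₁₂, F.inner₂₁, F.inner₂₂]
    linear_combination Real.exp (2 * e q 2) * hd
  · rw [AlmostContactMetric.Φ, ← (C q hq).ξ_eq he hq, S.φ_ξ, map_zero]
  · rw [AlmostContactMetric.Φ, ← (C q hq).ξ_eq he hq, S.φ_ξ, map_zero]
  · refine IsFrameChart.hasComponents C he
      (τ := fun s ↦ !![0, Real.exp (-2 * s); Real.exp (-2 * s), 0])
      (fun q _ ↦ hS.h_ξ q) (fun q hq ↦ by simp [(C q hq).frame.h₁])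
      (fun q hq ↦ by simp [(C q hq).frame.h₂]) fun q hq ↦ ?_
    have hd := (C q hq).det
    ext i j
    fin_cases i <;> fin_cases j <;>
      simp [hComponents, Matrix.mul_apply, Fin.sum_univ_two] <;> rw [neg_mul] at hd
    · linear_combination v (e q 2) * hd
    · linear_combination u (e q 2) * hd
    · linear_combination v' (e q 2) * hd
    · linear_combination u' (e q 2) * hd
  · refine IsFrameChart.hasComponents C he
      (τ := fun s ↦ !![Real.exp (-2 * s), 0; 0, -Real.exp (-2 * s)])
      (fun q _ ↦ hS.B_ξ q) (fun q hq ↦ by simp [(C q hq).frame.B₁])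
      (fun q hq ↦ by simp [(C q hq).frame.B₂]) fun q hq ↦ ?_
    have hd := (C q hq).det
    ext i j
    fin_cases i <;> fin_cases j <;>
      simp [BComponents, Matrix.mul_apply, Fin.sum_univ_two] <;> rw [neg_mul] at hd
    · linear_combination u (e q 2) * hd
    · linear_combination -v (e q 2) * hd
    · linear_combination u' (e q 2) * hd
    · linear_combination -v' (e q 2) * hd
  · have hd := (C q hq).det
    have h4 : Real.exp (-4 * e q 2) =
        (u (e q 2) * v' (e q 2) - v (e q 2) * u' (e q 2)) ^ 2 := by
      rw [hd, ← Real.exp_nat_mul]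
      push_cast
      ring_nf
    rw [h4]
    ext i j
    fin_cases i <;> fin_cases j <;> simp [BComponents, Matrix.mul_apply, Fin.sum_univ_two] <;> ring

end

end AlmostKenmotsu

end

/-! ### The equivalence -/

theorem theorem6p2 {M : Type*} [TopologicalSpace M] [T2Space M] [ConnectedSpace M]
    [ChartedSpace (EuclideanSpace ℝ (Fin 3)) M] [IsManifold (𝓡 3) ∞ M]
    (S : AlmostKenmotsu.AlmostContactMetric 3 M) (hS : S.IsAlmostKenmotsu)
    (hh : ∃ p : M, S.h p ≠ 0)
    (k μ : M → ℝ) (hk : ContMDiff (𝓡 3) 𝓘(ℝ, ℝ) ∞ k) (hμ : ContMDiff (𝓡 3) 𝓘(ℝ, ℝ) ∞ μ)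
    (hdk : ∀ (p : M) (v w : TangentSpace (𝓡 3) p),
      mvfderiv (𝓡 3) k p v * S.η p w - mvfderiv (𝓡 3) k p w * S.η p v = 0) :
    S.IsGeneralizedKMu k μ ↔
      ∀ p : M, ∃ e ∈ IsManifold.maximalAtlas (𝓡 3) ∞ M, p ∈ e.source ∧
        ∃ (m : ℝ → ℝ) (a b c G : ℝ → Matrix (Fin 2) (Fin 2) ℝ),
          AlmostKenmotsu.IsNormalForm S k μ e m a b c G := by
  refine ⟨fun hK p ↦ ?_, fun H ↦ AlmostKenmotsu.isGeneralizedKMu_of_isNormalForm hS H⟩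
  obtain ⟨t, ht, hdt, hkt⟩ := hS.exists_global_time hK hk hdk hh
  obtain ⟨e, he, hp, e₁, e₂, m, u, v, u', v', H⟩ :=
    AlmostKenmotsu.exists_frameChart hS hK hμ ht hdt hkt p
  exact ⟨e, he, hp, m, _, _, _, _, AlmostKenmotsu.isNormalForm_of_isFrameChart hS he hkt H⟩
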